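/- Let $L$ be a finite extension of $\mathbb{Q}_p$ with ring of integers $\mathcal O$, uniformizer $\varpi$ and residue field $k=\mathcal O/\varpi$, and let $G$ be a topological group that is locally pro-$p$. Let $\mathrm{Mod}^{\mathrm{pro\,aug}}_G(\mathcal O)$ be the category of profinite linearly topological $\mathcal O[[H]]$-modules ($H\subseteq G$ a compact open subgroup; the choice is irrelevant) with a compatible action of $\mathcal O[G]$ by continuous maps, with continuous $\mathcal O$-linear $G$-equivariant maps as morphisms. Equivalently, its objects are the profinite linearly topological $\mathcal O$-modules with a continuous $\mathcal O$-linear action of $G$. Let $\mathfrak C(\mathcal O)$ be a full (abelian) subcategory closed under arbitrary direct products and subquotients, in which every object is the inverse limit of its quotients of finite length, and let $\mathfrak C(k)$ be the full subcategory of objects killed by $\varpi$. Let $S$ be an irreducible object of $\mathfrak C(k)$ with $\mathrm{End}(S)=k$, let $\kappa\colon\widetilde P\twoheadrightarrow S$ be a projective envelope of $S$ in $\mathfrak C(\mathcal O)$, and put $\widetilde E=\mathrm{End}_{\mathfrak C(\mathcal O)}(\widetilde P)$. Let $Q$ be an object of finite length of $\mathfrak C(k)$, let $R=\mathrm{rad}\,Q$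 be the intersection of its maximal proper subobjects, and assume: - (H0) $\mathrm{Hom}_{\mathfrak C(\mathcal O)}(\widetilde P[\varpi],R)=0$; - (H1) $\mathrm{Hom}_{\mathfrak C(k)}(Q,S')=0$ for every irreducible $S'\not\cong S$ of $\mathfrak C(k)$; - (H2) $S$ occurs in $Q$ as a subquotient with multiplicity one; - (H3) $\mathrm{Ext}^1_{\mathfrak C(k)}(Q,S')=0$ for every irreducible $S'\not\cong S$ of $\mathfrak C(k)$; - (H4) $\mathrm{Ext}^1_{\mathfrak C(k)}(Q,S)$ is finite dimensional over $k$; - (H5) $\mathrm{Ext}^2_{\mathfrak C(k)}(Q,R)=0$. Let $\mathfrak A$ be the category of finite local artinian, possibly non-commutative, $\mathcal O$-algebras $(A,\mathfrak m_A)$ such that the image of $\mathcal O$ in $A$ is central and $\mathcal O\to A$ induces an isomorphism $k\cong A/\mathfrak m_A$. Let $\widehat{\mathfrak A}$ be the category of local $\mathcal O$-algebras $B$ such that $B/\mathfrak m_B^n\in\mathfrak A$ for all $n\ge 1$ and $B\cong\varprojlim_n B/\mathfrak m_B^n$, with local $\mathcal O$-algebra homomorphisms. For $A\in\mathfrak A$,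 a deformation of $Q$ to $A$ is a pair $(M,\alpha)$, where $M$ is an object of $\mathfrak C(\mathcal O)$ with an $\mathcal O$-algebra map $A\to\mathrm{End}(M)$ that makes $M$ a flat $A$-module, and $\alpha\colon k\widehat\otimes_A M\cong Q$ is an isomorphism. Two deformations are isomorphic if there is an $A$-linear isomorphism in $\mathfrak C(\mathcal O)$ between them that is compatible with the maps to $Q$. Let $\mathrm{Def}_Q(A)$ be the set of isomorphism classes of deformations of $Q$ to $A$; it is a functor of $A$ by $M\mapsto A'\widehat\otimes_A M$. Then there is a non-zero morphism $\varphi_0\colon Q\to S$, and for every such $\varphi_0$ there is $\theta\colon\widetilde P\to Q$ with $\varphi_0\circ\theta=\kappa$. For every such $\varphi_0$ and $\theta$ the following hold. 1. $\widetilde E$ is an object of $\widehat{\mathfrak A}$, and so is its maximal commutative quotient $\widetilde E^{ab}$ (the quotient of $\widetilde E$ by the closure of the two-sided ideal generated by the commutators). 2. For every $A\in\mathfrak A$ and $\varphi\in\mathrm{Hom}_{\widehat{\mathfrak A}}(\widetilde E,A)$, the object $A\widehat\otimes_{\widetilde E,\varphi}\widetilde P$ together with the isomorphism $\alpha_\varphi\colon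 k\widehat\otimes_A(A\widehat\otimes_{\widetilde E,\varphi}\widetilde P)\cong Q$, $1\widehat\otimes(1\widehat\otimes v)\mapsto\theta(v)$, is a deformation of $Q$ to $A$. The map sending $\varphi$ to the class of this deformation induces a bijection from the set of $A^\times$-conjugacy classes in $\mathrm{Hom}_{\widehat{\mathfrak A}}(\widetilde E,A)$ onto $\mathrm{Def}_Q(A)$, and this bijection is natural in $A$. 3. For every commutative $A\in\mathfrak A$, composition with $\widetilde E\to\widetilde E^{ab}$ followed by this map is a bijection $\mathrm{Hom}_{\widehat{\mathfrak A}}(\widetilde E^{ab},A)\to\mathrm{Def}_Q(A)$. -/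

import Mathlib

open CategoryTheory CategoryTheory.Limits
open scoped TensorProduct

universe u

noncomputable section

/-- The objects of the category of profinite augmented representations of `G` over `O`: profinite
linearly topological `O`-modules `M` with a continuous action of `O[G]`.

For a compact open subgroup `H` of `G`, such an object is the same thing as a profinite linearly
topological `O[[H]]`-module with a compatible action of `O[G]` by continuous maps: by
compactness of `H`, joint continuity of the action means that `0` has a basis of open
`H`-stable `O`-submodules `U` such that `H` acts on the finite `O`-module `M / U` through a finite
quotient `H / N` with `N` open, i.e. that `M` is an inverse limit of finite discrete
`O[[H]]`-modules. The `O[[H]]`-structure is unique, as `O[H]` is dense in `O[[H]]`. -/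
structure ProAug (O G : Type u) [CommRing O] [Group G] [TopologicalSpace G] where
  carrier : Type u
  [addCommGroup : AddCommGroup carrier]
  [module : Module O carrier]
  [action : DistribMulAction G carrier]
  [smulComm : SMulCommClass G O carrier]
  [topology : TopologicalSpace carrier]
  [isTopologicalAddGroup : IsTopologicalAddGroup carrier]
  [continuousConstSMul : ContinuousConstSMul O carrier]
  [isLinearTopology : IsLinearTopology O carrier]
  [compactSpace : CompactSpace carrier]
  [t2Space : T2Space carrier]
  [continuousSMul : ContinuousSMul G carrier]

namespace ProAug

attribute [instance] addCommGroup module action smulComm topology isTopologicalAddGroup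
  continuousConstSMul isLinearTopology compactSpace t2Space continuousSMul

variable {O G : Type u} [CommRing O] [Group G] [TopologicalSpace G]

/-- The `O`-module of morphisms from `M` to `N`: continuous, `O`-linear, `G`-equivariant maps.
By density of `O[H]` they are `O[[H]]`-linear. -/
def homs (M N : ProAug O G) : Submodule O (M.carrier →L[O] N.carrier) where
  carrier := {f | ∀ (g : G) (x : M.carrier), f (g • x) = g • f x}
  add_mem' := fun ha hb g x => by simp [ha g x, hb g x]
  zero_mem' := fun g x => by simp
  smul_mem' := fun c f hf g x => by simp [hf g x, smul_comm]

instance : Category (ProAug O G) where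
  Hom M N := homs M N
  id M := ⟨ContinuousLinearMap.id O M.carrier, fun _ _ => rfl⟩
  comp f g := ⟨g.1.comp f.1, fun a x => by
    have h1 := f.2 a x
    have h2 := g.2 a (f.1 x)
    simp only [ContinuousLinearMap.comp_apply, h1, h2]⟩

/-- Value of a morphism at an element. -/
def app {M N : ProAug O G} (f : M ⟶ N) (x : M.carrier) : N.carrier := f.1 x

/-- Constructor for morphisms. -/
def mkHom {M N : ProAug O G} (f : M.carrier →L[O] N.carrier)
    (hf : ∀ (g : G) (x : M.carrier), f (g • x) = g • f x) : M ⟶ N := ⟨f, hf⟩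

@[simp] theorem mkHom_app {M N : ProAug O G} (f : M.carrier →L[O] N.carrier)
    (hf : ∀ (g : G) (x : M.carrier), f (g • x) = g • f x) (x : M.carrier) :
    app (mkHom f hf) x = f x := rfl

theorem hom_ext {M N : ProAug O G} {f g : M ⟶ N} (h : ∀ x, app f x = app g x) : f = g :=
  Subtype.ext (ContinuousLinearMap.ext h)

@[simp] theorem id_app (M : ProAug O G) (x : M.carrier) : app (𝟙 M) x = x := rfl

@[simp] theorem comp_app {M N K : ProAug O G} (f : M ⟶ N) (g : N ⟶ K) (x : M.carrier) :
    app (f ≫ g) x = app g (app f x) := rfl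

theorem app_add {M N : ProAug O G} (f : M ⟶ N) (x y : M.carrier) :
    app f (x + y) = app f x + app f y := map_add f.1 x y

theorem app_smul {M N : ProAug O G} (f : M ⟶ N) (r : O) (x : M.carrier) :
    app f (r • x) = r • app f x := map_smul f.1 r x

theorem app_zero {M N : ProAug O G} (f : M ⟶ N) : app f 0 = 0 := map_zero f.1

theorem app_action {M N : ProAug O G} (f : M ⟶ N) (g : G) (x : M.carrier) :
    app f (g • x) = g • app f x := f.2 g x

theorem app_continuous {M N : ProAug O G} (f : M ⟶ N) : Continuous (app f) := f.1.continuous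

instance : Preadditive (ProAug O G) where
  homGroup M N := inferInstanceAs (AddCommGroup (homs M N))
  add_comp _ _ _ f f' g := hom_ext fun x => app_add g (app f x) (app f' x)
  comp_add _ _ _ _ _ _ := rfl

instance : Linear O (ProAug O G) where
  homModule M N := inferInstanceAs (Module O (homs M N))
  smul_comp _ _ _ r f g := hom_ext fun x => app_smul g r (app f x)
  comp_smul _ _ _ _ _ _ := rfl

@[simp] theorem hom_add_app {M N : ProAug O G} (f g : M ⟶ N) (x : M.carrier) :
    app (f + g) x = app f x + app g x := rfl

@[simp] theorem hom_zero_app {M N : ProAug O G} (x : M.carrier) :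
    app (0 : M ⟶ N) x = 0 := rfl

@[simp] theorem hom_smul_app {M N : ProAug O G} (r : O) (f : M ⟶ N) (x : M.carrier) :
    app (r • f) x = r • app f x := rfl

/-- The subobjects of `M`: closed `G`-stable `O`-submodules, ordered by inclusion. -/
@[ext] structure Sub (M : ProAug O G) where
  toSubmodule : Submodule O M.carrier
  isClosed : IsClosed (toSubmodule : Set M.carrier)
  smul_mem : ∀ (g : G), ∀ x ∈ toSubmodule, g • x ∈ toSubmodule

instance (M : ProAug O G) : PartialOrder (Sub M) :=
  PartialOrder.lift Sub.toSubmodule fun _ _ h => Sub.ext h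

instance (M : ProAug O G) : BoundedOrder (Sub M) where
  top := ⟨⊤, isClosed_univ, fun _ _ _ => trivial⟩
  bot := ⟨⊥, by simp, fun g x hx => by
    rw [Submodule.mem_bot] at hx ⊢; rw [hx, smul_zero]⟩
  le_top N := (le_top : N.toSubmodule ≤ ⊤)
  bot_le N := (bot_le : ⊥ ≤ N.toSubmodule)

theorem linTop_of {A : Type u} [AddCommGroup A] [Module O A] [TopologicalSpace A]
    (h : ∀ V ∈ nhds (0 : A), ∃ U : Submodule O A, (U : Set A) ∈ nhds 0 ∧ (U : Set A) ⊆ V) :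
    IsLinearTopology O A where
  hasBasis_submodule' := Filter.hasBasis_iff.2 fun V =>
    ⟨fun hV => h V hV, fun ⟨_, hU, hUV⟩ => Filter.mem_of_superset hU hUV⟩

/-- A closed subrepresentation as an object. -/
def ofSub {M : ProAug O G} (N : Sub M) : ProAug O G :=
  letI : DistribMulAction G N.toSubmodule :=
    { smul := fun g x => ⟨g • x.1, N.smul_mem g x.1 x.2⟩
      one_smul := fun x => Subtype.ext (one_smul G x.1)
      mul_smul := fun g h x => Subtype.ext (mul_smul g h x.1)
      smul_zero := fun g => Subtype.ext (smul_zero g)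
      smul_add := fun g x y => Subtype.ext (smul_add g x.1 y.1) }
  haveI : SMulCommClass G O N.toSubmodule :=
    ⟨fun g r x => Subtype.ext (smul_comm g r x.1)⟩
  haveI : ContinuousConstSMul O N.toSubmodule :=
    ⟨fun r => Continuous.subtype_mk (continuous_subtype_val.const_smul r) _⟩
  haveI : CompactSpace N.toSubmodule := isCompact_iff_compactSpace.1 N.isClosed.isCompact
  haveI : IsLinearTopology O N.toSubmodule := linTop_of fun V hV => by
    rw [nhds_subtype_eq_comap, Filter.mem_comap] at hV
    obtain ⟨W, hW, hWV⟩ := hV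
    obtain ⟨U, hU, hUW⟩ := (IsLinearTopology.hasBasis_submodule O).mem_iff.1 hW
    refine ⟨U.comap N.toSubmodule.subtype, ?_, fun x hx => hWV (hUW hx)⟩
    exact continuous_subtype_val.continuousAt.preimage_mem_nhds hU
  haveI : ContinuousSMul G N.toSubmodule :=
    ⟨Continuous.subtype_mk (by fun_prop) _⟩
  { carrier := N.toSubmodule }

/-- The inclusion of a closed subrepresentation. -/
def subι {M : ProAug O G} (N : Sub M) : ofSub N ⟶ M :=
  mkHom (M := ofSub N) N.toSubmodule.subtypeL fun _ _ => rfl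

theorem subι_injective {M : ProAug O G} (N : Sub M) : Function.Injective (app (subι N)) :=
  Subtype.val_injective

/-- The quotient by a closed subrepresentation, with the quotient topology. -/
def quot {M : ProAug O G} (N : Sub M) : ProAug O G :=
  letI act : G → (M.carrier ⧸ N.toSubmodule) →ₗ[O] (M.carrier ⧸ N.toSubmodule) := fun g =>
    N.toSubmodule.mapQ N.toSubmodule (DistribSMul.toLinearMap O M.carrier g) (N.smul_mem g)
  letI : DistribMulAction G (M.carrier ⧸ N.toSubmodule) :=
    { smul := fun g x => act g x
      one_smul := fun x => by
        obtain ⟨x, rfl⟩ := N.toSubmodule.mkQ_surjective x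
        exact congrArg N.toSubmodule.mkQ (one_smul G x)
      mul_smul := fun g h x => by
        obtain ⟨x, rfl⟩ := N.toSubmodule.mkQ_surjective x
        exact congrArg N.toSubmodule.mkQ (mul_smul g h x)
      smul_zero := fun g => map_zero (act g)
      smul_add := fun g => map_add (act g) }
  haveI : SMulCommClass G O (M.carrier ⧸ N.toSubmodule) :=
    ⟨fun g r x => map_smul (act g) r x⟩
  haveI : ContinuousConstSMul O (M.carrier ⧸ N.toSubmodule) :=
    ⟨fun r => (N.toSubmodule.isOpenMap_mkQ.isQuotientMap N.toSubmodule.continuous_mkQ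
      N.toSubmodule.mkQ_surjective).continuous_iff.2
      (N.toSubmodule.continuous_mkQ.comp (continuous_const_smul r))⟩
  haveI : T2Space (M.carrier ⧸ N.toSubmodule) := by
    have : IsClosed (N.toSubmodule.toAddSubgroup : Set M.carrier) := N.isClosed
    exact (inferInstance : T2Space (M.carrier ⧸ N.toSubmodule.toAddSubgroup))
  haveI : CompactSpace (M.carrier ⧸ N.toSubmodule) := Quotient.compactSpace
  haveI : IsLinearTopology O (M.carrier ⧸ N.toSubmodule) := linTop_of fun V hV => by
    have hV' := (N.toSubmodule.continuous_mkQ).continuousAt.preimage_mem_nhds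
      (x := 0) (by simpa using hV)
    obtain ⟨U, hU, hUW⟩ := (IsLinearTopology.hasBasis_submodule O).mem_iff.1 hV'
    refine ⟨U.map N.toSubmodule.mkQ, ?_, ?_⟩
    · have := N.toSubmodule.isOpenMap_mkQ.image_mem_nhds hU
      simpa using this
    · rintro _ ⟨x, hx, rfl⟩
      exact hUW hx
  haveI : ContinuousSMul G (M.carrier ⧸ N.toSubmodule) := by
    refine ⟨?_⟩
    have hq : Topology.IsQuotientMap (Prod.map (id : G → G) N.toSubmodule.mkQ) :=
      (IsOpenMap.id.prodMap N.toSubmodule.isOpenMap_mkQ).isQuotientMap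
        (continuous_id.prodMap N.toSubmodule.continuous_mkQ)
        (Function.surjective_id.prodMap N.toSubmodule.mkQ_surjective)
    rw [hq.continuous_iff]
    exact N.toSubmodule.continuous_mkQ.comp (continuous_smul (M := G) (X := M.carrier))
  { carrier := M.carrier ⧸ N.toSubmodule }

/-- The projection to a quotient. -/
def quotπ {M : ProAug O G} (N : Sub M) : M ⟶ quot N :=
  mkHom (N := quot N) N.toSubmodule.mkQL fun _ _ => rfl

theorem quotπ_surjective {M : ProAug O G} (N : Sub M) : Function.Surjective (app (quotπ N)) :=
  N.toSubmodule.mkQ_surjective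

theorem quotπ_eq_zero {M : ProAug O G} (N : Sub M) (x : M.carrier) :
    app (quotπ N) x = 0 ↔ x ∈ N.toSubmodule :=
  Submodule.Quotient.mk_eq_zero _

/-- The morphism out of a quotient. -/
def quotDesc {M K : ProAug O G} (N : Sub M) (f : M ⟶ K)
    (hf : ∀ x ∈ N.toSubmodule, app f x = 0) : quot N ⟶ K :=
  mkHom (M := quot N)
    ⟨N.toSubmodule.liftQ f.1.toLinearMap hf,
      (N.toSubmodule.isOpenMap_mkQ.isQuotientMap N.toSubmodule.continuous_mkQ
        N.toSubmodule.mkQ_surjective).continuous_iff.2 f.1.continuous⟩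
    fun g x => by
      obtain ⟨x, rfl⟩ := N.toSubmodule.mkQ_surjective x
      exact f.2 g x

@[simp] theorem quotπ_desc {M K : ProAug O G} (N : Sub M) (f : M ⟶ K)
    (hf : ∀ x ∈ N.toSubmodule, app f x = 0) : quotπ N ≫ quotDesc N f hf = f := rfl

/-- The kernel of a morphism. -/
def ker {M N : ProAug O G} (f : M ⟶ N) : Sub M where
  toSubmodule := LinearMap.ker f.1.toLinearMap
  isClosed := isClosed_singleton.preimage f.1.continuous
  smul_mem g x hx := by
    have hx' : app f x = 0 := hx
    change app f (g • x) = 0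
    rw [app_action, hx', smul_zero]

/-- The image of a morphism. -/
def range {M N : ProAug O G} (f : M ⟶ N) : Sub N where
  toSubmodule := LinearMap.range f.1.toLinearMap
  isClosed := by
    exact (isCompact_range f.1.continuous).isClosed
  smul_mem g := by
    rintro _ ⟨x, rfl⟩
    exact ⟨g • x, app_action f g x⟩

/-- The morphism into a closed subrepresentation. -/
def subLift {M K : ProAug O G} (N : Sub M) (f : K ⟶ M)
    (hf : ∀ x, app f x ∈ N.toSubmodule) : K ⟶ ofSub N :=
  mkHom (N := ofSub N) (f.1.codRestrict N.toSubmodule hf) fun g x => Subtype.ext (f.2 g x)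

theorem mem_ker {M N : ProAug O G} (f : M ⟶ N) (x : M.carrier) :
    x ∈ (ker f).toSubmodule ↔ app f x = 0 := Iff.rfl

theorem injective_of_mono {M N : ProAug O G} (f : M ⟶ N) [Mono f] :
    Function.Injective (app f) := by
  have h : subι (ker f) = 0 := by
    rw [← cancel_mono f, zero_comp]
    exact hom_ext fun x => x.2
  refine (injective_iff_map_eq_zero f.1).2 fun x hx => ?_
  exact congrArg (fun φ => app φ (⟨x, hx⟩ : (ker f).toSubmodule)) h

theorem surjective_of_epi {M N : ProAug O G} (f : M ⟶ N) [Epi f] :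
    Function.Surjective (app f) := by
  have h : quotπ (range f) = 0 := by
    rw [← cancel_epi f]
    exact hom_ext fun x => (quotπ_eq_zero _ _).2 ⟨x, rfl⟩
  intro y
  have : app (quotπ (range f)) y = 0 := by rw [h]; rfl
  exact (quotπ_eq_zero _ _).1 this

theorem mono_of_injective {M N : ProAug O G} (f : M ⟶ N) (hf : Function.Injective (app f)) :
    Mono f :=
  ⟨fun _ _ h => hom_ext fun x => hf (congrArg (fun φ => app φ x) h)⟩

theorem epi_of_surjective {M N : ProAug O G} (f : M ⟶ N) (hf : Function.Surjective (app f)) :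
    Epi f :=
  ⟨fun _ _ h => hom_ext fun y => by
    obtain ⟨x, rfl⟩ := hf y
    exact congrArg (fun φ => app φ x) h⟩

/-- The product of a family of objects, with the product topology. -/
def pi {ι : Type u} (M : ι → ProAug O G) : ProAug O G :=
  haveI : IsLinearTopology O (∀ i, (M i).carrier) := linTop_of fun V hV => by
    rw [nhds_pi, Filter.mem_pi] at hV
    obtain ⟨I, hI, t, ht, htV⟩ := hV
    choose U hU hUt using fun i =>
      (IsLinearTopology.hasBasis_submodule (M := (M i).carrier) O).mem_iff.1 (ht i)
    refine ⟨Submodule.pi I U, ?_, ?_⟩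
    · exact set_pi_mem_nhds hI fun i _ => hU i
    · exact fun x hx => htV fun i hi => hUt i (hx i hi)
  { carrier := ∀ i, (M i).carrier }

/-- The projections of a product. -/
def piProj {ι : Type u} (M : ι → ProAug O G) (i : ι) : pi M ⟶ M i :=
  mkHom (M := pi M) (ContinuousLinearMap.proj i) fun _ _ => rfl

/-- The morphism to a product given by its components. -/
def piLift {ι : Type u} (M : ι → ProAug O G) {K : ProAug O G} (f : ∀ i, K ⟶ M i) : K ⟶ pi M :=
  mkHom (N := pi M) (ContinuousLinearMap.pi fun i => (f i).1) fun g x =>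
    funext fun i => (f i).2 g x

/-- The product as a categorical product. -/
def piFan {ι : Type u} (M : ι → ProAug O G) : Fan M := Fan.mk (pi M) (piProj M)

/-- The universal property of the product. -/
def piFanIsLimit {ι : Type u} (M : ι → ProAug O G) : IsLimit (piFan M) :=
  Fan.IsLimit.mk _ (fun s => piLift M s.proj) (fun _ _ => rfl) fun s m hm => by
    refine hom_ext fun x => funext fun i => ?_
    exact congrArg (fun φ => app φ x) (hm i)

instance : HasProducts.{u} (ProAug O G) := fun _ =>
  ⟨fun F =>
    have : HasLimit (Discrete.functor (F.obj ∘ Discrete.mk)) := ⟨⟨⟨_, piFanIsLimit _⟩⟩⟩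
    hasLimit_of_iso (Discrete.natIsoFunctor (F := F)).symm⟩

instance : HasFiniteProducts (ProAug O G) := hasFiniteProducts_of_hasProducts _

instance : HasKernels (ProAug O G) where
  has_limit f := ⟨⟨⟨KernelFork.ofι (subι (ker f)) (hom_ext fun x => x.2),
    KernelFork.IsLimit.ofι _ _
      (fun g hg => subLift (ker f) g fun x => congrArg (fun φ => app φ x) hg)
      (fun _ _ => rfl)
      (fun _ _ _ hm => hom_ext fun x => Subtype.ext (congrArg (fun φ => app φ x) hm))⟩⟩⟩

instance : HasCokernels (ProAug O G) where
  has_colimit f := ⟨⟨⟨CokernelCofork.ofπ (quotπ (range f))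
      (hom_ext fun x => (quotπ_eq_zero _ _).2 ⟨x, rfl⟩),
    CokernelCofork.IsColimit.ofπ _ _
      (fun g hg => quotDesc (range f) g (by
        rintro _ ⟨x, rfl⟩
        exact congrArg (fun φ => app φ x) hg))
      (fun _ _ => rfl)
      (fun g hg m hm => hom_ext fun x => by
        obtain ⟨x, rfl⟩ := quotπ_surjective (range f) x
        exact congrArg (fun φ => app φ x) hm)⟩⟩⟩

/-- A bijective morphism is an isomorphism, by compactness. -/
def isoOfBijective {M N : ProAug O G} (f : M ⟶ N) (hf : Function.Bijective (app f)) : M ≅ N :=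
  let e := LinearEquiv.ofBijective f.1.toLinearMap hf
  { hom := f
    inv := mkHom ⟨e.symm.toLinearMap,
        ((app_continuous f).homeoOfEquivCompactToT2 (f := e.toEquiv)).symm.continuous⟩
      fun g x => by
        apply hf.1
        obtain ⟨y, rfl⟩ := hf.2 x
        have h1 : ∀ z, app f (e.symm z) = z := fun z => e.apply_symm_apply z
        have h2 : e.symm (app f y) = y := e.symm_apply_apply y
        change app f (e.symm (g • app f y)) = app f (g • e.symm (app f y))
        rw [h1, h2, app_action]
    hom_inv_id := hom_ext fun x => e.symm_apply_apply x
    inv_hom_id := hom_ext fun x => e.apply_symm_apply x }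

instance : IsNormalMonoCategory (ProAug O G) where
  normalMonoOfMono {M N} f hf := ⟨{
    Z := quot (range f)
    g := quotπ (range f)
    w := hom_ext fun x => (quotπ_eq_zero _ _).2 ⟨x, rfl⟩
    isLimit :=
      let e := isoOfBijective (subLift (range f) f fun x => ⟨x, rfl⟩)
        ⟨fun x y h => injective_of_mono f (congrArg Subtype.val h), by
          rintro ⟨_, x, rfl⟩; exact ⟨x, rfl⟩⟩
      KernelFork.IsLimit.ofι _ _
        (fun g hg => subLift (range f) g
          (fun x => (quotπ_eq_zero _ _).1 (congrArg (fun φ => app φ x) hg)) ≫ e.inv)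
        (fun g hg => by
          have h : e.inv ≫ f = subι (range f) := by rw [Iso.inv_comp_eq]; rfl
          rw [Category.assoc, h]; rfl)
        (fun g hg m hm => by rw [← cancel_mono f, hm, Category.assoc,
          show e.inv ≫ f = subι (range f) by rw [Iso.inv_comp_eq]; rfl]; rfl) }⟩

instance : IsNormalEpiCategory (ProAug O G) where
  normalEpiOfEpi {M N} f hf := ⟨{
    W := ofSub (ker f)
    g := subι (ker f)
    w := hom_ext fun x => x.2
    isColimit :=
      let e := isoOfBijective (quotDesc (ker f) f fun _ h => h)
        ⟨(injective_iff_map_eq_zero (quotDesc (ker f) f fun _ h => h).1).2 fun x hx => by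
            obtain ⟨x, rfl⟩ := quotπ_surjective (ker f) x
            exact (quotπ_eq_zero _ _).2 hx, fun y => by
          obtain ⟨x, rfl⟩ := surjective_of_epi f y
          exact ⟨app (quotπ (ker f)) x, rfl⟩⟩
      CokernelCofork.IsColimit.ofπ _ _
        (fun g hg => e.inv ≫ quotDesc (ker f) g fun x hx =>
          show app (subι (ker f) ≫ g) (⟨x, hx⟩ : (ker f).toSubmodule) = 0 by rw [hg]; rfl)
        (fun g hg => by
          have h : f ≫ e.inv = quotπ (ker f) := by rw [Iso.comp_inv_eq]; rfl
          rw [← Category.assoc, h]; rfl)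
        (fun g hg m hm => by
          rw [← cancel_epi f, hm, ← Category.assoc,
            show f ≫ e.inv = quotπ (ker f) by rw [Iso.comp_inv_eq]; rfl]; rfl) }⟩

/-- The category of profinite augmented representations is abelian. -/
instance : Abelian (ProAug O G) where

end ProAug

namespace ProAug

variable {O G : Type u} [CommRing O] [Group G] [TopologicalSpace G]

/-- A composition series: a chain of subobjects from `0` to `M` with irreducible successive
quotients. -/
def IsCompositionSeries (M : ProAug O G) {n : ℕ} (c : Fin (n + 1) → Sub M) : Prop :=
  c 0 = ⊥ ∧ c (Fin.last n) = ⊤ ∧ ∀ i : Fin n, c i.castSucc ⋖ c i.succ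

/-- `M` has a composition series, i.e. is of finite length. -/
def IsFiniteLength (M : ProAug O G) : Prop :=
  ∃ (n : ℕ) (c : Fin (n + 1) → Sub M), IsCompositionSeries M c

/-- For `N ≤ N'`: the quotient `N' / N` is isomorphic to `S`, i.e. there is a surjection from `N'`
to `S` with kernel `N`. -/
def QuotientIso {M : ProAug O G} (N N' : Sub M) (S : ProAug O G) : Prop :=
  ∃ f : ofSub N' ⟶ S, Function.Surjective (app f) ∧
    ∀ x : (ofSub N').carrier, app f x = 0 ↔ app (subι N') x ∈ N.toSubmodule

/-- The irreducible object `S` occurs in the finite length object `M` with multiplicity one: exactly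
one successive quotient of a composition series is isomorphic to `S` (by Jordan--Hölder the
choice of the series is irrelevant). -/
def HasMultiplicityOne (S M : ProAug O G) : Prop :=
  ∃ (n : ℕ) (c : Fin (n + 1) → Sub M), IsCompositionSeries M c ∧
    ∃! i : Fin n, QuotientIso (c i.castSucc) (c i.succ) S

/-- `rad M`: the intersection of all maximal proper subobjects of `M`. -/
def rad (M : ProAug O G) : Sub M where
  toSubmodule := ⨅ N : {N : Sub M // IsCoatom N}, N.1.toSubmodule
  isClosed := by
    rw [Submodule.coe_iInf]
    exact isClosed_iInter fun N => N.1.isClosed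
  smul_mem g x hx := by
    rw [Submodule.mem_iInf] at hx ⊢
    exact fun N => N.1.smul_mem g x (hx N)

/-- `C` defines a locally finite dual category: a full subcategory of the category of profinite
augmented representations, closed under subobjects, quotients and arbitrary products (hence
abelian), such that every object `M` is the inverse limit of its quotients of finite length.
As `M` is compact and its quotients of finite length form an inverse system, the map from `M` to
their limit is always surjective, and open onto its image; so the last condition says that this
map is injective, i.e. that every `x ≠ 0` has a nonzero image in some finite length quotient. -/
class IsDualCat (C : ObjectProperty (ProAug O G)) : Prop where
  subobjects : C.IsClosedUnderSubobjects
  quotients : C.IsClosedUnderQuotients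
  products : ∀ ι : Type u, C.IsClosedUnderLimitsOfShape (Discrete ι)
  separated : ∀ M : ProAug O G, C M → ∀ x : M.carrier, x ≠ 0 →
    ∃ (N : ProAug O G) (f : M ⟶ N), Function.Surjective (app f) ∧ IsFiniteLength N ∧ app f x ≠ 0

attribute [instance] IsDualCat.subobjects IsDualCat.quotients IsDualCat.products

section
variable (C : ObjectProperty (ProAug O G)) [IsDualCat C]

instance : C.IsClosedUnderFiniteProducts :=
  ObjectProperty.IsClosedUnderFiniteProducts.of_isClosedUnderLimitsOfShape.{u} fun _ _ =>
    inferInstance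

theorem prop_pi {ι : Type u} (M : ι → ProAug O G) (h : ∀ i, C (M i)) : C (pi M) :=
  C.prop_of_isLimit (piFanIsLimit M) fun ⟨i⟩ => h i

instance : C.ContainsZero where
  exists_zero := by
    refine ⟨pi (fun i : PEmpty.{u + 1} => (i.elim : ProAug O G)),
      (IsZero.iff_id_eq_zero _).2 (hom_ext fun x => funext fun i => i.elim), ?_⟩
    exact prop_pi C _ fun i => i.elim

/-- The full subcategory is abelian. -/
instance : Abelian C.FullSubcategory := inferInstance

instance : HasExt.{u + 1} C.FullSubcategory := HasExt.standard _

/-- The full subcategory of the objects that are killed by `ϖ` (`C(k)` inside `C(O)`). -/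
def killedBy (C : ObjectProperty (ProAug O G)) (ϖ : O) : ObjectProperty (ProAug O G) :=
  fun M => C M ∧ ∀ x : M.carrier, ϖ • x = 0

theorem killedBy_le (C : ObjectProperty (ProAug O G)) (ϖ : O) : killedBy C ϖ ≤ C :=
  fun _ h => h.1

instance (ϖ : O) : IsDualCat (killedBy C ϖ) where
  subobjects := ⟨fun f _ h => ⟨C.prop_of_mono f h.1, fun x => injective_of_mono f (by
    rw [app_smul, h.2, app_zero])⟩⟩
  quotients := ⟨fun f _ h => ⟨C.prop_of_epi f h.1, fun y => by
    obtain ⟨x, rfl⟩ := surjective_of_epi f y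
    rw [← app_smul, h.2, app_zero]⟩⟩
  products ι := ⟨by
    rintro X ⟨p⟩
    refine ⟨C.prop_of_isLimit p.isLimit fun j => (p.prop_diag_obj j).1, fun x => ?_⟩
    have h : (ϖ • 𝟙 X : X ⟶ X) = 0 := p.isLimit.hom_ext fun j => hom_ext fun x => by
      have := (p.prop_diag_obj j).2 (app (p.π.app j) x)
      rw [← app_smul] at this
      refine this.trans ?_
      rw [zero_comp]
      rfl
    exact congrArg (fun φ => app φ x) h⟩
  separated M hM := IsDualCat.separated M hM.1

/-- The inclusion of `C(k)` into `C(O)`. -/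
abbrev incl (C : ObjectProperty (ProAug O G)) (ϖ : O) :
    (killedBy C ϖ).FullSubcategory ⥤ C.FullSubcategory :=
  ObjectProperty.ιOfLE (killedBy_le C ϖ)

variable {C}

/-- The radical, as an object of the full subcategory. -/
def radical (Q : C.FullSubcategory) : C.FullSubcategory :=
  ⟨ofSub (rad Q.obj),
    haveI := mono_of_injective _ (subι_injective (rad Q.obj))
    C.prop_of_mono (subι (rad Q.obj)) Q.property⟩

end

/-- The value of a morphism of the full subcategory at an element. -/
def ev {C : ObjectProperty (ProAug O G)} {M N : C.FullSubcategory} (f : M ⟶ N)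
    (x : M.obj.carrier) : N.obj.carrier := app f.hom x

/-- `κ : P ⟶ S` is a projective envelope: `P` is projective and `κ` is an essential epimorphism. -/
structure IsProjectiveEnvelope {D : Type*} [Category D] {P S : D} (κ : P ⟶ S) : Prop where
  projective : Projective P
  epi : Epi κ
  essential : ∀ {X : D} (g : X ⟶ P), Epi (g ≫ κ) → Epi g

/-- An object of `C` with an action of the `O`-algebra `R`, i.e. a map of `O`-algebras
`R → End(M)`. (In `End`, `f * g` is `f` after `g`, so these are left actions.) -/
structure CMod (C : ObjectProperty (ProAug O G)) (R : Type u) [Ring R] [Algebra O R] where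
  obj : C.FullSubcategory
  ρ : R →ₐ[O] End obj

namespace CMod

variable {C : ObjectProperty (ProAug O G)} {R : Type u} [Ring R] [Algebra O R]

/-- An object with the tautological action of its own endomorphism ring. -/
def taut (P : C.FullSubcategory) : CMod C (End P) := ⟨P, AlgHom.id O (End P)⟩

/-- The underlying abstract left `R`-module. -/
def Carrier (M : CMod C R) : Type u := M.obj.obj.carrier

instance (M : CMod C R) : AddCommGroup M.Carrier := M.obj.obj.addCommGroup

instance (M : CMod C R) : Module R M.Carrier where
  smul r x := ev (M.ρ r) x
  one_smul x := by
    change ev (M.ρ 1) x = x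
    rw [map_one]; rfl
  mul_smul r s x := by
    change ev (M.ρ (r * s)) x = ev (M.ρ r) (ev (M.ρ s) x)
    rw [map_mul]; rfl
  smul_zero r := app_zero _
  smul_add r x y := app_add _ x y
  add_smul r s x := by
    change ev (M.ρ (r + s)) x = ev (M.ρ r) x + ev (M.ρ s) x
    rw [map_add]; rfl
  zero_smul x := by
    change ev (M.ρ 0) x = 0
    rw [map_zero]; rfl

section BaseChange

variable [IsDualCat C] {A : Type u} [Ring A] [Algebra O A] [Finite A]
  (M : CMod C R) (φ : R →ₐ[O] A)

open Classical in
/-- The map `M → M ^ A` with value `x` at `a` and `0` elsewhere. As `A` is finite, `M ^ A` is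
the direct sum of copies of `M` indexed by `A`, and `single a x` is the formal tensor `a ⊗ x`. -/
def single (a : A) : M.obj.obj ⟶ pi (fun _ : A => M.obj.obj) :=
  mkHom (N := pi (fun _ : A => M.obj.obj))
    (ContinuousLinearMap.single O (fun _ : A => M.obj.obj.carrier) a) fun g x => by
      funext b
      by_cases h : b = a
      · subst h
        change Pi.single (M := fun _ : A => M.obj.obj.carrier) b (g • x) b =
          g • Pi.single (M := fun _ : A => M.obj.obj.carrier) b x b
        rw [Pi.single_eq_same, Pi.single_eq_same]
      · change Pi.single (M := fun _ : A => M.obj.obj.carrier) a (g • x) b =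
          g • Pi.single (M := fun _ : A => M.obj.obj.carrier) a x b
        rw [Pi.single_eq_of_ne h, Pi.single_eq_of_ne h, smul_zero]

/-- The relations `(a + b) ⊗ x = a ⊗ x + b ⊗ x` and `a φ(r) ⊗ x = a ⊗ r x`; their span is the
kernel of the map from `M ^ A` to the algebraic tensor product `A ⊗_R M`. -/
def relations : Set (pi (fun _ : A => M.obj.obj)).carrier :=
  {z | ∃ (a b : A) (x : M.obj.obj.carrier),
      z = app (M.single (a + b)) x - app (M.single a) x - app (M.single b) x} ∪
  {z | ∃ (a : A) (r : R) (x : M.obj.obj.carrier),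
      z = app (M.single (a * φ r)) x - app (M.single a) (ev (M.ρ r) x)}

theorem relations_smul (g : G) (z : (pi (fun _ : A => M.obj.obj)).carrier)
    (hz : z ∈ M.relations φ) : g • z ∈ M.relations φ := by
  rcases hz with ⟨a, b, x, rfl⟩ | ⟨a, r, x, rfl⟩
  · exact Or.inl ⟨a, b, g • x, by simp only [smul_sub, app_action]⟩
  · exact Or.inr ⟨a, r, g • x, by simp only [ev, smul_sub, app_action]⟩

end BaseChange
end CMod

/-- The closed subrepresentation generated by a `G`-stable set. -/
def closedSpan {M : ProAug O G} (s : Set M.carrier) (hs : ∀ (g : G), ∀ x ∈ s, g • x ∈ s) :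
    Sub M where
  toSubmodule := (Submodule.span O s).topologicalClosure
  isClosed := Submodule.isClosed_topologicalClosure _
  smul_mem g x hx := by
    have h : Submodule.span O s ≤ (Submodule.span O s).topologicalClosure.comap
        (DistribSMul.toLinearMap O M.carrier g) :=
      Submodule.span_le.2 fun y hy =>
        Submodule.le_topologicalClosure _ (Submodule.subset_span (hs g y hy))
    have h' := Submodule.topologicalClosure_minimal _ h
      ((Submodule.isClosed_topologicalClosure _).preimage (continuous_const_smul g))
    exact h' hx

theorem closedSpan_le_ker {M N : ProAug O G} (s : Set M.carrier)
    (hs : ∀ (g : G), ∀ x ∈ s, g • x ∈ s) (f : M ⟶ N) (hf : ∀ x ∈ s, app f x = 0) :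
    ∀ x ∈ (closedSpan s hs).toSubmodule, app f x = 0 := by
  intro x hx
  have h : Submodule.span O s ≤ (ker f).toSubmodule := Submodule.span_le.2 hf
  exact Submodule.topologicalClosure_minimal _ h (ker f).isClosed hx

namespace CMod

variable {C : ObjectProperty (ProAug O G)} {R : Type u} [Ring R] [Algebra O R]
  [IsDualCat C] {A : Type u} [Ring A] [Algebra O A] [Finite A]
  (M : CMod C R) (φ : R →ₐ[O] A)

/-- The object underlying the completed tensor product `A ⊗̂_{R, φ} M`, for `A` finite: the
algebraic tensor product `A ⊗_R M`, a quotient of the compact module `M ^ A`, made Hausdorff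
by dividing out the closure of the relations, with the quotient topology. -/
def tensorObj : C.FullSubcategory :=
  ⟨quot (closedSpan (M.relations φ) (M.relations_smul φ)),
    haveI := epi_of_surjective _
      (quotπ_surjective (closedSpan (M.relations φ) (M.relations_smul φ)))
    C.prop_of_epi (quotπ (closedSpan (M.relations φ) (M.relations_smul φ)))
      (prop_pi C _ fun _ => M.obj.property)⟩

/-- The morphism `x ↦ a ⊗̂ x`. -/
def tmul (a : A) : M.obj ⟶ M.tensorObj φ :=
  ObjectProperty.homMk (M.single a ≫ quotπ (closedSpan (M.relations φ) (M.relations_smul φ)))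

variable {φ}

theorem tmul_add (a b : A) : M.tmul φ (a + b) = M.tmul φ a + M.tmul φ b := by
  refine ObjectProperty.hom_ext _ (hom_ext fun x => ?_)
  have h := (quotπ_eq_zero (closedSpan (M.relations φ) (M.relations_smul φ)) _).2
    (Submodule.le_topologicalClosure _ (Submodule.subset_span (Or.inl ⟨a, b, x, rfl⟩)))
  have h' : app (M.tmul φ (a + b)).hom x - app (M.tmul φ a).hom x - app (M.tmul φ b).hom x = 0 := h
  rw [sub_sub, sub_eq_zero] at h'
  exact h'

theorem tmul_mul (a : A) (r : R) : M.tmul φ (a * φ r) = M.ρ r ≫ M.tmul φ a := by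
  refine ObjectProperty.hom_ext _ (hom_ext fun x => ?_)
  have h := (quotπ_eq_zero (closedSpan (M.relations φ) (M.relations_smul φ)) _).2
    (Submodule.le_topologicalClosure _ (Submodule.subset_span (Or.inr ⟨a, r, x, rfl⟩)))
  have h' : app (M.tmul φ (a * φ r)).hom x - app (M.tmul φ a).hom (ev (M.ρ r) x) = 0 := h
  rw [sub_eq_zero] at h'
  exact h'

theorem tmul_smul (r : O) (a : A) : M.tmul φ (r • a) = r • M.tmul φ a := by
  have h := M.tmul_mul (φ := φ) a (algebraMap O R r)
  rw [AlgHom.commutes, AlgHom.commutes, ← Algebra.commutes, ← Algebra.smul_def] at h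
  rw [h, Algebra.algebraMap_eq_smul_one]
  change (r • 𝟙 M.obj) ≫ _ = _
  rw [Linear.smul_comp, Category.id_comp]

theorem sum_app {ι : Type u} {M N : ProAug O G} (s : Finset ι) (f : ι → (M ⟶ N)) (x : M.carrier) :
    app (∑ i ∈ s, f i) x = ∑ i ∈ s, app (f i) x := by
  classical
  induction s using Finset.induction_on with
  | empty => simp
  | insert i s hi ih => simp [Finset.sum_insert hi, ih]

open Classical in
theorem sum_single (z : (pi (fun _ : A => M.obj.obj)).carrier) :
    letI := Fintype.ofFinite A
    z = ∑ a : A, app (M.single a) (z a) := by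
  letI := Fintype.ofFinite A
  exact (Finset.univ_sum_single (M := fun _ : A => M.obj.obj.carrier) z).symm

variable {M} in
theorem tensor_ext {N : C.FullSubcategory} {f g : M.tensorObj φ ⟶ N}
    (h : ∀ a, M.tmul φ a ≫ f = M.tmul φ a ≫ g) : f = g := by
  letI := Fintype.ofFinite A
  refine ObjectProperty.hom_ext _ (hom_ext fun z => ?_)
  obtain ⟨z, rfl⟩ := quotπ_surjective (closedSpan (M.relations φ) (M.relations_smul φ)) z
  rw [M.sum_single z]
  have hm : ∀ (k : M.tensorObj φ ⟶ N) (z : A → M.obj.obj.carrier),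
      app k.hom (app (quotπ (closedSpan (M.relations φ) (M.relations_smul φ)))
        (∑ a : A, app (M.single a) (z a))) = ∑ a : A, ev (M.tmul φ a ≫ k) (z a) := by
    intro k z
    have h1 := map_sum (quotπ (closedSpan (M.relations φ) (M.relations_smul φ)) ≫ k.hom).1
      (fun a : A => app (M.single a) (z a)) Finset.univ
    exact h1
  refine (hm f z).trans (Eq.trans ?_ (hm g z).symm)
  simp only [h]

/-- The universal property of the completed tensor product. -/
def desc {N : C.FullSubcategory} (F : A → (M.obj ⟶ N))
    (hadd : ∀ a b, F (a + b) = F a + F b) (hmul : ∀ a r, F (a * φ r) = M.ρ r ≫ F a) :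
    M.tensorObj φ ⟶ N :=
  letI := Fintype.ofFinite A
  ObjectProperty.homMk (quotDesc _ (∑ a : A, piProj (fun _ : A => M.obj.obj) a ≫ (F a).hom)
    (closedSpan_le_ker _ _ _ (by
      classical
      have key : ∀ (a : A) (x : M.obj.obj.carrier),
          app (∑ b : A, piProj (fun _ : A => M.obj.obj) b ≫ (F b).hom) (app (M.single a) x) =
            ev (F a) x := by
        intro a x
        rw [sum_app, Finset.sum_eq_single a]
        · change app (F a).hom (Pi.single (M := fun _ : A => M.obj.obj.carrier) a x a) = _
          rw [Pi.single_eq_same]; rfl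
        · intro b _ hb
          change app (F b).hom (Pi.single (M := fun _ : A => M.obj.obj.carrier) a x b) = _
          rw [Pi.single_eq_of_ne hb, app_zero]
        · intro h; exact absurd (Finset.mem_univ a) h
      rintro z (⟨a, b, x, rfl⟩ | ⟨a, r, x, rfl⟩)
      · refine (map_sub (∑ b : A, piProj (fun _ : A => M.obj.obj) b ≫ (F b).hom).1 _ _).trans ?_
        refine (congrArg₂ (· - ·)
          (map_sub (∑ b : A, piProj (fun _ : A => M.obj.obj) b ≫ (F b).hom).1 _ _) rfl).trans ?_
        refine (congrArg₂ (· - ·) (congrArg₂ (· - ·) (key _ _) (key _ _)) (key _ _)).trans ?_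
        rw [hadd]
        change ev (F a) x + ev (F b) x - ev (F a) x - ev (F b) x = 0
        abel
      · refine (map_sub (∑ b : A, piProj (fun _ : A => M.obj.obj) b ≫ (F b).hom).1 _ _).trans ?_
        refine (congrArg₂ (· - ·) (key _ _) (key _ _)).trans ?_
        rw [hmul]
        exact sub_self _)))

@[simp] theorem tmul_desc {N : C.FullSubcategory} (F : A → (M.obj ⟶ N))
    (hadd : ∀ a b, F (a + b) = F a + F b) (hmul : ∀ a r, F (a * φ r) = M.ρ r ≫ F a) (a : A) :
    M.tmul φ a ≫ M.desc F hadd hmul = F a := by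
  classical
  letI := Fintype.ofFinite A
  refine ObjectProperty.hom_ext _ (hom_ext fun x => ?_)
  change app (∑ b : A, piProj (fun _ : A => M.obj.obj) b ≫ (F b).hom) (app (M.single a) x) = _
  rw [sum_app, Finset.sum_eq_single a]
  · change app (F a).hom (Pi.single (M := fun _ : A => M.obj.obj.carrier) a x a) = _
    rw [Pi.single_eq_same]
  · intro b _ hb
    change app (F b).hom (Pi.single (M := fun _ : A => M.obj.obj.carrier) a x b) = _
    rw [Pi.single_eq_of_ne hb, app_zero]
  · intro h; exact absurd (Finset.mem_univ a) h

variable (φ)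

/-- Left multiplication by `a` on the completed tensor product: `b ⊗̂ x ↦ a b ⊗̂ x`. -/
def tensorAct (a : A) : End (M.tensorObj φ) :=
  M.desc (fun b => M.tmul φ (a * b)) (fun b c => by rw [mul_add, tmul_add])
    (fun b r => by rw [← mul_assoc, tmul_mul])

@[simp] theorem tmul_tensorAct (a b : A) :
    M.tmul φ b ≫ M.tensorAct φ a = M.tmul φ (a * b) := tmul_desc ..

/-- The completed tensor product `A ⊗̂_{R, φ} M` with its left `A`-action. -/
def baseChange : CMod C A where
  obj := M.tensorObj φ
  ρ :=
    { toFun := M.tensorAct φ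
      map_one' := tensor_ext fun b => by
        rw [tmul_tensorAct, one_mul]; exact (Category.comp_id _).symm
      map_mul' a b := tensor_ext fun c => by
        rw [tmul_tensorAct, End.mul_def, ← Category.assoc, tmul_tensorAct, tmul_tensorAct,
          mul_assoc]
      map_zero' := tensor_ext fun b => by
        rw [tmul_tensorAct, zero_mul]
        have h := M.tmul_add (φ := φ) 0 0
        rw [add_zero] at h
        exact (left_eq_add.1 h).trans comp_zero.symm
      map_add' a b := tensor_ext fun c => by
        rw [tmul_tensorAct, add_mul, tmul_add, Preadditive.comp_add, tmul_tensorAct,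
          tmul_tensorAct]
      commutes' r := tensor_ext fun c => by
        rw [tmul_tensorAct, ← Algebra.smul_def, tmul_smul, Algebra.algebraMap_eq_smul_one]
        change _ = _ ≫ (r • 𝟙 _)
        rw [Linear.comp_smul, Category.comp_id] }

end CMod

end ProAug

namespace ProAug

section Flat

variable (A : Type u) [Ring A] (N : Type u) [AddCommGroup N] [Module Aᵐᵒᵖ N]
  (M : Type u) [AddCommGroup M] [Module A M]

/-- The relations `(n a) ⊗ m = n ⊗ (a m)` that cut `N ⊗_A M` out of `N ⊗_ℤ M`. -/
def balancedRel : AddSubgroup (N ⊗[ℤ] M) :=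
  AddSubgroup.closure
    {t | ∃ (n : N) (a : A) (m : M), t = (MulOpposite.op a • n) ⊗ₜ[ℤ] m - n ⊗ₜ[ℤ] (a • m)}

/-- The tensor product `N ⊗_A M` of a right module `N` and a left module `M` over a
(non-commutative) ring `A`. -/
abbrev BalancedTensor : Type u := (N ⊗[ℤ] M) ⧸ balancedRel A N M

variable {N} {N' : Type u} [AddCommGroup N'] [Module Aᵐᵒᵖ N']

/-- The map `f ⊗_A id`. -/
def BalancedTensor.map (f : N →ₗ[Aᵐᵒᵖ] N') : BalancedTensor A N M →+ BalancedTensor A N' M :=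
  QuotientAddGroup.map (balancedRel A N M) (balancedRel A N' M)
    (LinearMap.rTensor M f.toAddMonoidHom.toIntLinearMap).toAddMonoidHom
    ((AddSubgroup.closure_le _).2 (by
      rintro _ ⟨n, a, m, rfl⟩
      refine AddSubgroup.subset_closure ⟨f n, a, m, ?_⟩
      simp))

/-- The left `A`-module `M` is flat: `- ⊗_A M` preserves injections of right `A`-modules. -/
def IsFlatModule : Prop :=
  ∀ (N N' : Type u) [AddCommGroup N] [Module Aᵐᵒᵖ N] [AddCommGroup N'] [Module Aᵐᵒᵖ N']
    (f : N →ₗ[Aᵐᵒᵖ] N'), Function.Injective f → Function.Injective (BalancedTensor.map A M f)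

end Flat

section Algebras

variable {O : Type u} [CommRing O] (ϖ : O)

/-- `A` is a finite local (hence artinian), possibly non-commutative, `O`-algebra such that
`O → A` induces an isomorphism from `O / ϖ` to `A / 𝔪_A`. Here `𝔪_A`, the maximal ideal of the local
ring `A`, is its Jacobson radical; `Algebra O A` says that `O` maps to the centre of `A`. -/
structure IsArtAlgebra (A : Type u) [Ring A] [Algebra O A] : Prop where
  finite : Finite A
  isLocalRing : IsLocalRing A
  surjective : Function.Surjective (algebraMap O (A ⧸ Ring.jacobson A))
  ker : RingHom.ker (algebraMap O (A ⧸ Ring.jacobson A)) = Ideal.span {ϖ}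

/-- The objects of the category `𝔄` of finite local artinian `O`-algebras. -/
structure ArtAlg where
  carrier : Type u
  [ring : Ring carrier]
  [algebra : Algebra O carrier]
  isArtAlgebra : IsArtAlgebra ϖ carrier

attribute [instance] ArtAlg.ring ArtAlg.algebra

instance (A : ArtAlg ϖ) : Finite A.carrier := A.isArtAlgebra.finite

instance (A : ArtAlg ϖ) : Finite (A.carrier ⧸ Ring.jacobson A.carrier) :=
  Finite.of_surjective _ (Ideal.Quotient.mk_surjective)

/-- `R` is an object of the pro-category of `𝔄`: a local `O`-algebra such that every `R / 𝔪 ^ n`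
lies in `𝔄` and `R` maps isomorphically to the inverse limit of the `R / 𝔪 ^ n`. -/
structure IsProArtAlgebra (R : Type u) [Ring R] [Algebra O R] : Prop where
  isLocalRing : IsLocalRing R
  quotients : ∀ n : ℕ, 1 ≤ n → IsArtAlgebra ϖ (R ⧸ Ring.jacobson R ^ n)
  separated : ∀ x : R, (∀ n : ℕ, x ∈ Ring.jacobson R ^ n) → x = 0
  complete : ∀ f : ℕ → R, (∀ n : ℕ, f (n + 1) - f n ∈ Ring.jacobson R ^ n) →
    ∃ x : R, ∀ n : ℕ, x - f n ∈ Ring.jacobson R ^ n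

/-- The local homomorphisms of `O`-algebras from `R` to `A`. If `A` is in `𝔄`, so that `𝔪_A` is
nilpotent, they factor through some `R / 𝔪_R ^ m`: these are the morphisms of pro-objects. -/
def LocHom (O : Type u) [CommRing O] (R A : Type u) [Ring R] [Algebra O R] [Ring A]
    [Algebra O A] : Type u :=
  {f : R →ₐ[O] A // ∀ x ∈ Ring.jacobson R, f x ∈ Ring.jacobson A}

/-- Composition of local homomorphisms. -/
def LocHom.comp {R A B : Type u} [Ring R] [Algebra O R] [Ring A] [Algebra O A] [Ring B]
    [Algebra O B] (f : LocHom O A B) (φ : LocHom O R A) : LocHom O R B :=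
  ⟨f.1.comp φ.1, fun x hx => f.2 _ (φ.2 x hx)⟩

/-- Conjugacy under the units of `A`. -/
def conjSetoid (O : Type u) [CommRing O] (R A : Type u) [Ring R] [Algebra O R] [Ring A]
    [Algebra O A] : Setoid (LocHom O R A) where
  r φ ψ := ∃ u : Aˣ, ∀ x : R, ψ.1 x = u * φ.1 x * (u⁻¹ : Aˣ)
  iseqv :=
    { refl := fun φ => ⟨1, fun x => by simp⟩
      symm := fun ⟨u, hu⟩ => ⟨u⁻¹, fun x => by rw [hu]; simp [mul_assoc]⟩
      trans := fun ⟨u, hu⟩ ⟨v, hv⟩ => ⟨v * u, fun x => by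
        rw [hv, hu, mul_inv_rev]; simp [mul_assoc]⟩ }

/-- The set of `A^×`-conjugacy classes of local homomorphisms from `R` to `A`. -/
abbrev ConjClass (O : Type u) [CommRing O] (R A : Type u) [Ring R] [Algebra O R] [Ring A]
    [Algebra O A] : Type u := Quotient (conjSetoid O R A)

/-- The two-sided ideal generated by all commutators. -/
def commutatorIdeal (R : Type u) [Ring R] : Ideal R :=
  Ideal.span {z | ∃ a b c : R, z = (a * b - b * a) * c}

instance (R : Type u) [Ring R] : (commutatorIdeal R).IsTwoSided := ⟨fun {x} b hx => by
  refine Submodule.span_induction (p := fun x _ => x * b ∈ commutatorIdeal R) ?_ ?_ ?_ ?_ hx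
  · rintro _ ⟨a, b', c, rfl⟩
    exact Ideal.subset_span ⟨a, b', c * b, by rw [mul_assoc]⟩
  · simp
  · intro x y _ _ hx hy
    rw [add_mul]; exact Ideal.add_mem _ hx hy
  · intro a x _ hx
    rw [smul_eq_mul, mul_assoc]; exact Ideal.mul_mem_left _ _ hx⟩

/-- The closure of the commutator ideal in the topology defined by the powers of `𝔪_R`. -/
def commutatorClosure (R : Type u) [Ring R] : Ideal R :=
  ⨅ n : ℕ, commutatorIdeal R ⊔ Ring.jacobson R ^ n

instance (R : Type u) [Ring R] : (commutatorClosure R).IsTwoSided := ⟨fun {x} b hx => by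
  rw [commutatorClosure, Submodule.mem_iInf] at hx ⊢
  intro n
  obtain ⟨y, hy, z, hz, rfl⟩ := Submodule.mem_sup.1 (hx n)
  rw [add_mul]
  exact Submodule.add_mem_sup (Ideal.mul_mem_right b _ hy) (Ideal.mul_mem_right b _ hz)⟩

/-- The maximal commutative (Hausdorff) quotient of `R`. -/
abbrev Abelianized (R : Type u) [Ring R] : Type u := R ⧸ commutatorClosure R

/-- Composition of a homomorphism with the projection from `R` to its commutative quotient. -/
def LocHom.ofAb {R A : Type u} [Ring R] [Algebra O R] [Ring A] [Algebra O A]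
    (ψ : LocHom O (Abelianized R) A) : LocHom O R A :=
  ⟨ψ.1.comp (Ideal.Quotient.mkₐ O (commutatorClosure R)), fun x hx => ψ.2 _ (by
    have : RingHomSurjective (Ideal.Quotient.mk (commutatorClosure R)) :=
      ⟨Ideal.Quotient.mk_surjective⟩
    exact Ring.map_jacobson_le (Ideal.Quotient.mk (commutatorClosure R)) ⟨x, hx, rfl⟩)⟩

end Algebras

section Deformations

variable {O G : Type u} [CommRing O] [Group G] [TopologicalSpace G] {ϖ : O}
  {C : ObjectProperty (ProAug O G)} [IsDualCat C]

/-- `k ⊗̂_A M`, where `k` is identified with `A / 𝔪_A`. -/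
def CMod.reduction {A : ArtAlg ϖ} (M : CMod C A.carrier) :
    CMod C (A.carrier ⧸ Ring.jacobson A.carrier) :=
  M.baseChange (Ideal.Quotient.mkₐ O (Ring.jacobson A.carrier))

/-- The map `M → k ⊗̂_A M`, `x ↦ 1 ⊗̂ x`. -/
def CMod.toReduction {A : ArtAlg ϖ} (M : CMod C A.carrier) : M.obj ⟶ M.reduction.obj :=
  M.tmul (Ideal.Quotient.mkₐ O (Ring.jacobson A.carrier)) 1

/-- A deformation of `Q` to `A`: an object `M` of `C` with an action of `A` that is flat over `A`,
and an isomorphism `α : k ⊗̂_A M ≅ Q`. -/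
structure Deformation (Q : C.FullSubcategory) (A : ArtAlg ϖ) where
  M : CMod C A.carrier
  flat : IsFlatModule A.carrier M.Carrier
  α : M.reduction.obj ≅ Q

/-- The map `M → k ⊗̂_A M ≅ Q`; it determines `α`, since `k ⊗̂_A M` is generated over `O` by the
`1 ⊗̂ x`. -/
def Deformation.proj {Q : C.FullSubcategory} {A : ArtAlg ϖ} (D : Deformation Q A) :
    D.M.obj ⟶ Q := D.M.toReduction ≫ D.α.hom

/-- Isomorphism of deformations: an `A`-linear isomorphism compatible with the maps to `Q`. -/
def defSetoid (Q : C.FullSubcategory) (A : ArtAlg ϖ) : Setoid (Deformation Q A) where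
  r D D' := ∃ β : D.M.obj ≅ D'.M.obj,
    (∀ a : A.carrier, D.M.ρ a ≫ β.hom = β.hom ≫ D'.M.ρ a) ∧ β.hom ≫ D'.proj = D.proj
  iseqv :=
    { refl := fun D => ⟨Iso.refl _, fun a =>
        (Category.comp_id _).trans (Category.id_comp _).symm, Category.id_comp _⟩
      symm := fun ⟨β, h1, h2⟩ => ⟨β.symm, fun a => by
        rw [Iso.symm_hom, Iso.comp_inv_eq, Category.assoc, h1, Iso.inv_hom_id_assoc], by
        rw [Iso.symm_hom, Iso.inv_comp_eq, h2]⟩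
      trans := fun ⟨β, h1, h2⟩ ⟨γ, h3, h4⟩ => ⟨β ≪≫ γ, fun a => by
        rw [Iso.trans_hom, ← Category.assoc, h1, Category.assoc, h3, Category.assoc], by
        rw [Iso.trans_hom, Category.assoc, h4, h2]⟩ }

/-- `Def_Q(A)`: the set of isomorphism classes of deformations of `Q` to `A`. -/
abbrev DefFunctor (Q : C.FullSubcategory) (A : ArtAlg ϖ) := Quotient (defSetoid Q A)

/-- `D'` is (isomorphic to) the deformation `B ⊗̂_{A, f} D`, the image of `D` under `Def_Q(f)`. -/
def IsPushforward {Q : C.FullSubcategory} {A B : ArtAlg ϖ} (f : LocHom O A.carrier B.carrier)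
    (D : Deformation Q A) (D' : Deformation Q B) : Prop :=
  ∃ β : (D.M.baseChange f.1).obj ≅ D'.M.obj,
    (∀ b : B.carrier, (D.M.baseChange f.1).ρ b ≫ β.hom = β.hom ≫ D'.M.ρ b) ∧
    D.M.tmul f.1 1 ≫ β.hom ≫ D'.proj = D.proj

end Deformations

/-- `H` is a pro-`p` group. -/
def IsProP (p : ℕ) (H : Type u) [Group H] [TopologicalSpace H] : Prop :=
  CompactSpace H ∧ TotallyDisconnectedSpace H ∧
    ∀ (N : Subgroup H) [N.Normal], IsOpen (N : Set H) → IsPGroup p (H ⧸ N)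

end ProAug

end

open ProAug

noncomputable section

namespace ProAug

/-! ### The ring of integers of a finite extension of `ℚ_[p]`. -/

section IntegerRing

/-! Write `E = End P`, `𝔪` for its maximal ideal and `R = rad Q`. The heart of the matter is that
`P` behaves like a free `E`-module with `k ⊗ P = Q`. Once this is known, universality is a formal
consequence of the projectivity of `P`.

Maps from `P` detect the irreducible constituent `S`. As `S` has multiplicity one in `Q`, every map
`P → Q` is a scalar multiple of `θ`, and there are no nonzero maps `P → R`. As `S` is the only
irreducible quotient of `Q`, the map `θ` is surjective. So `E` is local with residue field `k`, and
`𝔪` consists of the `r` with `θ ∘ r = 0`.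

Finiteness. Let `K` be the kernel of `P/ϖP → Q`. By (H3) its only irreducible quotient is `S`, and
`Hom(K, S)` embeds into `Ext¹(Q, S)`, which is finite by (H4). Hence finitely many maps from `P`
generate `K`. Lifting these and adding multiplication by `ϖ` gives endomorphisms `f i` with `ker θ =
∑ f i P`, so that `𝔪 = ∑ f i E`. Put `P₀ = P` and `Pₙ₊₁ = ∑ f i Pₙ`. Then `𝔪ⁿ` consists of the `r`
with `r P ⊆ Pₙ` (`IsHead.mem_jacobson_pow_iff`), and each finite length quotient of `P` kills some
`Pₙ`. Compactness of `P` gives completeness of `E`.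

Freeness (`IsHead.exists_graded_basis`). Each `Pₙ/Pₙ₊₁` is a finite direct sum of copies of `Q`.
First, (H5) is carried from `C(k)` to `C(O)` with the help of (H0), giving `Ext²(Q, R) = 0` there. A
minimal family of generators gives a surjection `Q^J → Pₙ/Pₙ₊₁` with kernel `Y`. Minimality means
`Hom(P, Y) = 0`, and `Ext¹(Pₙ/Pₙ₊₁, R) = 0` gives `Hom(Y, R) = 0`. Together these force `Hom(Y, Q) =
0`, hence `Y = 0`. The induction runs because `Ext²(Q, R) = 0` propagates the vanishing of `Ext¹(Pₙ,
R)`. It follows that any lifts `x i` of a `k`-basis of `Q` form a basis of `P/Pₙ` over `E/𝔪ⁿ`. For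
local `φ : E → A` the elements `1 ⊗ x i` are then an `A`-basis of `A ⊗ P`, which is therefore a
deformation of `Q`.

Universality. Let `M` be a deformation to `A`. Flatness over the artinian ring `A` makes lifts of a
basis of `Q` into an `A`-basis of `M`. By projectivity `θ` lifts to some `t : P → M`, and `Hom(P,
M)` is free of rank one over `A` on `t`. So `t ∘ r = φ(r) ∘ t` defines a homomorphism `φ : E → A`,
and another choice of `t` conjugates it. The map `A ⊗ P → M`, `a ⊗ x ↦ a t(x)`, carries a basis to a
basis, so it is an isomorphism. All assertions about classes are translated into the relation
`IsRep`. For commutative `A` conjugation is trivial and `φ` factors through the commutative quotient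
of `E`. -/

theorem finite_of_smul_eq_zero {R M : Type*} [CommRing R] [AddCommGroup M] [Module R M]
    [Module.Finite R M] (r : R) [Finite (R ⧸ Ideal.span {r})] (h : ∀ x : M, r • x = 0) :
    Finite M := by
  obtain ⟨n, f, hf⟩ := Module.Finite.exists_fin' R M
  refine Finite.of_surjective
    (fun c : Fin n → R ⧸ Ideal.span {r} => f fun i => Quotient.out (c i)) fun y => ?_
  obtain ⟨c, rfl⟩ := hf y
  refine ⟨fun i => Ideal.Quotient.mk _ (c i), ?_⟩
  have : ∀ i, ∃ d, Quotient.out (Ideal.Quotient.mk (Ideal.span {r}) (c i)) = c i + r * d := by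
    intro i
    have h1 : Ideal.Quotient.mk (Ideal.span {r})
        (Quotient.out (Ideal.Quotient.mk (Ideal.span {r}) (c i))) = Ideal.Quotient.mk _ (c i) :=
      Quotient.out_eq _
    rw [Ideal.Quotient.eq, Ideal.mem_span_singleton] at h1
    obtain ⟨d, hd⟩ := h1
    exact ⟨d, by rw [← hd]; ring⟩
  choose d hd using this
  have h2 : (fun i => Quotient.out (Ideal.Quotient.mk (Ideal.span {r}) (c i))) = c + r • d :=
    funext hd
  change f (fun i => Quotient.out (Ideal.Quotient.mk (Ideal.span {r}) (c i))) = f c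
  rw [h2, map_add, map_smul, h, add_zero]

variable {p : ℕ} [Fact p.Prime]

/-- The spectral norm is at most one exactly when the minimal polynomial over `ℚ_[p]` has
coefficients in `ℤ_[p]`. As `ℤ_[p]` is integrally closed, this is integrality. -/
theorem isIntegral_iff_spectralNorm_le_one {L : Type*} [Field L] [Algebra ℚ_[p] L]
    [FiniteDimensional ℚ_[p] L] [Algebra ℤ_[p] L] [IsScalarTower ℤ_[p] ℚ_[p] L] (x : L) :
    IsIntegral ℤ_[p] x ↔ spectralNorm ℚ_[p] L x ≤ 1 := by
  have hx : IsIntegral ℚ_[p] x := Algebra.IsIntegral.isIntegral x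
  rw [spectralNorm, spectralValue_le_one_iff (minpoly.monic hx)]
  constructor
  · intro h n
    rw [minpoly.isIntegrallyClosed_eq_field_fractions' ℚ_[p] h, Polynomial.coeff_map]
    exact PadicInt.norm_le_one _
  · intro h
    have hl : minpoly ℚ_[p] x ∈ Polynomial.lifts (algebraMap ℤ_[p] ℚ_[p]) := by
      rw [Polynomial.lifts_iff_coeff_lifts]
      exact fun n => ⟨⟨_, h n⟩, rfl⟩
    obtain ⟨q, hq, -, hqm⟩ := Polynomial.lifts_and_natDegree_eq_and_monic hl (minpoly.monic hx)
    refine ⟨q, hqm, ?_⟩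
    rw [IsScalarTower.algebraMap_eq ℤ_[p] ℚ_[p] L, ← Polynomial.eval₂_map, hq]
    exact minpoly.aeval _ _

/-- The spectral norm is multiplicative, so the units are the elements of norm one. It is
nonarchimedean, so the elements of norm less than one are closed under addition. -/
theorem integralClosure_isLocalRing {L : Type*} [Field L] [Algebra ℚ_[p] L]
    [FiniteDimensional ℚ_[p] L] [Algebra ℤ_[p] L] [IsScalarTower ℤ_[p] ℚ_[p] L] :
    IsLocalRing (integralClosure ℤ_[p] L) := by
  have hunit : ∀ x : integralClosure ℤ_[p] L, IsUnit x ↔ spectralNorm ℚ_[p] L x.1 = 1 := by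
    intro x
    have hx := (isIntegral_iff_spectralNorm_le_one x.1).1 x.2
    constructor
    · intro h
      obtain ⟨y, hy⟩ := h.exists_right_inv
      have hxy : x.1 * y.1 = 1 := congrArg Subtype.val hy
      have h1 := spectralAlgNorm_mul (K := ℚ_[p]) x.1 y.1
      rw [hxy, spectralAlgNorm_one, spectralAlgNorm_def, spectralAlgNorm_def] at h1
      have hy1 := (isIntegral_iff_spectralNorm_le_one y.1).1 y.2
      have h3 := spectralNorm_nonneg (K := ℚ_[p]) x.1
      nlinarith
    · intro h
      have h0 : x.1 ≠ 0 := by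
        intro h0
        rw [h0, spectralNorm_zero] at h
        exact zero_ne_one h
      have h1 := spectralAlgNorm_mul (K := ℚ_[p]) x.1 x.1⁻¹
      rw [mul_inv_cancel₀ h0, spectralAlgNorm_one, spectralAlgNorm_def, spectralAlgNorm_def, h,
        one_mul] at h1
      exact .of_mul_eq_one ⟨x.1⁻¹, (isIntegral_iff_spectralNorm_le_one _).2 h1.symm.le⟩
        (Subtype.ext (mul_inv_cancel₀ h0))
  refine IsLocalRing.of_nonunits_add fun a b ha hb => ?_
  rw [mem_nonunits_iff, hunit] at ha hb ⊢
  have ha1 := lt_of_le_of_ne ((isIntegral_iff_spectralNorm_le_one a.1).1 a.2) ha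
  have hb1 := lt_of_le_of_ne ((isIntegral_iff_spectralNorm_le_one b.1).1 b.2) hb
  exact ((isNonarchimedean_spectralNorm a.1 b.1).trans_lt (max_lt ha1 hb1)).ne

theorem isLocalRing_and_span_uniformizer {L : Type*} [Field L] [Algebra ℚ_[p] L]
    [FiniteDimensional ℚ_[p] L] [Algebra ℤ_[p] L] [IsScalarTower ℤ_[p] ℚ_[p] L]
    {O : Type*} [CommRing O] [Algebra O L] [IsIntegralClosure O ℤ_[p] L]
    (ϖ : O) (hϖ : Irreducible ϖ) :
    IsLocalRing O ∧ (Ideal.span {ϖ}).IsMaximal ∧ Finite (O ⧸ Ideal.span {ϖ}) := by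
  have hint : ∀ x : O, IsIntegral ℤ_[p] (algebraMap O L x) := fun x =>
    IsIntegralClosure.isIntegral_iff.2 ⟨x, rfl⟩
  let e : O ≃+* integralClosure ℤ_[p] L := RingEquiv.ofBijective
    ((algebraMap O L).codRestrict (integralClosure ℤ_[p] L) hint)
    ⟨fun x y h => IsIntegralClosure.algebraMap_injective O ℤ_[p] L (congrArg Subtype.val h),
      fun y => by
        obtain ⟨x, hx⟩ := (IsIntegralClosure.isIntegral_iff (A := O)).1 y.2
        exact ⟨x, Subtype.ext hx⟩⟩
  have hloc : IsLocalRing O := by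
    have := integralClosure_isLocalRing (p := p) (L := L)
    exact e.symm.isLocalRing
  let _ : Algebra ℤ_[p] O :=
    (e.symm.toRingHom.comp (algebraMap ℤ_[p] (integralClosure ℤ_[p] L))).toAlgebra
  have htow : IsScalarTower ℤ_[p] O L := IsScalarTower.of_algebraMap_eq fun x => by
    change _ = (e (e.symm (algebraMap ℤ_[p] (integralClosure ℤ_[p] L) x))).1
    rw [e.apply_symm_apply]; rfl
  have hfin : Module.Finite ℤ_[p] O := IsIntegralClosure.finite ℤ_[p] ℚ_[p] L O
  have hinj := IsIntegralClosure.algebraMap_injective O ℤ_[p] L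
  have : IsDomain O := hinj.isDomain
  have : IsDedekindDomain O := IsIntegralClosure.isDedekindDomain ℤ_[p] ℚ_[p] L O
  have : IsPrincipalIdealRing O := inferInstance
  have hmax := PrincipalIdealRing.isMaximal_of_irreducible hϖ
  refine ⟨hloc, hmax, ?_⟩
  -- If `p` were a unit of `O`, then `1/p` would be integral, but its spectral norm is `p > 1`.
  have hp : (p : O) ∈ Ideal.span {ϖ} := by
    have hm := IsLocalRing.eq_maximalIdeal hmax
    change (p : O) ∈ O ∙ ϖ
    rw [hm, IsLocalRing.mem_maximalIdeal, mem_nonunits_iff]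
    intro hu
    obtain ⟨y, hy⟩ := hu.exists_right_inv
    have h1 : (p : L) * algebraMap O L y = 1 := by
      rw [← map_natCast (algebraMap O L), ← map_mul, hy, map_one]
    have h2 : algebraMap O L y = algebraMap ℚ_[p] L (p : ℚ_[p])⁻¹ := by
      rw [map_inv₀, map_natCast]
      exact eq_inv_of_mul_eq_one_right h1
    have h3 := (isIntegral_iff_spectralNorm_le_one (p := p) _).1 (hint y)
    rw [h2, spectralNorm_extends, norm_inv, Padic.norm_p, inv_inv] at h3
    exact absurd h3 (not_le.2 (by exact_mod_cast (Fact.out : p.Prime).one_lt))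
  have : Finite (ℤ_[p] ⧸ Ideal.span {(p : ℤ_[p])}) := by
    rw [← PadicInt.maximalIdeal_eq_span_p, ← PadicInt.ker_toZMod]
    have : NeZero p := ⟨(Fact.out : p.Prime).ne_zero⟩
    exact Finite.of_injective _ (RingHom.kerLift_injective (PadicInt.toZMod (p := p)))
  -- `O` is finite over `ℤ_[p]`, and its quotient by `ϖ` is killed by `p`.
  refine finite_of_smul_eq_zero (R := ℤ_[p]) (p : ℤ_[p]) fun x => ?_
  obtain ⟨x, rfl⟩ := Ideal.Quotient.mk_surjective x
  change Ideal.Quotient.mk (Ideal.span {ϖ}) ((p : ℤ_[p]) • x) = 0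
  rw [Ideal.Quotient.eq_zero_iff_mem, Algebra.smul_def, map_natCast]
  exact Ideal.mul_mem_right _ _ hp

end IntegerRing

/-! ### Non-commutative local rings and their Jacobson radical. -/

section LocalRings

variable {R : Type*} [Ring R] [IsLocalRing R]

/-- The element `x * y` is idempotent, and it or `1 - x * y` is a unit. A unit idempotent is `1`; in
the other case `(1 - x * y) * x = 0` forces `x = 0`. -/
theorem isUnit_of_mul_eq_one_of_isLocalRing {x y : R} (h : y * x = 1) : IsUnit x := by
  have he : x * y + (1 - x * y) = 1 := by abel
  have hxx : x * y * x = x := by rw [mul_assoc, h, mul_one]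
  rcases IsLocalRing.isUnit_or_isUnit_of_add_one he with h1 | h1
  · have h2 : x * y = 1 := by
      have : x * y * (x * y) = x * y * 1 := by rw [← mul_assoc, hxx, mul_one]
      exact h1.mul_left_cancel this
    exact ⟨⟨x, y, h2, h⟩, rfl⟩
  · have h2 : x = 0 := by
      have : (1 - x * y) * x = (1 - x * y) * 0 := by rw [sub_mul, hxx, one_mul, sub_self, mul_zero]
      exact h1.mul_left_cancel this
    rw [h2, mul_zero] at h
    exact absurd h zero_ne_one

/-- If a maximal left ideal `I` misses `x`, then `1 - r * x ∈ I` for some `r`. As `I` is proper,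
locality makes `r * x` a unit, so `x` has a left inverse and is itself a unit. -/
theorem mem_jacobson_iff {x : R} : x ∈ Ring.jacobson R ↔ ¬ IsUnit x := by
  constructor
  · intro hx hu
    exact (Ring.jacobson_lt_top R).ne (Ideal.eq_top_of_isUnit_mem _ hx hu)
  · intro hx
    rw [Ring.jacobson_eq_sInf_isMaximal, Submodule.mem_sInf]
    intro I hI
    by_contra hxI
    have hI' : Ideal.IsMaximal I := hI
    obtain ⟨r, hr⟩ : ∃ r, 1 - r * x ∈ I := by
      have h1 : (1 : R) ∈ I ⊔ Ideal.span {x} := by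
        have : I ⊔ Ideal.span {x} = ⊤ := hI'.1.2 _ (lt_of_le_of_ne le_sup_left fun h =>
          hxI (h ▸ Ideal.mem_sup_right (Ideal.mem_span_singleton_self x)))
        rw [this]; trivial
      obtain ⟨m, hm, y, hy, h⟩ := Submodule.mem_sup.1 h1
      obtain ⟨r, rfl⟩ := Ideal.mem_span_singleton'.1 hy
      exact ⟨r, by rw [← h, add_sub_cancel_right]; exact hm⟩
    rcases IsLocalRing.isUnit_or_isUnit_of_add_one (a := 1 - r * x) (b := r * x) (by abel)
      with h1 | h1
    · exact hI'.ne_top (Ideal.eq_top_of_isUnit_mem _ hr h1)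
    · obtain ⟨u, hu⟩ := h1.exists_left_inv
      exact hx (isUnit_of_mul_eq_one_of_isLocalRing (y := u * r) (by rw [mul_assoc, hu]))

theorem isUnit_one_add_of_mem_jacobson {x : R} (hx : x ∈ Ring.jacobson R) : IsUnit (1 + x) := by
  by_contra h
  have h1 := sub_mem (mem_jacobson_iff.2 h) hx
  rw [add_sub_cancel_right] at h1
  exact mem_jacobson_iff.1 h1 isUnit_one

theorem isLocalRing_quotient {I : Ideal R} [I.IsTwoSided] (hI : I ≤ Ring.jacobson R) :
    IsLocalRing (R ⧸ I) := by
  have : Nontrivial (R ⧸ I) := Ideal.Quotient.nontrivial_iff.2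
    (lt_of_le_of_lt hI (Ring.jacobson_lt_top R)).ne
  refine ⟨fun {a b} h => ?_⟩
  obtain ⟨a, rfl⟩ := Ideal.Quotient.mk_surjective a
  obtain ⟨b, rfl⟩ := Ideal.Quotient.mk_surjective b
  rw [← map_add, ← map_one (Ideal.Quotient.mk I), Ideal.Quotient.eq] at h
  obtain ⟨u, hu⟩ := isUnit_one_add_of_mem_jacobson (hI h)
  rw [add_sub_cancel] at hu
  have hu' : (u⁻¹ : Rˣ) * a + (u⁻¹ : Rˣ) * b = 1 := by
    rw [← mul_add, ← hu, Units.inv_mul]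
  rcases IsLocalRing.isUnit_or_isUnit_of_add_one hu' with h1 | h1
  · exact Or.inl (((Units.isUnit_units_mul _ _).1 h1).map (Ideal.Quotient.mk I))
  · exact Or.inr (((Units.isUnit_units_mul _ _).1 h1).map (Ideal.Quotient.mk I))

omit [IsLocalRing R] in
theorem mk_mem_jacobson_iff {I : Ideal R} [I.IsTwoSided] (hI : I ≤ Ring.jacobson R) (x : R) :
    Ideal.Quotient.mk I x ∈ Ring.jacobson (R ⧸ I) ↔ x ∈ Ring.jacobson R := by
  have : RingHomSurjective (Ideal.Quotient.mk I) := ⟨Ideal.Quotient.mk_surjective⟩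
  have h := Ring.map_jacobson_of_ker_le (f := Ideal.Quotient.mk I) (by rwa [Ideal.mk_ker])
  rw [← h]
  constructor
  · rintro ⟨y, hy, hxy⟩
    have h1 : y - x ∈ I := Ideal.Quotient.eq.1 hxy
    have := sub_mem hy (hI h1)
    rwa [sub_sub_cancel] at this
  · exact fun hx => ⟨x, hx, rfl⟩

omit [IsLocalRing R] in
theorem mk_mem_jacobson_pow_iff {I : Ideal R} [I.IsTwoSided] (hI : I ≤ Ring.jacobson R) (n : ℕ)
    (x : R) : Ideal.Quotient.mk I x ∈ Ring.jacobson (R ⧸ I) ^ n ↔ x ∈ I ⊔ Ring.jacobson R ^ n := by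
  constructor
  · suffices h : ∀ z ∈ Ring.jacobson (R ⧸ I) ^ n, ∃ y ∈ Ring.jacobson R ^ n,
        Ideal.Quotient.mk I y = z by
      intro hx
      obtain ⟨y, hy, hxy⟩ := h _ hx
      have h1 : y - x ∈ I := Ideal.Quotient.eq.1 hxy
      have h2 := Submodule.add_mem_sup (neg_mem h1) hy
      rwa [neg_sub, sub_add_cancel] at h2
    induction n with
    | zero =>
      intro z _
      obtain ⟨y, rfl⟩ := Ideal.Quotient.mk_surjective z
      exact ⟨y, by rw [Submodule.pow_zero, Ideal.one_eq_top]; trivial, rfl⟩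
    | succ n ih =>
      intro z hz
      rw [Submodule.pow_succ] at hz
      refine Submodule.smul_induction_on hz ?_ ?_
      · intro a ha b hb
        obtain ⟨a', ha', rfl⟩ := ih a ha
        obtain ⟨b, rfl⟩ := Ideal.Quotient.mk_surjective b
        refine ⟨a' * b, ?_, rfl⟩
        rw [Submodule.pow_succ]
        exact Ideal.mul_mem_mul ha' ((mk_mem_jacobson_iff hI b).1 hb)
      · rintro _ _ ⟨a, ha, rfl⟩ ⟨b, hb, rfl⟩
        exact ⟨a + b, add_mem ha hb, rfl⟩
  · intro hx
    obtain ⟨y, hy, z, hz, rfl⟩ := Submodule.mem_sup.1 hx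
    rw [map_add, Ideal.Quotient.eq_zero_iff_mem.2 hy, zero_add]
    clear hx hy
    induction n generalizing z with
    | zero => rw [Submodule.pow_zero, Ideal.one_eq_top]; trivial
    | succ n ih =>
      rw [Submodule.pow_succ] at hz ⊢
      refine Submodule.smul_induction_on hz ?_ ?_
      · intro a ha b hb
        rw [smul_eq_mul, map_mul]
        exact Ideal.mul_mem_mul (ih a ha) ((mk_mem_jacobson_iff hI b).2 hb)
      · intro a b ha hb
        rw [map_add]; exact add_mem ha hb

end LocalRings

/-! ### Local algebras with residue field `O / ϖ`, their pro-objects and commutative quotients. -/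

section Algebras

variable {O : Type u} [CommRing O] {ϖ : O} {R : Type u} [Ring R] [Algebra O R]

/-- `R` is local and `O → R` induces an isomorphism from `O / ϖ` to the residue ring of `R`. -/
structure IsLocalOver (ϖ : O) (R : Type u) [Ring R] [Algebra O R] : Prop where
  isLocalRing : IsLocalRing R
  exists_scalar : ∀ x : R, ∃ c : O, x - algebraMap O R c ∈ Ring.jacobson R
  scalar_mem_iff : ∀ c : O, algebraMap O R c ∈ Ring.jacobson R ↔ c ∈ Ideal.span {ϖ}

theorem isArtAlgebra_iff : IsArtAlgebra ϖ R ↔ Finite R ∧ IsLocalOver ϖ R := by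
  constructor
  · intro h
    refine ⟨h.finite, h.isLocalRing, fun x => ?_, fun c => ?_⟩
    · obtain ⟨c, hc⟩ := h.surjective (Ideal.Quotient.mk _ x)
      exact ⟨c, Ideal.Quotient.eq.1 hc.symm⟩
    · rw [← h.ker, RingHom.mem_ker]
      exact Ideal.Quotient.eq_zero_iff_mem.symm
  · rintro ⟨hf, h⟩
    refine ⟨hf, h.isLocalRing, fun x => ?_, ?_⟩
    · obtain ⟨x, rfl⟩ := Ideal.Quotient.mk_surjective x
      obtain ⟨c, hc⟩ := h.exists_scalar x
      exact ⟨c, (Ideal.Quotient.eq.2 hc).symm⟩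
    · ext c
      rw [← h.scalar_mem_iff, RingHom.mem_ker]
      exact Ideal.Quotient.eq_zero_iff_mem

theorem IsLocalOver.quotient (h : IsLocalOver ϖ R) {I : Ideal R} [I.IsTwoSided]
    (hI : I ≤ Ring.jacobson R) : IsLocalOver ϖ (R ⧸ I) where
  isLocalRing := haveI := h.isLocalRing; isLocalRing_quotient hI
  exists_scalar x := by
    obtain ⟨x, rfl⟩ := Ideal.Quotient.mk_surjective x
    obtain ⟨c, hc⟩ := h.exists_scalar x
    exact ⟨c, (mk_mem_jacobson_iff hI _).2 hc⟩
  scalar_mem_iff c := by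
    rw [← h.scalar_mem_iff]
    exact mk_mem_jacobson_iff hI _

theorem IsLocalOver.isProArtAlgebra (h : IsLocalOver ϖ R)
    (hfin : ∀ n, Finite (R ⧸ Ring.jacobson R ^ n))
    (hsep : ∀ x : R, (∀ n : ℕ, x ∈ Ring.jacobson R ^ n) → x = 0)
    (hcomp : ∀ f : ℕ → R, (∀ n : ℕ, f (n + 1) - f n ∈ Ring.jacobson R ^ n) →
      ∃ x : R, ∀ n : ℕ, x - f n ∈ Ring.jacobson R ^ n) : IsProArtAlgebra ϖ R where
  isLocalRing := h.isLocalRing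
  quotients n hn := isArtAlgebra_iff.2
    ⟨hfin n, h.quotient (Ideal.pow_le_self (Nat.one_le_iff_ne_zero.1 hn))⟩
  separated := hsep
  complete := hcomp

theorem IsProArtAlgebra.isLocalOver (h : IsProArtAlgebra ϖ R) : IsLocalOver ϖ R := by
  have h1 := (isArtAlgebra_iff.1 (h.quotients 1 le_rfl)).2
  have hI : Ring.jacobson R ^ 1 ≤ Ring.jacobson R := by rw [Submodule.pow_one]
  refine ⟨h.isLocalRing, fun x => ?_, fun c => ?_⟩
  · obtain ⟨c, hc⟩ := h1.exists_scalar (Ideal.Quotient.mk _ x)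
    exact ⟨c, (mk_mem_jacobson_iff hI _).1 hc⟩
  · rw [← h1.scalar_mem_iff]
    exact (mk_mem_jacobson_iff hI _).symm

/-- Hypothesis `hcl` says that `I` is closed in the `𝔪`-adic topology, which gives separatedness.
For completeness the successive differences of a Cauchy sequence are lifted to `𝔪ⁿ`, so that their
partial sums converge in `R`. -/
theorem IsProArtAlgebra.quotient (h : IsProArtAlgebra ϖ R) {I : Ideal R} [I.IsTwoSided]
    (hI : I ≤ Ring.jacobson R) (hcl : ∀ x, (∀ n : ℕ, x ∈ I ⊔ Ring.jacobson R ^ n) → x ∈ I) :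
    IsProArtAlgebra ϖ (R ⧸ I) := by
  refine (h.isLocalOver.quotient hI).isProArtAlgebra (fun n => ?_) (fun x hx => ?_)
    (fun f hf => ?_)
  · rcases Nat.eq_zero_or_pos n with rfl | hn
    · rw [Submodule.pow_zero, Ideal.one_eq_top]
      infer_instance
    have := (h.quotients n hn).finite
    refine Finite.of_surjective (α := R ⧸ Ring.jacobson R ^ n)
      (Ideal.Quotient.lift _ ((Ideal.Quotient.mk (Ring.jacobson (R ⧸ I) ^ n)).comp
        (Ideal.Quotient.mk I)) fun x hx => ?_) fun y => ?_
    · exact Ideal.Quotient.eq_zero_iff_mem.2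
        ((mk_mem_jacobson_pow_iff hI n x).2 (Ideal.mem_sup_right hx))
    · obtain ⟨y, rfl⟩ := Ideal.Quotient.mk_surjective y
      obtain ⟨y, rfl⟩ := Ideal.Quotient.mk_surjective y
      exact ⟨Ideal.Quotient.mk _ y, rfl⟩
  · obtain ⟨x, rfl⟩ := Ideal.Quotient.mk_surjective x
    exact Ideal.Quotient.eq_zero_iff_mem.2
      (hcl x fun n => (mk_mem_jacobson_pow_iff hI n x).1 (hx n))
  · have key : ∀ n, ∃ d ∈ Ring.jacobson R ^ n, Ideal.Quotient.mk I d = f (n + 1) - f n := by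
      intro n
      obtain ⟨d, hd⟩ := Ideal.Quotient.mk_surjective (f (n + 1) - f n)
      have h1 := hf n
      rw [← hd, mk_mem_jacobson_pow_iff hI] at h1
      obtain ⟨y, hy, z, hz, rfl⟩ := Submodule.mem_sup.1 h1
      refine ⟨z, hz, ?_⟩
      rw [← hd, map_add, Ideal.Quotient.eq_zero_iff_mem.2 hy, zero_add]
    choose d hd hdf using key
    obtain ⟨g0, hg0⟩ := Ideal.Quotient.mk_surjective (f 0)
    let g : ℕ → R := fun n => g0 + ∑ i ∈ Finset.range n, d i
    have hg : ∀ n, Ideal.Quotient.mk I (g n) = f n := by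
      intro n
      induction n with
      | zero => simp [g, hg0]
      | succ n ih =>
        have : g (n + 1) = g n + d n := by simp [g, Finset.sum_range_succ, add_assoc]
        rw [this, map_add, ih, hdf, add_sub_cancel]
    obtain ⟨x, hx⟩ := h.complete g fun n => by
      have : g (n + 1) = g n + d n := by simp [g, Finset.sum_range_succ, add_assoc]
      rw [this, add_sub_cancel_left]
      exact hd n
    refine ⟨Ideal.Quotient.mk I x, fun n => ?_⟩
    rw [← hg, ← map_sub, mk_mem_jacobson_pow_iff hI]
    exact Ideal.mem_sup_right (hx n)

/-- Modulo `𝔪` every element is a scalar, and scalars are central. -/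
theorem IsLocalOver.commutator_mem (h : IsLocalOver ϖ R) (a b : R) :
    a * b - b * a ∈ Ring.jacobson R := by
  obtain ⟨c, hc⟩ := h.exists_scalar a
  have : a * b - b * a = (a - algebraMap O R c) * b - b * (a - algebraMap O R c) := by
    rw [sub_mul, mul_sub, Algebra.commutes c b]; abel
  rw [this]
  exact sub_mem (Ideal.mul_mem_right b _ hc) (Ideal.mul_mem_left _ _ hc)

theorem IsLocalOver.commutatorClosure_le (h : IsLocalOver ϖ R) :
    commutatorClosure R ≤ Ring.jacobson R := by
  refine (iInf_le _ 1).trans (sup_le (Ideal.span_le.2 ?_) (by rw [Submodule.pow_one]))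
  rintro _ ⟨a, b, c, rfl⟩
  exact Ideal.mul_mem_right c _ (h.commutator_mem a b)

theorem IsProArtAlgebra.abelianized (h : IsProArtAlgebra ϖ R) :
    IsProArtAlgebra ϖ (Abelianized R) := by
  refine h.quotient h.isLocalOver.commutatorClosure_le fun x hx => ?_
  rw [commutatorClosure, Submodule.mem_iInf]
  intro n
  exact (sup_le (iInf_le _ n) le_sup_right : commutatorClosure R ⊔ Ring.jacobson R ^ n ≤ _) (hx n)

theorem IsArtAlgebra.exists_jacobson_pow_eq_bot (h : IsArtAlgebra ϖ R) :
    ∃ n, Ring.jacobson R ^ n = ⊥ := by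
  have := h.finite
  exact IsSemiprimaryRing.isNilpotent

theorem LocHom.map_jacobson_pow {A : Type u} [Ring A] [Algebra O A] (φ : LocHom O R A) (n : ℕ)
    {x : R} (hx : x ∈ Ring.jacobson R ^ n) : φ.1 x ∈ Ring.jacobson A ^ n := by
  induction n generalizing x with
  | zero => rw [Submodule.pow_zero, Ideal.one_eq_top]; trivial
  | succ n ih =>
    rw [Submodule.pow_succ] at hx ⊢
    refine Submodule.smul_induction_on hx ?_ ?_
    · intro a ha b hb
      rw [smul_eq_mul, map_mul]
      exact Ideal.mul_mem_mul (ih ha) (φ.2 b hb)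
    · intro a b ha hb
      rw [map_add]; exact add_mem ha hb

theorem exists_finite_representatives (J : Ideal R) [J.IsTwoSided] [Finite (R ⧸ J)] :
    ∃ T : Set R, T.Finite ∧ ∀ r, ∃ t ∈ T, r - t ∈ J := by
  refine ⟨Set.range fun x : R ⧸ J => Quotient.out x, Set.finite_range _, fun r =>
    ⟨_, ⟨Ideal.Quotient.mk J r, rfl⟩, ?_⟩⟩
  exact Ideal.Quotient.eq.1 (Quotient.out_eq (Ideal.Quotient.mk J r)).symm

/-- Every `x` is `t + ∑ f i * g i` with `t` from a finite set, and modulo `𝔪ⁿ⁺¹` only the classes of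
the `g i` modulo `𝔪ⁿ` matter. -/
theorem finite_quotient_jacobson_pow {ι : Type*} [Fintype ι] (f : ι → R)
    (hf : ∀ i, f i ∈ Ring.jacobson R)
    (hgen : ∀ x ∈ Ring.jacobson R, ∃ g : ι → R, x = ∑ i, f i * g i)
    [Finite (R ⧸ Ring.jacobson R)] (n : ℕ) : Finite (R ⧸ Ring.jacobson R ^ n) := by
  induction n with
  | zero => rw [Submodule.pow_zero, Ideal.one_eq_top]; infer_instance
  | succ n ih =>
    obtain ⟨T, hT, hTr⟩ := exists_finite_representatives (Ring.jacobson R ^ n)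
    obtain ⟨T₁, hT₁, hTr₁⟩ := exists_finite_representatives (Ring.jacobson R)
    have := hT.to_subtype
    have := hT₁.to_subtype
    refine Finite.of_surjective (α := T₁ × (ι → T)) (fun t =>
      Ideal.Quotient.mk _ (t.1.1 + ∑ i, f i * (t.2 i).1)) fun x => ?_
    obtain ⟨x, rfl⟩ := Ideal.Quotient.mk_surjective x
    obtain ⟨t, ht, hxt⟩ := hTr₁ x
    obtain ⟨g, hg⟩ := hgen _ hxt
    choose s hs hgs using fun i => hTr (g i)
    refine ⟨⟨⟨t, ht⟩, fun i => ⟨s i, hs i⟩⟩, (Ideal.Quotient.eq.2 ?_).symm⟩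
    change x - (t + ∑ i, f i * s i) ∈ _
    rw [← sub_sub, hg, ← Finset.sum_sub_distrib]
    refine sum_mem fun i _ => ?_
    rw [← mul_sub, Ideal.IsTwoSided.pow_succ]
    exact Ideal.mul_mem_mul (hf i) (hgs i)

end Algebras

/-! ### Closed subrepresentations and irreducible objects. -/

section Subobjects

variable {O G : Type u} [CommRing O] [Group G] [TopologicalSpace G]

/-- The preimage of a subobject. -/
def comapSub {M N : ProAug O G} (f : M ⟶ N) (K : Sub N) : Sub M where
  toSubmodule := K.toSubmodule.comap f.1.toLinearMap
  isClosed := K.isClosed.preimage f.1.continuous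
  smul_mem g x hx := by
    change app f (g • x) ∈ K.toSubmodule
    rw [app_action]
    exact K.smul_mem g _ hx

/-- The image of a subobject. -/
def mapSub {M N : ProAug O G} (f : M ⟶ N) (K : Sub M) : Sub N where
  toSubmodule := K.toSubmodule.map f.1.toLinearMap
  isClosed := (K.isClosed.isCompact.image f.1.continuous).isClosed
  smul_mem g := by
    rintro _ ⟨x, hx, rfl⟩
    exact ⟨g • x, K.smul_mem g x hx, app_action f g x⟩

/-- The sum of two subobjects. -/
def supSub {M : ProAug O G} (K L : Sub M) : Sub M where
  toSubmodule := K.toSubmodule ⊔ L.toSubmodule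
  isClosed := by
    rw [Submodule.coe_sup]
    exact (K.isClosed.isCompact.add L.isClosed.isCompact).isClosed
  smul_mem g x hx := by
    obtain ⟨y, hy, z, hz, rfl⟩ := Submodule.mem_sup.1 hx
    rw [smul_add]
    exact Submodule.add_mem_sup (K.smul_mem g y hy) (L.smul_mem g z hz)

theorem sub_le_iff {M : ProAug O G} {K L : Sub M} :
    K ≤ L ↔ ∀ x ∈ K.toSubmodule, x ∈ L.toSubmodule := Iff.rfl

theorem sub_eq_top_iff {M : ProAug O G} {K : Sub M} : K = ⊤ ↔ ∀ x, x ∈ K.toSubmodule := by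
  rw [eq_top_iff, sub_le_iff]
  exact ⟨fun h x => h x trivial, fun h x _ => h x⟩

theorem sub_eq_bot_iff {M : ProAug O G} {K : Sub M} :
    K = ⊥ ↔ ∀ x ∈ K.toSubmodule, x = 0 := by
  rw [eq_bot_iff, sub_le_iff]
  rfl

/-- Irreducible objects. -/
structure IsIrred (X : ProAug O G) : Prop where
  exists_ne : ∃ x : X.carrier, x ≠ 0
  eq_or : ∀ N : Sub X, N = ⊥ ∨ N = ⊤

theorem IsIrred.of_surjective {M X : ProAug O G} (f : M ⟶ X) (hf : Function.Surjective (app f))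
    (hne : ker f ≠ ⊤) (h : ∀ N : Sub M, ker f ≤ N → N = ker f ∨ N = ⊤) : IsIrred X := by
  refine ⟨?_, fun N => ?_⟩
  · by_contra! h0
    exact hne (sub_eq_top_iff.2 fun x => h0 _)
  · rcases h (comapSub f N) (fun x hx => by
      have hx' : app f x = 0 := hx
      change app f x ∈ N.toSubmodule
      rw [hx']; exact zero_mem _) with h1 | h1
    · refine Or.inl (sub_eq_bot_iff.2 fun y hy => ?_)
      obtain ⟨x, rfl⟩ := hf y
      have : x ∈ (comapSub f N).toSubmodule := hy
      rw [h1] at this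
      exact this
    · refine Or.inr (sub_eq_top_iff.2 fun y => ?_)
      obtain ⟨x, rfl⟩ := hf y
      exact (sub_eq_top_iff.1 h1 x : x ∈ (comapSub f N).toSubmodule)

theorem IsIrred.quot {M : ProAug O G} {N : Sub M} (hN : IsCoatom N) : IsIrred (quot N) := by
  have hk : ker (quotπ N) = N := Sub.ext (Submodule.ext fun x => quotπ_eq_zero N x)
  refine IsIrred.of_surjective (quotπ N) (quotπ_surjective N) ?_ ?_
  · rw [hk]; exact hN.1
  · rw [hk]
    intro L hL
    rcases eq_or_lt_of_le hL with h | h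
    · exact Or.inl h.symm
    · exact Or.inr (hN.2 L h)

theorem IsIrred.of_covBy {M X : ProAug O G} {N N' : Sub M} (hN : N ⋖ N') (f : ofSub N' ⟶ X)
    (hf : Function.Surjective (app f))
    (hk : ∀ x : (ofSub N').carrier, app f x = 0 ↔ app (subι N') x ∈ N.toSubmodule) :
    IsIrred X := by
  refine IsIrred.of_surjective f hf (fun h => ?_) fun L hL => ?_
  · refine hN.1.not_ge fun x hx => ?_
    exact (hk ⟨x, hx⟩).1 (sub_eq_top_iff.1 h ⟨x, hx⟩)
  · have h1 : N ≤ mapSub (subι N') L := fun x hx => by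
      exact ⟨⟨x, hN.1.le hx⟩, sub_le_iff.1 hL _ ((hk ⟨x, hN.1.le hx⟩).2 hx), rfl⟩
    have h2 : mapSub (subι N') L ≤ N' := by
      rintro _ ⟨x, -, rfl⟩
      exact x.2
    rcases hN.eq_or_eq h1 h2 with h | h
    · have h3 : ∀ x ∈ L.toSubmodule, app f x = 0 := fun x hx => (hk x).2 (by
        rw [← h]
        exact ⟨x, hx, rfl⟩)
      exact Or.inl (le_antisymm h3 hL)
    · refine Or.inr (sub_eq_top_iff.2 fun x => ?_)
      have : x.1 ∈ (mapSub (subι N') L).toSubmodule := by rw [h]; exact x.2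
      obtain ⟨y, hy, hyx⟩ := this
      rwa [← subι_injective N' hyx]

theorem IsFiniteLength.exists_isCoatom {M : ProAug O G} (hM : IsFiniteLength M)
    (h : ∃ x : M.carrier, x ≠ 0) : ∃ N : Sub M, IsCoatom N := by
  obtain ⟨n, c, h0, h1, h2⟩ := hM
  cases n with
  | zero =>
    obtain ⟨x, hx⟩ := h
    have hbt : (⊥ : Sub M) = ⊤ := h0.symm.trans h1
    exact absurd (sub_eq_bot_iff.1 hbt.symm x trivial) hx
  | succ n =>
    refine ⟨c (Fin.last n).castSucc, ?_⟩
    have := h2 (Fin.last n)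
    rwa [Fin.succ_last, h1, covBy_top_iff] at this

end Subobjects

/-! ### Pointwise arguments in the full subcategory `C`. -/

section FullSubcategories

variable {O G : Type u} [CommRing O] [Group G] [TopologicalSpace G]
  {C : ObjectProperty (ProAug O G)}

theorem full_ext {M N : C.FullSubcategory} {f g : M ⟶ N} (h : ∀ x, ev f x = ev g x) : f = g :=
  ObjectProperty.hom_ext _ (hom_ext h)

section
variable {M N K : C.FullSubcategory}

@[simp] theorem ev_id (x : M.obj.carrier) : ev (𝟙 M) x = x := rfl
@[simp] theorem ev_comp (f : M ⟶ N) (g : N ⟶ K) (x : M.obj.carrier) :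
    ev (f ≫ g) x = ev g (ev f x) := rfl
theorem ev_add (f : M ⟶ N) (x y : M.obj.carrier) : ev f (x + y) = ev f x + ev f y :=
  app_add _ _ _
theorem ev_zero (f : M ⟶ N) : ev f 0 = 0 := app_zero _
theorem ev_smul (f : M ⟶ N) (c : O) (x : M.obj.carrier) : ev f (c • x) = c • ev f x :=
  app_smul _ _ _
theorem ev_sub (f : M ⟶ N) (x y : M.obj.carrier) : ev f (x - y) = ev f x - ev f y :=
  map_sub f.hom.1 x y
theorem ev_sum {ι : Type*} (f : M ⟶ N) (s : Finset ι) (x : ι → M.obj.carrier) :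
    ev f (∑ i ∈ s, x i) = ∑ i ∈ s, ev f (x i) :=
  map_sum f.hom.1 x s
@[simp] theorem zero_ev (x : M.obj.carrier) : ev (0 : M ⟶ N) x = 0 := rfl
@[simp] theorem add_ev (f g : M ⟶ N) (x : M.obj.carrier) : ev (f + g) x = ev f x + ev g x := rfl
@[simp] theorem smul_ev (c : O) (f : M ⟶ N) (x : M.obj.carrier) : ev (c • f) x = c • ev f x := rfl
@[simp] theorem neg_ev (f : M ⟶ N) (x : M.obj.carrier) : ev (-f) x = - ev f x := by
  rw [eq_neg_iff_add_eq_zero, ← add_ev, neg_add_cancel, zero_ev]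
@[simp] theorem sub_ev (f g : M ⟶ N) (x : M.obj.carrier) : ev (f - g) x = ev f x - ev g x := by
  rw [sub_eq_add_neg, add_ev, neg_ev, sub_eq_add_neg]
theorem sum_ev {ι : Type*} (s : Finset ι) (f : ι → (M ⟶ N)) (x : M.obj.carrier) :
    ev (∑ i ∈ s, f i) x = ∑ i ∈ s, ev (f i) x := by
  classical
  induction s using Finset.induction_on with
  | empty => simp
  | insert i s hi ih => simp [Finset.sum_insert hi, ih]

@[simp] theorem mul_ev (f g : End M) (x : M.obj.carrier) : ev (f * g) x = ev f (ev g x) := rfl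
theorem algebraMap_ev (c : O) (x : M.obj.carrier) : ev (algebraMap O (End M) c) x = c • x := by
  rw [Algebra.algebraMap_eq_smul_one]; rfl

theorem ev_congr {f g : M ⟶ N} (h : f = g) (x : M.obj.carrier) : ev f x = ev g x := by rw [h]

theorem mono_of_ev_injective (f : M ⟶ N) (hf : Function.Injective (ev f)) : Mono f :=
  ⟨fun _ _ h => full_ext fun x => hf (congrArg (fun φ => ev φ x) h)⟩

theorem epi_of_ev_surjective (f : M ⟶ N) (hf : Function.Surjective (ev f)) : Epi f :=
  ⟨fun _ _ h => full_ext fun y => by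
    obtain ⟨x, rfl⟩ := hf y
    exact congrArg (fun φ => ev φ x) h⟩

theorem isIso_of_bijective (f : M ⟶ N) (hf : Function.Bijective (ev f)) : IsIso f :=
  (ObjectProperty.isoMk C (isoOfBijective f.hom hf)).isIso_hom

theorem bijective_of_isIso (f : M ⟶ N) [IsIso f] : Function.Bijective (ev f) := by
  refine Function.bijective_iff_has_inverse.2 ⟨ev (inv f), fun x => ?_, fun x => ?_⟩
  · rw [← ev_comp, IsIso.hom_inv_id, ev_id]
  · rw [← ev_comp, IsIso.inv_hom_id, ev_id]

/-- A morphism factors through any surjection whose kernel it kills. -/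
theorem exists_desc (π : M ⟶ N) (hπ : Function.Surjective (ev π)) (f : M ⟶ K)
    (h : ∀ x, ev π x = 0 → ev f x = 0) : ∃ g : N ⟶ K, π ≫ g = f := by
  let e := isoOfBijective (quotDesc (ker π.hom) π.hom fun _ h => h)
    ⟨(injective_iff_map_eq_zero (quotDesc (ker π.hom) π.hom fun _ h => h).1).2 fun x hx => by
      obtain ⟨x, rfl⟩ := quotπ_surjective (ker π.hom) x
      exact (quotπ_eq_zero _ _).2 hx, fun y => by
        obtain ⟨x, rfl⟩ := hπ y
        exact ⟨app (quotπ (ker π.hom)) x, rfl⟩⟩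
  have he : π.hom ≫ e.inv = quotπ (ker π.hom) := by rw [Iso.comp_inv_eq]; rfl
  refine ⟨ObjectProperty.homMk (e.inv ≫ quotDesc (ker π.hom) f.hom h),
    ObjectProperty.hom_ext _ ?_⟩
  change π.hom ≫ e.inv ≫ quotDesc (ker π.hom) f.hom h = f.hom
  rw [← Category.assoc, he]
  rfl

/-- A morphism factors through any injection whose image contains its image. -/
theorem exists_lift (i : N ⟶ M) (hi : Function.Injective (ev i)) (f : K ⟶ M)
    (h : ∀ x, ∃ y, ev i y = ev f x) : ∃ g : K ⟶ N, g ≫ i = f := by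
  let e := isoOfBijective (subLift (range i.hom) i.hom fun x => ⟨x, rfl⟩)
    ⟨fun x y h => hi (congrArg Subtype.val h), by
      rintro ⟨_, x, rfl⟩; exact ⟨x, rfl⟩⟩
  have he : e.inv ≫ i.hom = subι (range i.hom) := by rw [Iso.inv_comp_eq]; rfl
  refine ⟨ObjectProperty.homMk (subLift (range i.hom) f.hom h ≫ e.inv),
    ObjectProperty.hom_ext _ ?_⟩
  change (subLift (range i.hom) f.hom h ≫ e.inv) ≫ i.hom = f.hom
  rw [Category.assoc, he]
  rfl

end

variable [IsDualCat C]

/-- A subobject as an object of the full subcategory. -/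
def subObj {M : C.FullSubcategory} (N : Sub M.obj) : C.FullSubcategory :=
  ⟨ofSub N, haveI := mono_of_injective _ (subι_injective N)
    C.prop_of_mono (subι N) M.property⟩

/-- The inclusion of a subobject. -/
def subInc {M : C.FullSubcategory} (N : Sub M.obj) : subObj N ⟶ M :=
  ObjectProperty.homMk (subι N)

theorem subInc_injective {M : C.FullSubcategory} (N : Sub M.obj) :
    Function.Injective (ev (subInc N)) := subι_injective N

theorem subInc_mem {M : C.FullSubcategory} (N : Sub M.obj) (x : (subObj N).obj.carrier) :
    ev (subInc N) x ∈ N.toSubmodule := x.2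

theorem exists_subInc_eq {M : C.FullSubcategory} (N : Sub M.obj) {x : M.obj.carrier}
    (hx : x ∈ N.toSubmodule) : ∃ y, ev (subInc N) y = x := ⟨⟨x, hx⟩, rfl⟩

theorem exists_subLift {M K : C.FullSubcategory} (N : Sub M.obj) (f : K ⟶ M)
    (h : ∀ x, ev f x ∈ N.toSubmodule) : ∃ g : K ⟶ subObj N, g ≫ subInc N = f :=
  ⟨ObjectProperty.homMk (subLift N f.hom h), rfl⟩

/-- The quotient by a subobject, as an object of the full subcategory. -/
def quotObj {M : C.FullSubcategory} (N : Sub M.obj) : C.FullSubcategory :=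
  ⟨quot N, haveI := epi_of_surjective _ (quotπ_surjective N)
    C.prop_of_epi (quotπ N) M.property⟩

/-- The projection to a quotient. -/
def quotProj {M : C.FullSubcategory} (N : Sub M.obj) : M ⟶ quotObj N :=
  ObjectProperty.homMk (quotπ N)

theorem quotProj_surjective {M : C.FullSubcategory} (N : Sub M.obj) :
    Function.Surjective (ev (quotProj N)) := quotπ_surjective N

theorem quotProj_eq_zero {M : C.FullSubcategory} (N : Sub M.obj) (x : M.obj.carrier) :
    ev (quotProj N) x = 0 ↔ x ∈ N.toSubmodule := quotπ_eq_zero N x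

theorem ev_injective {M N : C.FullSubcategory} (f : M ⟶ N) [Mono f] :
    Function.Injective (ev f) := by
  have h : subInc (ker f.hom) = 0 := by
    rw [← cancel_mono f, zero_comp]
    exact full_ext fun x => x.2
  refine (injective_iff_map_eq_zero f.hom.1).2 fun x hx => ?_
  exact congrArg (fun φ => ev φ (⟨x, hx⟩ : (ker f.hom).toSubmodule)) h

theorem ev_surjective {M N : C.FullSubcategory} (f : M ⟶ N) [Epi f] :
    Function.Surjective (ev f) := by
  have h : quotProj (range f.hom) = 0 := by
    rw [← cancel_epi f]
    exact full_ext fun x => (quotProj_eq_zero _ _).2 ⟨x, rfl⟩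
  intro y
  have : ev (quotProj (range f.hom)) y = 0 := by rw [h]; rfl
  exact (quotProj_eq_zero _ _).1 this

theorem simple_iff {X : C.FullSubcategory} : Simple X ↔ IsIrred X.obj := by
  constructor
  · intro hX
    refine ⟨?_, fun N => ?_⟩
    · by_contra! h0
      exact id_nonzero X (full_ext h0)
    · have := mono_of_ev_injective _ (subInc_injective N)
      by_cases h : subInc N = 0
      · refine Or.inl (sub_eq_bot_iff.2 fun x hx => ?_)
        exact congrArg (fun φ => ev φ (⟨x, hx⟩ : N.toSubmodule)) h
      · have := isIso_of_mono_of_nonzero h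
        refine Or.inr (sub_eq_top_iff.2 fun x => ?_)
        obtain ⟨y, rfl⟩ := (bijective_of_isIso (subInc N)).2 x
        exact y.2
  · intro hX
    refine ⟨fun {Y} f hf => ⟨fun h h0 => ?_, fun h => ?_⟩⟩
    · obtain ⟨x, hx⟩ := hX.exists_ne
      obtain ⟨y, rfl⟩ := (bijective_of_isIso f).2 x
      exact hx (by rw [h0]; rfl)
    · refine isIso_of_bijective f ⟨ev_injective f, ?_⟩
      rcases hX.eq_or (range f.hom) with h1 | h1
      · exact absurd (full_ext fun x => (sub_eq_bot_iff.1 h1 _ ⟨x, rfl⟩ : ev f x = 0)) h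
      · exact fun y => sub_eq_top_iff.1 h1 y

omit [IsDualCat C] in
theorem IsIrred.surjective {X Y : C.FullSubcategory} (hX : IsIrred X.obj) {f : Y ⟶ X}
    (hf : f ≠ 0) : Function.Surjective (ev f) := by
  rcases hX.eq_or (range f.hom) with h1 | h1
  · exact absurd (full_ext fun x => (sub_eq_bot_iff.1 h1 _ ⟨x, rfl⟩ : ev f x = 0)) hf
  · exact fun y => sub_eq_top_iff.1 h1 y

/-- A nonzero element survives in some quotient of finite length, and the top step of a composition
series of that quotient is a maximal proper subobject. -/
theorem exists_simple_quotient_of_ne (X : C.FullSubcategory) (h : ∃ x : X.obj.carrier, x ≠ 0) :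
    ∃ (S : C.FullSubcategory) (f : X ⟶ S), Simple S ∧ Function.Surjective (ev f) := by
  obtain ⟨x, hx⟩ := h
  obtain ⟨N, f, hf, hN, hfx⟩ := IsDualCat.separated X.obj X.property x hx
  obtain ⟨L, hL⟩ := hN.exists_isCoatom ⟨_, hfx⟩
  have hs : Function.Surjective (app (f ≫ quotπ L)) := (quotπ_surjective L).comp hf
  have := epi_of_surjective _ hs
  exact ⟨⟨quot L, C.prop_of_epi (f ≫ quotπ L) X.property⟩, ObjectProperty.homMk (f ≫ quotπ L),
    simple_iff.2 (IsIrred.quot hL), hs⟩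

/-- A subobject through which no map to an irreducible object is killed is everything. -/
theorem surjective_of_forall_simple {X Y : C.FullSubcategory} (f : Y ⟶ X)
    (h : ∀ (S : C.FullSubcategory) (g : X ⟶ S), Simple S → f ≫ g = 0 → g = 0) :
    Function.Surjective (ev f) := by
  by_contra hf
  obtain ⟨x, hx⟩ : ∃ x, x ∉ (range f.hom).toSubmodule := by
    by_contra! h'
    exact hf h'
  obtain ⟨S, g, hS, hg⟩ := exists_simple_quotient_of_ne (quotObj (range f.hom))
    ⟨ev (quotProj _) x, fun h0 => hx ((quotProj_eq_zero _ _).1 h0)⟩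
  have h1 := h S (quotProj (range f.hom) ≫ g) hS (full_ext fun y => by
    have : ev (quotProj (range f.hom)) (ev f y) = 0 := (quotProj_eq_zero _ _).2 ⟨y, rfl⟩
    rw [ev_comp, ev_comp, this, ev_zero, zero_ev])
  obtain ⟨s, hs⟩ := (simple_iff.1 hS).exists_ne
  obtain ⟨z, rfl⟩ := hg s
  obtain ⟨y, rfl⟩ := quotProj_surjective _ z
  exact hs (congrArg (fun φ => ev φ y) h1)

/-- A concrete criterion for short exactness. -/
theorem shortExact_of {X Y Z : C.FullSubcategory} (f : X ⟶ Y) (g : Y ⟶ Z)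
    (hf : Function.Injective (ev f)) (hg : Function.Surjective (ev g)) (w : f ≫ g = 0)
    (hex : ∀ y, ev g y = 0 → ∃ x, ev f x = y) : (ShortComplex.mk f g w).ShortExact := by
  have := mono_of_ev_injective f hf
  have := epi_of_ev_surjective g hg
  refine ShortComplex.ShortExact.mk' (ShortComplex.exact_of_f_is_kernel _ ?_) ‹_› ‹_›
  have key : ∀ {T : C.FullSubcategory} (k : T ⟶ Y), k ≫ g = 0 → ∃ l : T ⟶ X, l ≫ f = k :=
    fun k hk => exists_lift f hf k fun x => hex _ (congrArg (fun φ => ev φ x) hk)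
  exact KernelFork.IsLimit.ofι _ _ (fun k hk => (key k hk).choose)
    (fun k hk => (key k hk).choose_spec)
    (fun k hk m hm => by rw [← cancel_mono f, hm, (key k hk).choose_spec])

/-- The power `X ^ ι`. -/
def pow (ι : Type u) (X : C.FullSubcategory) : C.FullSubcategory :=
  ⟨pi fun _ : ι => X.obj, prop_pi C _ fun _ => X.property⟩

variable {ι : Type u}

/-- The projections of a power. -/
def powProj (X : C.FullSubcategory) (i : ι) : pow ι X ⟶ X :=
  ObjectProperty.homMk (piProj (fun _ : ι => X.obj) i)

/-- The morphism to a power with given components. -/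
def powLift {X Y : C.FullSubcategory} (f : ι → (Y ⟶ X)) : Y ⟶ pow ι X :=
  ObjectProperty.homMk (piLift (fun _ : ι => X.obj) fun i => (f i).hom)

@[simp] theorem powLift_proj {X Y : C.FullSubcategory} (f : ι → (Y ⟶ X)) (i : ι) :
    powLift f ≫ powProj X i = f i := rfl

theorem pow_ext {X : C.FullSubcategory} {x y : (pow ι X).obj.carrier}
    (h : ∀ i, ev (powProj X i) x = ev (powProj X i) y) : x = y := funext h

theorem pow_hom_ext {X Y : C.FullSubcategory} {f g : Y ⟶ pow ι X}
    (h : ∀ i, f ≫ powProj X i = g ≫ powProj X i) : f = g :=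
  full_ext fun x => pow_ext fun i => congrArg (fun φ => ev φ x) (h i)

theorem exists_pow_eq {X : C.FullSubcategory} (x : ι → X.obj.carrier) :
    ∃ y : (pow ι X).obj.carrier, ∀ i, ev (powProj X i) y = x i := ⟨x, fun _ => rfl⟩

/-- The morphism `X ^ ι → X ^ ι` induced by `f`. -/
def powMap (ι : Type u) {X Y : C.FullSubcategory} (f : X ⟶ Y) : pow ι X ⟶ pow ι Y :=
  powLift fun i => powProj X i ≫ f

@[simp] theorem powMap_proj {X Y : C.FullSubcategory} (f : X ⟶ Y) (i : ι) :
    powMap ι f ≫ powProj Y i = powProj X i ≫ f := rfl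

variable [Fintype ι]

/-- The morphism `X ^ ι → Y` that is `f i` on the `i`-th copy of `X`. -/
def sumMap {X Y : C.FullSubcategory} (f : ι → (X ⟶ Y)) : pow ι X ⟶ Y :=
  ∑ i, powProj X i ≫ f i

theorem ev_sumMap {X Y : C.FullSubcategory} (f : ι → (X ⟶ Y)) (x : (pow ι X).obj.carrier) :
    ev (sumMap f) x = ∑ i, ev (f i) (ev (powProj X i) x) := by
  rw [sumMap, sum_ev]; rfl

theorem comp_sumMap {X Y Z : C.FullSubcategory} (f : ι → (X ⟶ Y)) (g : Z ⟶ pow ι X) :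
    g ≫ sumMap f = ∑ i, (g ≫ powProj X i) ≫ f i := by
  simp [sumMap, Preadditive.comp_sum]

open Classical in
/-- The inclusion of the `i`-th copy of `X` in `X ^ ι`. -/
def powInc (X : C.FullSubcategory) (i : ι) : X ⟶ pow ι X :=
  powLift fun j => if j = i then 𝟙 X else 0

theorem powInc_sumMap {X Y : C.FullSubcategory} (f : ι → (X ⟶ Y)) (i : ι) :
    powInc X i ≫ sumMap f = f i := by
  classical
  rw [comp_sumMap, Finset.sum_eq_single i]
  · simp [powInc]
  · intro j _ hj; simp [powInc, hj]
  · simp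

theorem sum_proj_inc (X : C.FullSubcategory) :
    ∑ i : ι, powProj X i ≫ powInc X i = 𝟙 (pow ι X) := by
  classical
  refine pow_hom_ext fun j => ?_
  rw [Preadditive.sum_comp, Finset.sum_eq_single j]
  · simp [powInc]
  · intro i _ hi; simp [powInc, hi.symm]
  · simp

theorem pow_hom_eq_zero {X Y : C.FullSubcategory} (h : ∀ f : X ⟶ Y, f = 0) (g : pow ι X ⟶ Y) :
    g = 0 := by
  rw [← Category.id_comp g, ← sum_proj_inc, Preadditive.sum_comp]
  exact Finset.sum_eq_zero fun i _ => by rw [Category.assoc, h (powInc X i ≫ g), comp_zero]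

end FullSubcategories

/-! ### Vanishing of `Ext` along short exact sequences, retracts and finite sums. -/

section ExtVanishing

open Abelian

variable {D : Type*} [Category D] [Abelian D] [HasExt.{u} D]

/-- `Ext^n(X, R)` vanishes. -/
def ExtVanish (X R : D) (n : ℕ) : Prop := ∀ e : Ext.{u} X R n, e = 0

theorem extVanish_zero_iff {X R : D} : ExtVanish.{u} X R 0 ↔ ∀ f : X ⟶ R, f = 0 := by
  constructor
  · intro h f
    exact (Ext.mk₀_eq_zero_iff f).1 (h _)
  · intro h e
    obtain ⟨f, rfl⟩ := (Ext.mk₀_bijective X R).2 e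
    rw [h f, Ext.mk₀_zero]

theorem ExtVanish.of_projective (P R : D) [Projective P] (n : ℕ) : ExtVanish.{u} P R (n + 1) :=
  fun _ => Ext.eq_zero_of_projective _

variable {S : ShortComplex D} (hS : S.ShortExact) {R : D} {n : ℕ}

include hS in
theorem ExtVanish.right (h1 : ExtVanish.{u} S.X₁ R n) (h2 : ExtVanish.{u} S.X₂ R (n + 1)) :
    ExtVanish.{u} S.X₃ R (n + 1) := by
  intro e
  obtain ⟨x, rfl⟩ := Ext.contravariant_sequence_exact₃ hS R e (h2 _) (add_comm 1 n)
  rw [h1 x, Ext.comp_zero]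

include hS in
theorem ExtVanish.mid (h1 : ExtVanish.{u} S.X₁ R n) (h3 : ExtVanish.{u} S.X₃ R n) :
    ExtVanish.{u} S.X₂ R n := by
  intro e
  obtain ⟨x, rfl⟩ := Ext.contravariant_sequence_exact₂ hS R e (h1 _)
  rw [h3 x, Ext.comp_zero]

include hS in
theorem ExtVanish.left (h2 : ExtVanish.{u} S.X₂ R n) (h3 : ExtVanish.{u} S.X₃ R (n + 1)) :
    ExtVanish.{u} S.X₁ R n := by
  intro e
  obtain ⟨x, rfl⟩ := Ext.contravariant_sequence_exact₁ hS R e (add_comm 1 n) (h3 _)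
  rw [h2 x, Ext.comp_zero]

theorem ExtVanish.of_retract {X Y : D} (i : X ⟶ Y) (p : Y ⟶ X) (h : i ≫ p = 𝟙 X)
    (hY : ExtVanish.{u} Y R n) : ExtVanish.{u} X R n := by
  intro e
  have h1 : (Ext.mk₀ i).comp ((Ext.mk₀ p).comp e (zero_add n)) (zero_add n) = e := by
    rw [Ext.mk₀_comp_mk₀_assoc, h, Ext.mk₀_id_comp]
  rw [← h1, show (Ext.mk₀ p).comp e (zero_add n) = 0 from hY _, Ext.comp_zero]

theorem ExtVanish.of_sum {ι : Type*} [Fintype ι] {X Y : D} (p : ι → (Y ⟶ X)) (i : ι → (X ⟶ Y))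
    (h : ∑ j, p j ≫ i j = 𝟙 Y) (hX : ExtVanish.{u} X R n) : ExtVanish.{u} Y R n := by
  intro e
  rw [← Ext.mk₀_id_comp e, ← h]
  have h1 : ∀ s : Finset ι, (Ext.mk₀ (∑ j ∈ s, p j ≫ i j)).comp e (zero_add n) = 0 := by
    classical
    intro s
    induction s using Finset.induction_on with
    | empty => simp
    | insert j s hj ih =>
      rw [Finset.sum_insert hj, Ext.mk₀_add, Ext.add_comp, ih, add_zero,
        ← Ext.mk₀_comp_mk₀_assoc,
        show (Ext.mk₀ (i j)).comp e (zero_add n) = 0 from hX _, Ext.comp_zero]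
  exact h1 _

end ExtVanishing

section

variable {O G : Type u} [CommRing O] [Group G] [TopologicalSpace G]
  {C : ObjectProperty (ProAug O G)} [IsDualCat C]

theorem ExtVanish.pow {ι : Type u} [Fintype ι] {X R : C.FullSubcategory} {n : ℕ}
    (h : ExtVanish.{u + 1} X R n) : ExtVanish.{u + 1} (pow ι X) R n :=
  h.of_sum _ _ (sum_proj_inc X)

end

/-! ### Maps out of a projective envelope of an irreducible object. -/

section Envelope

variable {O G : Type u} [CommRing O] [Group G] [TopologicalSpace G]
  {C : ObjectProperty (ProAug O G)} [IsDualCat C]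
  {S P : C.FullSubcategory} {κ : P ⟶ S}

namespace IsProjectiveEnvelope

omit [IsDualCat C] in
theorem exists_lift (hκ : IsProjectiveEnvelope κ) {X Y : C.FullSubcategory} (g : X ⟶ Y)
    (hg : Function.Surjective (ev g)) (f : P ⟶ Y) : ∃ h : P ⟶ X, h ≫ g = f := by
  have := hκ.projective
  have := epi_of_ev_surjective g hg
  exact ⟨Projective.factorThru f g, Projective.factorThru_comp f g⟩

theorem surjective (hκ : IsProjectiveEnvelope κ) : Function.Surjective (ev κ) := by
  have := hκ.epi
  exact ev_surjective κ

/-- This is essentiality in terms of elements, and plays the role of Nakayama's lemma for `P`. -/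
theorem eq_top (hκ : IsProjectiveEnvelope κ) (N : Sub P.obj)
    (h : ∀ s, ∃ x ∈ N.toSubmodule, ev κ x = s) : N = ⊤ := by
  have := hκ.essential (subInc N) (epi_of_ev_surjective _ fun s => by
    obtain ⟨x, hx, rfl⟩ := h s
    exact ⟨⟨x, hx⟩, rfl⟩)
  refine sub_eq_top_iff.2 fun x => ?_
  obtain ⟨y, rfl⟩ := ev_surjective (subInc N) x
  exact y.2

/-- A chain `N ⋖ N'` with `N'` containing the image of `g` : then `g` sends `ker κ` to `N`. -/
theorem mem_of_covBy (hκ : IsProjectiveEnvelope κ) {M : C.FullSubcategory} {N N' : Sub M.obj}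
    (hN : N ⋖ N') (g : P ⟶ M) (hg : ∀ x, ev g x ∈ N'.toSubmodule) {x : P.obj.carrier}
    (hx : ev κ x = 0) : ev g x ∈ N.toSubmodule := by
  let V := supSub N (mapSub g.hom (ker κ.hom))
  have h1 : N ≤ V := (le_sup_left : N.toSubmodule ≤ _)
  have h2 : V ≤ N' := by
    refine (sup_le hN.1.le ?_ : _ ≤ N'.toSubmodule)
    rintro _ ⟨y, -, rfl⟩
    exact hg y
  have h3 : ev g x ∈ V.toSubmodule := Submodule.mem_sup_right ⟨x, hx, rfl⟩
  rcases hN.eq_or_eq h1 h2 with h | h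
  · rwa [h] at h3
  -- Now `N + g(ker κ) = N'`, so every element of `P` is congruent modulo `ker κ` to one of
  -- `g⁻¹(N)`. Thus `g⁻¹(N)` maps onto `S` and is all of `P`.
  · have h4 : comapSub g.hom N = ⊤ := by
      refine hκ.eq_top _ fun s => ?_
      obtain ⟨y, rfl⟩ := hκ.surjective s
      have h5 : ev g y ∈ V.toSubmodule := by rw [h]; exact hg y
      obtain ⟨a, ha, b, ⟨z, hz, rfl⟩, hab⟩ := Submodule.mem_sup.1 h5
      refine ⟨y - z, ?_, ?_⟩
      · change ev g (y - z) ∈ N.toSubmodule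
        rw [ev_sub, ← hab]
        change a + ev g z - ev g z ∈ N.toSubmodule
        rwa [add_sub_cancel_right]
      · rw [ev_sub, show ev κ z = 0 from hz, sub_zero]
    exact sub_eq_top_iff.1 h4 x

theorem ev_eq_zero_of_irred (hκ : IsProjectiveEnvelope κ) {X : C.FullSubcategory}
    (hX : IsIrred X.obj) (g : P ⟶ X) {x : P.obj.carrier} (hx : ev κ x = 0) : ev g x = 0 := by
  have h : (⊥ : Sub X.obj) ⋖ ⊤ := by
    refine ⟨bot_lt_iff_ne_bot.2 fun h => ?_, fun N h1 h2 => ?_⟩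
    · obtain ⟨y, hy⟩ := hX.exists_ne
      exact hy (sub_eq_bot_iff.1 h y trivial)
    · rcases hX.eq_or N with h | h
      · exact h1.ne' h
      · exact h2.ne h
  exact hκ.mem_of_covBy h g (fun _ => trivial) hx

/-- A nonzero morphism from `P` to an irreducible object is `κ` followed by an isomorphism. -/
theorem exists_iso (hκ : IsProjectiveEnvelope κ) (hS : IsIrred S.obj) {X : C.FullSubcategory}
    (hX : IsIrred X.obj) {g : P ⟶ X} (hg : g ≠ 0) : ∃ e : S ≅ X, κ ≫ e.hom = g := by
  obtain ⟨e, he⟩ := exists_desc κ hκ.surjective g fun x => hκ.ev_eq_zero_of_irred hX g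
  have : Simple S := simple_iff.2 hS
  have : Simple X := simple_iff.2 hX
  have : IsIso e := isIso_of_hom_simple (fun h => hg (by rw [← he, h, comp_zero]))
  exact ⟨asIso e, he⟩

theorem ne_zero (hκ : IsProjectiveEnvelope κ) (hS : IsIrred S.obj) : κ ≠ 0 := by
  rintro rfl
  obtain ⟨s, hs⟩ := hS.exists_ne
  obtain ⟨x, rfl⟩ := hκ.surjective s
  exact hs rfl

theorem exists_smul_eq (hκ : IsProjectiveEnvelope κ) (hS : IsIrred S.obj)
    (hend : Function.Surjective (algebraMap O (End S))) (g : P ⟶ S) : ∃ c : O, g = c • κ := by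
  obtain ⟨e, he⟩ := exists_desc κ hκ.surjective g fun x => hκ.ev_eq_zero_of_irred hS g
  obtain ⟨c, hc⟩ := hend e
  refine ⟨c, full_ext fun x => ?_⟩
  rw [← he, ev_comp, smul_ev, ← algebraMap_ev, hc]

end IsProjectiveEnvelope

end Envelope

/-! ### Multiplicity one: `Hom(P, Q)` is generated by `θ`. -/

section MultiplicityOne

variable {O G : Type u} [CommRing O] [Group G] [TopologicalSpace G]
  {C : ObjectProperty (ProAug O G)} [IsDualCat C]
  {S P Q : C.FullSubcategory} {κ : P ⟶ S} {ϖ : O}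

namespace IsProjectiveEnvelope

theorem smul_eq_zero_iff (hκ : IsProjectiveEnvelope κ) (hS : IsIrred S.obj)
    (hmax : (Ideal.span {ϖ}).IsMaximal) (hϖS : ∀ x : S.obj.carrier, ϖ • x = 0) (c : O) :
    c • κ = 0 ↔ c ∈ Ideal.span {ϖ} := by
  have h1 : ∀ d ∈ Ideal.span {ϖ}, d • κ = 0 := by
    intro d hd
    obtain ⟨a, rfl⟩ := Ideal.mem_span_singleton'.1 hd
    refine full_ext fun x => ?_
    rw [smul_ev, mul_smul, hϖS, smul_zero, zero_ev]
  refine ⟨fun h => ?_, h1 c⟩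
  by_contra hc
  obtain ⟨a, b, hb, hab⟩ := hmax.exists_inv hc
  refine hκ.ne_zero hS ?_
  rw [← one_smul O κ, ← hab, add_smul, mul_smul, h, smul_zero, zero_add, h1 b hb]

/-- The quotient `N' / N` is irreducible, and a nonzero map from `P` to it would identify it with
`S`. -/
theorem mem_of_not_quotientIso (hκ : IsProjectiveEnvelope κ) (hS : IsIrred S.obj)
    {N N' : Sub Q.obj} (hN : N ⋖ N') (h : ¬ QuotientIso N N' S.obj) (g : P ⟶ Q)
    (hg : ∀ x, ev g x ∈ N'.toSubmodule) (x : P.obj.carrier) : ev g x ∈ N.toSubmodule := by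
  obtain ⟨g', rfl⟩ := exists_subLift N' g hg
  let L : Sub (subObj N').obj := comapSub (subι N') N
  by_contra hx
  have hX : IsIrred (quotObj L).obj := by
    refine IsIrred.of_covBy hN (quotπ L) (quotπ_surjective L) fun y => ?_
    exact quotπ_eq_zero L y
  obtain ⟨e, he⟩ := hκ.exists_iso hS hX (g := g' ≫ quotProj L) fun h0 => hx (by
    have := congrArg (fun φ => ev φ x) h0
    exact (quotProj_eq_zero L _).1 this)
  have hb := bijective_of_isIso e.inv
  refine h ⟨(quotProj L ≫ e.inv).hom, hb.2.comp (quotProj_surjective L), fun y => ?_⟩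
  change ev e.inv (ev (quotProj L) y) = 0 ↔ _
  rw [← ev_zero e.inv, hb.1.eq_iff]
  exact quotProj_eq_zero L y

/-- The image of `g` sinks through every step of the series that is not isomorphic to `S`. -/
theorem mem_of_isCompositionSeries (hκ : IsProjectiveEnvelope κ) (hS : IsIrred S.obj)
    {n : ℕ} {c : Fin (n + 1) → Sub Q.obj} (hc : IsCompositionSeries Q.obj c) (g : P ⟶ Q)
    {a : Fin (n + 1)} (ha : ∀ x, ev g x ∈ (c a).toSubmodule) (b : Fin (n + 1)) (hba : b ≤ a)
    (h : ∀ j : Fin n, b ≤ j.castSucc → j.castSucc < a →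
      ¬ QuotientIso (c j.castSucc) (c j.succ) S.obj) :
    ∀ x, ev g x ∈ (c b).toSubmodule := by
  induction b using Fin.reverseInduction with
  | last =>
    rw [Fin.last_le_iff] at hba
    rwa [hba] at ha
  | cast j ih =>
    rcases hba.eq_or_lt with rfl | hlt
    · exact ha
    · refine hκ.mem_of_not_quotientIso hS (hc.2.2 j) (h j le_rfl hlt) g (ih ?_ fun i hi => ?_)
      · exact Fin.castSucc_lt_iff_succ_le.1 hlt
      · exact h i ((Fin.castSucc_lt_succ (i := j)).le.trans hi)

/-- All maps `P → Q` land in the upper term of the unique step isomorphic to `S`. They are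
determined by the induced map `P → S`, because a map that lands in the lower term sinks to zero.
Finally every map `P → S` is a multiple of `κ`. -/
theorem hom_eq_smul (hκ : IsProjectiveEnvelope κ) (hS : IsIrred S.obj)
    (hend : Function.Surjective (algebraMap O (End S))) (hmax : (Ideal.span {ϖ}).IsMaximal)
    (hϖS : ∀ x : S.obj.carrier, ϖ • x = 0) (H2 : HasMultiplicityOne S.obj Q.obj)
    {θ : P ⟶ Q} (hθ : θ ≠ 0) (g : P ⟶ Q) : ∃ c : O, g = c • θ := by
  obtain ⟨n, c, hc, i, ⟨q, hq, hqk⟩, huniq⟩ := H2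
  have hup : ∀ f : P ⟶ Q, ∀ x, ev f x ∈ (c i.succ).toSubmodule := fun f =>
    hκ.mem_of_isCompositionSeries hS hc f (a := Fin.last n)
      (fun x => by rw [hc.2.1]; trivial) _ (Fin.le_last _) fun j hj _ hQ => by
        rw [huniq j hQ] at hj
        exact absurd hj (not_le.2 Fin.castSucc_lt_succ)
  have hdown : ∀ f : P ⟶ Q, (∀ x, ev f x ∈ (c i.castSucc).toSubmodule) → f = 0 := fun f hf => by
    have := hκ.mem_of_isCompositionSeries hS hc f hf 0 (Fin.zero_le _) fun j _ hj hQ => by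
      rw [huniq j hQ] at hj
      exact lt_irrefl _ hj
    rw [hc.1] at this
    exact full_ext this
  obtain ⟨θ', hθ'⟩ := exists_subLift (c i.succ) θ (hup θ)
  obtain ⟨g', hg'⟩ := exists_subLift (c i.succ) g (hup g)
  let q' : subObj (c i.succ) ⟶ S := ObjectProperty.homMk q
  have hq' : ∀ f : P ⟶ subObj (c i.succ), f ≫ q' = 0 → f ≫ subInc (c i.succ) = 0 := by
    intro f hf
    refine hdown _ fun x => (hqk _).1 ?_
    exact congrArg (fun φ => ev φ x) hf
  obtain ⟨a, ha⟩ := hκ.exists_smul_eq hS hend (θ' ≫ q')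
  obtain ⟨b, hb⟩ := hκ.exists_smul_eq hS hend (g' ≫ q')
  have hs := hκ.smul_eq_zero_iff hS hmax hϖS
  have ha' : a ∉ Ideal.span {ϖ} := by
    rw [← hs, ← ha]
    exact fun h => hθ (by rw [← hθ', hq' _ h])
  obtain ⟨d, y, hy, hdy⟩ := hmax.exists_inv ha'
  -- In the step isomorphic to `S`, `θ` and `g` become `a • κ` and `b • κ`, and `d` inverts `a`
  -- modulo `ϖ`.
  refine ⟨b * d, ?_⟩
  have h1 : (g' - (b * d) • θ') ≫ q' = 0 := by
    rw [Preadditive.sub_comp, Linear.smul_comp, ha, hb, smul_smul, ← sub_smul, hs]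
    have : b - b * d * a = b * y := by
      calc b - b * d * a = b * (d * a + y) - b * d * a := by rw [hdy, mul_one]
        _ = b * y := by ring
    rw [this]
    exact Ideal.mul_mem_left _ _ hy
  have h2 := hq' _ h1
  rw [Preadditive.sub_comp, Linear.smul_comp, hθ', hg', sub_eq_zero] at h2
  exact h2

end IsProjectiveEnvelope

/-- The properties of `κ : P → S` and `Q` that come from irreducibility of `S`, `End(S) = k` and
(H1), (H2). -/
structure IsCosocle (ϖ : O) (κ : P ⟶ S) (Q : C.FullSubcategory) : Prop where
  envelope : IsProjectiveEnvelope κ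
  irred : IsIrred S.obj
  endo : Function.Surjective (algebraMap O (End S))
  maximal : (Ideal.span {ϖ}).IsMaximal
  smul_S : ∀ x : S.obj.carrier, ϖ • x = 0
  smul_Q : ∀ x : Q.obj.carrier, ϖ • x = 0
  simple_quotient : ∀ X : C.FullSubcategory, IsIrred X.obj → ∀ f : Q ⟶ X, f ≠ 0 → Nonempty (S ≅ X)
  multiplicity : HasMultiplicityOne S.obj Q.obj

namespace IsCosocle

variable (h : IsCosocle ϖ κ Q)
include h

theorem smul_κ (c : O) : c • κ = 0 ↔ c ∈ Ideal.span {ϖ} :=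
  h.envelope.smul_eq_zero_iff h.irred h.maximal h.smul_S c

omit [IsDualCat C] in
theorem exists_ne : ∃ x : Q.obj.carrier, x ≠ 0 := by
  obtain ⟨n, c, hc, i, ⟨q, hq, hqk⟩, -⟩ := h.multiplicity
  obtain ⟨s, hs⟩ := h.irred.exists_ne
  obtain ⟨x, rfl⟩ := hq s
  refine ⟨app (subι _) x, fun h0 => hs ?_⟩
  rw [subι_injective _ (h0.trans (app_zero _).symm), app_zero]

theorem exists_hom : ∃ φ₀ : Q ⟶ S, φ₀ ≠ 0 := by
  obtain ⟨X, f, hX, hf⟩ := exists_simple_quotient_of_ne Q h.exists_ne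
  have hX' := simple_iff.1 hX
  have hf0 : f ≠ 0 := by
    rintro rfl
    obtain ⟨x, hx⟩ := hX'.exists_ne
    obtain ⟨y, rfl⟩ := hf x
    exact hx rfl
  obtain ⟨e⟩ := h.simple_quotient X hX' f hf0
  refine ⟨f ≫ e.inv, fun h0 => hf0 ?_⟩
  rw [← Category.comp_id f, ← e.inv_hom_id, ← Category.assoc, h0, zero_comp]

omit [IsDualCat C] in
theorem exists_theta {φ₀ : Q ⟶ S} (hφ₀ : φ₀ ≠ 0) : ∃ θ : P ⟶ Q, θ ≫ φ₀ = κ :=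
  h.envelope.exists_lift φ₀ (h.irred.surjective hφ₀) κ

variable {φ₀ : Q ⟶ S} {θ : P ⟶ Q} (hθ : θ ≫ φ₀ = κ)
include hθ

theorem theta_ne_zero : θ ≠ 0 := by
  rintro rfl
  exact h.envelope.ne_zero h.irred (by rw [← hθ, zero_comp])

theorem hom_eq (g : P ⟶ Q) : ∃ c : O, g = c • θ :=
  h.envelope.hom_eq_smul h.irred h.endo h.maximal h.smul_S h.multiplicity (h.theta_ne_zero hθ) g

theorem smul_θ (c : O) : c • θ = 0 ↔ c ∈ Ideal.span {ϖ} := by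
  refine ⟨fun hc => (h.smul_κ c).1 ?_, fun hc => ?_⟩
  · rw [← hθ, ← Linear.smul_comp, hc, zero_comp]
  · obtain ⟨a, rfl⟩ := Ideal.mem_span_singleton'.1 hc
    exact full_ext fun x => by rw [smul_ev, mul_smul, h.smul_Q, smul_zero, zero_ev]

/-- Along `f`, the map `κ` followed by `S ≅ X` lifts to a map `P → Q`, which is a multiple of `θ`.
So `θ ≫ f = 0` would give `κ = 0`. -/
theorem comp_ne_zero {X : C.FullSubcategory} (hX : IsIrred X.obj) {f : Q ⟶ X} (hf : f ≠ 0) :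
    θ ≫ f ≠ 0 := by
  intro h0
  obtain ⟨e⟩ := h.simple_quotient X hX f hf
  obtain ⟨θ', hθ'⟩ := h.envelope.exists_lift f (hX.surjective hf) (κ ≫ e.hom)
  obtain ⟨c, rfl⟩ := h.hom_eq hθ θ'
  rw [Linear.smul_comp, h0, smul_zero] at hθ'
  refine h.envelope.ne_zero h.irred ?_
  rw [← Category.comp_id κ, ← e.hom_inv_id, ← Category.assoc, ← hθ', zero_comp]

theorem theta_surjective : Function.Surjective (ev θ) :=
  surjective_of_forall_simple θ fun X g hX hg => by
    by_contra h0
    exact h.comp_ne_zero hθ (simple_iff.1 hX) h0 hg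

/-- Since `f ≫ θ = c • θ`, both sides say that `c` lies in `(ϖ)`. This allows the maximal ideal of
`End P` to be tested on `Q` instead of `S`. -/
theorem comp_kappa_iff (f : P ⟶ P) : f ≫ κ = 0 ↔ f ≫ θ = 0 := by
  refine ⟨fun h0 => ?_, fun h0 => by rw [← hθ, ← Category.assoc, h0, zero_comp]⟩
  obtain ⟨c, hc⟩ := h.hom_eq hθ (f ≫ θ)
  have h1 : c • κ = 0 := by
    rw [← hθ, ← Linear.smul_comp, ← hc, Category.assoc, hθ, h0]
  rw [hc, (h.smul_θ hθ c).2 ((h.smul_κ c).1 h1)]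

omit h hθ [IsDualCat C] in
theorem rad_le_ker {X : C.FullSubcategory} (hX : IsIrred X.obj) (f : Q ⟶ X)
    {x : Q.obj.carrier} (hx : x ∈ (rad Q.obj).toSubmodule) : ev f x = 0 := by
  by_cases hf : f = 0
  · rw [hf, zero_ev]
  have hs := hX.surjective hf
  have hco : IsCoatom (ker f.hom) := by
    refine ⟨fun h0 => ?_, fun L hL => ?_⟩
    · exact hf (full_ext fun y => sub_eq_top_iff.1 h0 y)
    · rcases hX.eq_or (mapSub f.hom L) with h1 | h1
      · refine absurd (sub_le_iff.2 fun y hy => ?_) hL.not_ge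
        exact sub_eq_bot_iff.1 h1 _ ⟨y, hy, rfl⟩
      · refine sub_eq_top_iff.2 fun y => ?_
        obtain ⟨z, hz, hzy⟩ := sub_eq_top_iff.1 h1 (ev f y)
        have h2 : y - z ∈ (ker f.hom).toSubmodule := by
          change ev f (y - z) = 0
          rw [ev_sub]
          exact sub_eq_zero.2 hzy.symm
        have := add_mem (sub_le_iff.1 hL.le _ h2) hz
        rwa [sub_add_cancel] at this
  exact (Submodule.mem_iInf _).1 hx ⟨_, hco⟩

/-- Such a map, viewed in `Q`, is some `c • θ`. Since `φ₀` kills the radical, `c • κ = 0`, so `c`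
lies in `(ϖ)` and kills `θ`. -/
theorem hom_radical_eq_zero (f : P ⟶ radical Q) : f = 0 := by
  let i : radical Q ⟶ Q := subInc (rad Q.obj)
  have hi : Function.Injective (ev i) := subInc_injective _
  obtain ⟨c, hc⟩ := h.hom_eq hθ (f ≫ i)
  have h1 : c • κ = 0 := by
    rw [← hθ, ← Linear.smul_comp, ← hc]
    exact full_ext fun x => rad_le_ker h.irred φ₀ (subInc_mem (rad Q.obj) _)
  have := mono_of_ev_injective i hi
  rw [← cancel_mono i, hc, (h.smul_θ hθ c).2 ((h.smul_κ c).1 h1), zero_comp]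

omit hθ in
-- If `g` did not land in `rad Q`, it would induce a nonzero map from `Y` to some irreducible
-- quotient of `Q`, necessarily isomorphic to `S`. Then `κ` would lift to a nonzero map `P → Y`.
-- This is the criterion that kills the kernel in `IsHead.exists_graded_basis`.
theorem hom_eq_zero {Y : C.FullSubcategory} (hP : ∀ g : P ⟶ Y, g = 0)
    (hR : ∀ g : Y ⟶ radical Q, g = 0) (g : Y ⟶ Q) : g = 0 := by
  have h1 : ∀ y, ev g y ∈ (rad Q.obj).toSubmodule := by
    intro y
    refine (Submodule.mem_iInf _).2 fun N => ?_
    rw [← quotProj_eq_zero (M := Q) N.1]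
    by_contra h0
    have hX : IsIrred (quotObj (M := Q) N.1).obj := IsIrred.quot N.2
    have hne : g ≫ quotProj N.1 ≠ 0 := fun h2 => h0 (congrArg (fun φ => ev φ y) h2)
    obtain ⟨e⟩ := h.simple_quotient _ hX (quotProj N.1) fun h2 => hne (by rw [h2, comp_zero])
    obtain ⟨k, hk⟩ := h.envelope.exists_lift _ (hX.surjective hne) (κ ≫ e.hom)
    rw [hP k, zero_comp] at hk
    refine h.envelope.ne_zero h.irred ?_
    rw [← Category.comp_id κ, ← e.hom_inv_id, ← Category.assoc, ← hk, zero_comp]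
  obtain ⟨l, rfl⟩ := exists_subLift (rad Q.obj) g h1
  rw [show l = 0 from hR l, zero_comp]

end IsCosocle
end MultiplicityOne

/-! ### Reduction modulo `ϖ`: generators of `ker θ`, and `Ext²` from `C(k)` to `C(O)`. -/

section KilledBy

open Abelian

variable {O G : Type u} [CommRing O] [Group G] [TopologicalSpace G]
  {C : ObjectProperty (ProAug O G)} [IsDualCat C] {ϖ : O}

omit [IsDualCat C] in
theorem incl_map_eq_zero_iff {X Y : (killedBy C ϖ).FullSubcategory} (f : X ⟶ Y) :
    (incl C ϖ).map f = 0 ↔ f = 0 :=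
  ⟨fun h => full_ext fun x => (ev_congr h x :), fun h => full_ext fun x => (ev_congr h x :)⟩

/-- An object of `C` killed by `ϖ`, as an object of `C(k)`. -/
def toKilled (X : C.FullSubcategory) (hX : ∀ x : X.obj.carrier, ϖ • x = 0) :
    (killedBy C ϖ).FullSubcategory := ⟨X.obj, X.property, hX⟩

/-- The inclusion of `C(k)` into `C(O)` is full. -/
def inclPreimage {X Y : (killedBy C ϖ).FullSubcategory}
    (f : (incl C ϖ).obj X ⟶ (incl C ϖ).obj Y) : X ⟶ Y := ObjectProperty.homMk f.hom

/-- The submodule `ϖ M`. -/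
def smulSub (ϖ : O) (M : C.FullSubcategory) : Sub M.obj := range (ϖ • 𝟙 M : M ⟶ M).hom

/-- `M / ϖ M`. -/
def modObj (ϖ : O) (M : C.FullSubcategory) : (killedBy C ϖ).FullSubcategory :=
  toKilled (quotObj (smulSub ϖ M)) fun x => by
    obtain ⟨x, rfl⟩ := quotProj_surjective _ x
    rw [← ev_smul, quotProj_eq_zero]
    exact ⟨x, rfl⟩

/-- The projection `M → M / ϖ M`. -/
def modProj (ϖ : O) (M : C.FullSubcategory) : M ⟶ (incl C ϖ).obj (modObj ϖ M) :=
  quotProj (smulSub ϖ M)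

theorem modProj_surjective (M : C.FullSubcategory) : Function.Surjective (ev (modProj ϖ M)) :=
  quotProj_surjective _

theorem modProj_eq_zero (M : C.FullSubcategory) (x : M.obj.carrier) :
    ev (modProj ϖ M) x = 0 ↔ ∃ y, ϖ • y = x := quotProj_eq_zero _ _

theorem exists_modDesc {M : C.FullSubcategory} {X : (killedBy C ϖ).FullSubcategory}
    (f : M ⟶ (incl C ϖ).obj X) : ∃ g : modObj ϖ M ⟶ X, modProj ϖ M ≫ (incl C ϖ).map g = f := by
  obtain ⟨g, hg⟩ := exists_desc (modProj ϖ M) (modProj_surjective M) f fun x hx => by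
    obtain ⟨y, rfl⟩ := (modProj_eq_zero M x).1 hx
    rw [ev_smul]
    exact X.property.2 _
  exact ⟨inclPreimage g, hg⟩

/-- Maps from `P / ϖ P` to objects killed by `ϖ` are the same as maps from `P`. -/
theorem projective_modObj (P : C.FullSubcategory) [Projective P] : Projective (modObj ϖ P) where
  factors {X Y} f e he := by
    have := epi_of_ev_surjective ((incl C ϖ).map e) (ev_surjective e)
    obtain ⟨g, hg⟩ := exists_modDesc
      (Projective.factorThru (modProj ϖ P ≫ (incl C ϖ).map f) ((incl C ϖ).map e))
    refine ⟨g, full_ext fun x => ?_⟩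
    obtain ⟨x, rfl⟩ := modProj_surjective P x
    have h1 := Projective.factorThru_comp (modProj ϖ P ≫ (incl C ϖ).map f) ((incl C ϖ).map e)
    rw [← hg] at h1
    exact (ev_congr h1 x :)

theorem modObj_hom_eq_zero {P : C.FullSubcategory} {X : (killedBy C ϖ).FullSubcategory}
    (h : ∀ f : P ⟶ (incl C ϖ).obj X, f = 0) (f : modObj ϖ P ⟶ X) : f = 0 := by
  refine full_ext fun x => ?_
  obtain ⟨x, rfl⟩ := modProj_surjective P x
  exact (ev_congr (h (modProj ϖ P ≫ (incl C ϖ).map f)) x :)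

variable {S Q : (killedBy C ϖ).FullSubcategory} {P : C.FullSubcategory}
  {κ : P ⟶ (incl C ϖ).obj S} {θ : P ⟶ (incl C ϖ).obj Q}

theorem hom_eq_zero_of_not_iso (hκ : IsProjectiveEnvelope κ) (hS : IsIrred S.obj)
    {X : (killedBy C ϖ).FullSubcategory} (hX : IsIrred X.obj) (hSX : IsEmpty (S ≅ X))
    (f : P ⟶ (incl C ϖ).obj X) : f = 0 := by
  by_contra hf
  obtain ⟨e, -⟩ := hκ.exists_iso hS hX hf
  exact hSX.elim ((ObjectProperty.fullyFaithfulιOfLE _).preimageIso e)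

/-- The kernel of a morphism as an object. -/
def kerObj {M N : C.FullSubcategory} (f : M ⟶ N) : C.FullSubcategory := subObj (ker f.hom)

/-- The inclusion of the kernel. -/
def kerInc {M N : C.FullSubcategory} (f : M ⟶ N) : kerObj f ⟶ M := subInc (ker f.hom)

theorem kerInc_injective {M N : C.FullSubcategory} (f : M ⟶ N) :
    Function.Injective (ev (kerInc f)) := subInc_injective _

theorem kerInc_comp {M N : C.FullSubcategory} (f : M ⟶ N) : kerInc f ≫ f = 0 :=
  full_ext fun x => x.2

theorem exists_kerInc_eq {M N : C.FullSubcategory} (f : M ⟶ N) {x : M.obj.carrier}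
    (hx : ev f x = 0) : ∃ y, ev (kerInc f) y = x := ⟨⟨x, hx⟩, rfl⟩

theorem ker_shortExact {M N : C.FullSubcategory} (f : M ⟶ N) (hf : Function.Surjective (ev f)) :
    (ShortComplex.mk (kerInc f) f (kerInc_comp f)).ShortExact :=
  shortExact_of _ _ (kerInc_injective f) hf _ fun _ => exists_kerInc_eq f

/-- The connecting map `Hom(ker θk, S) → Ext¹(Q, S)` is injective. Indeed a map `P / ϖ P → S` comes
from a multiple of `κ`, and it vanishes on `ker θk` because `ker θ ⊆ ker κ`. -/
theorem finite_hom_kernel (h : IsCosocle ϖ κ ((incl C ϖ).obj Q))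
    [Finite (O ⧸ Ideal.span {ϖ})] {φ₀ : Q ⟶ S} (hθ : θ ≫ (incl C ϖ).map φ₀ = κ)
    (H4 : Module.Finite O (Ext.{u + 1} Q S 1)) {θk : modObj ϖ P ⟶ Q}
    (hθk : modProj ϖ P ≫ (incl C ϖ).map θk = θ) : Finite (kerObj θk ⟶ S) := by
  have hsurj : Function.Surjective (ev θk) := fun y => by
    obtain ⟨x, rfl⟩ := h.theta_surjective hθ y
    exact ⟨(ev (modProj ϖ P) x :), (ev_congr hθk x :)⟩
  have hSES := ker_shortExact θk hsurj
  have : Finite (Ext.{u + 1} Q S 1) := finite_of_smul_eq_zero ϖ fun e => by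
    rw [Ext.smul_eq_comp_mk₀]
    have : (ϖ • 𝟙 S : S ⟶ S) = 0 := full_ext fun x => S.property.2 x
    rw [this, Ext.mk₀_zero, Ext.comp_zero]
  refine Finite.of_injective
    (fun f : kerObj θk ⟶ S => hSES.extClass.comp (Ext.mk₀ f) (add_zero 1)) fun f g hfg => ?_
  have h0 : hSES.extClass.comp (Ext.mk₀ (f - g)) (add_zero 1) = 0 := by
    rw [sub_eq_add_neg, Ext.mk₀_add, Ext.mk₀_neg, Ext.comp_add, Ext.comp_neg, ← sub_eq_add_neg,
      sub_eq_zero]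
    exact hfg
  obtain ⟨t, ht⟩ := Ext.contravariant_sequence_exact₁ hSES S (Ext.mk₀ (f - g)) (add_zero 1) h0
  obtain ⟨t, rfl⟩ := (Ext.mk₀_bijective _ _).2 t
  rw [Ext.mk₀_comp_mk₀] at ht
  have ht' := (Ext.mk₀_bijective _ _).1 ht
  rw [← sub_eq_zero, ← ht']
  obtain ⟨c, hc⟩ := h.envelope.exists_smul_eq h.irred h.endo (modProj ϖ P ≫ (incl C ϖ).map t)
  refine full_ext fun y => ?_
  obtain ⟨x, hx⟩ := modProj_surjective P (ev (kerInc θk) y :)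
  have h1 : ev θ x = 0 := by
    rw [← hθk]
    change ev θk (ev (modProj ϖ P) x :) = 0
    rw [hx]
    exact (ev_congr (kerInc_comp θk) y :)
  have h2 : ev κ x = 0 := by rw [← hθ, ev_comp, h1, ev_zero]
  change ev t (ev (kerInc θk) y) = 0
  rw [← hx]
  have h3 := (ev_congr hc x :)
  refine h3.trans ?_
  simp only [smul_ev, h2, smul_zero]

/-- By (H3) and the long exact sequence, `ker θk` has no irreducible quotient other than `S`, and
there are only finitely many maps to `S`. Lifting `κ` along each nonzero one gives maps that no
nonzero map to an irreducible object can kill simultaneously. -/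
theorem exists_generators_kernel (h : IsCosocle ϖ κ ((incl C ϖ).obj Q))
    [Finite (O ⧸ Ideal.span {ϖ})] {φ₀ : Q ⟶ S} (hθ : θ ≫ (incl C ϖ).map φ₀ = κ)
    (H3 : ∀ S' : (killedBy C ϖ).FullSubcategory, Simple S' → IsEmpty (S ≅ S') →
      ∀ e : Ext.{u + 1} Q S' 1, e = 0)
    (H4 : Module.Finite O (Ext.{u + 1} Q S 1)) {θk : modObj ϖ P ⟶ Q}
    (hθk : modProj ϖ P ≫ (incl C ϖ).map θk = θ) :
    ∃ (ι : Type u) (_ : Fintype ι) (g : ι → (P ⟶ (incl C ϖ).obj (kerObj θk))),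
      Function.Surjective (ev (sumMap g)) := by
  have hfin := finite_hom_kernel h hθ H4 hθk
  have hsurj : Function.Surjective (ev θk) := fun y => by
    obtain ⟨x, rfl⟩ := h.theta_surjective hθ y
    exact ⟨(ev (modProj ϖ P) x :), (ev_congr hθk x :)⟩
  have hSES := ker_shortExact θk hsurj
  have hlift : ∀ s : {s : kerObj θk ⟶ S // s ≠ 0}, ∃ g : P ⟶ (incl C ϖ).obj (kerObj θk),
      g ≫ (incl C ϖ).map s.1 = κ := fun s =>
    h.envelope.exists_lift _ (h.irred.surjective ((incl_map_eq_zero_iff _).not.2 s.2)) κ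
  choose g hg using hlift
  refine ⟨_, Fintype.ofFinite _, g, surjective_of_forall_simple _ fun X t hX ht => ?_⟩
  by_contra ht0
  have hX' := simple_iff.1 hX
  have hts := hX'.surjective ht0
  let X' : (killedBy C ϖ).FullSubcategory := toKilled X fun x => by
    obtain ⟨y, rfl⟩ := hts x
    rw [← ev_smul, (kerObj θk).property.2 y, ev_zero]
  let t' : kerObj θk ⟶ X' := inclPreimage t
  have hX'' : Simple X' := simple_iff.2 hX'
  by_cases hSX : IsEmpty (S ≅ X')
  · have hv : ExtVanish.{u + 1} (kerObj θk) X' 0 := by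
      refine ExtVanish.left hSES (extVanish_zero_iff.2 ?_) (H3 X' hX'' hSX)
      exact modObj_hom_eq_zero (hom_eq_zero_of_not_iso h.envelope h.irred hX' hSX)
    have h0 : t' = 0 := extVanish_zero_iff.1 hv t'
    exact ht0 (full_ext fun x => (ev_congr h0 x :))
  · obtain ⟨e⟩ := not_isEmpty_iff.1 hSX
    have hne : t' ≫ e.inv ≠ 0 := fun h0 => ht0 (by
      have h1 : t' = 0 := by
        rw [← Category.comp_id t', ← e.inv_hom_id, ← Category.assoc, h0, zero_comp]
      exact full_ext fun x => (ev_congr h1 x :))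
    have h1 : g ⟨_, hne⟩ ≫ t = 0 := by
      let _ := Fintype.ofFinite {s : kerObj θk ⟶ S // s ≠ 0}
      rw [← powInc_sumMap g, Category.assoc, ht, comp_zero]
    refine h.envelope.ne_zero h.irred ?_
    rw [← hg ⟨_, hne⟩, Functor.map_comp, ← Category.assoc]
    exact (congrArg (· ≫ (incl C ϖ).map e.inv) h1).trans zero_comp

/-- Put `K = ker θk`. Dimension shifting in `C(k)` turns (H5) into `Ext¹(K, R) = 0` in `C(k)`, so
the kernel of `(P/ϖP)^ι → K` has no nonzero map to `R`. The kernel of `P^ι → K` contains `ϖ P^ι`, on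
which maps to `R` vanish, and its quotient by `ϖ P^ι` is the former kernel. So it has no nonzero map
to `R` either, and `Ext¹(K, R) = 0` in `C(O)`. -/
theorem extVanish_kernel (h : IsCosocle ϖ κ ((incl C ϖ).obj Q)) {φ₀ : Q ⟶ S}
    (hθ : θ ≫ (incl C ϖ).map φ₀ = κ) {R : (killedBy C ϖ).FullSubcategory}
    (hR : ∀ f : P ⟶ (incl C ϖ).obj R, f = 0)
    (H5 : ExtVanish.{u + 1} Q R 2) {θk : modObj ϖ P ⟶ Q}
    (hθk : modProj ϖ P ≫ (incl C ϖ).map θk = θ) {ι : Type u} [Fintype ι]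
    (g : ι → (P ⟶ (incl C ϖ).obj (kerObj θk))) (hg : Function.Surjective (ev (sumMap g))) :
    ExtVanish.{u + 1} ((incl C ϖ).obj (kerObj θk)) ((incl C ϖ).obj R) 1 := by
  have := h.envelope.projective
  have := projective_modObj (ϖ := ϖ) P
  have hsurj : Function.Surjective (ev θk) := fun y => by
    obtain ⟨x, rfl⟩ := h.theta_surjective hθ y
    exact ⟨(ev (modProj ϖ P) x :), (ev_congr hθk x :)⟩
  have hK : ExtVanish.{u + 1} (kerObj θk) R 1 :=
    ExtVanish.left (ker_shortExact θk hsurj) (ExtVanish.of_projective _ _ 0) H5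
  choose gk hgk using fun i => exists_modDesc (g i)
  have hcomp : ∀ x : (pow ι P).obj.carrier, ∀ y : (pow ι (modObj ϖ P)).obj.carrier,
      (∀ i, ev (powProj _ i) y = ev (modProj ϖ P) (ev (powProj P i) x)) →
      ev (sumMap gk) y = ev (sumMap g) x := by
    intro x y hxy
    rw [ev_sumMap]
    refine Eq.trans ?_ (ev_sumMap g x).symm
    refine Finset.sum_congr rfl fun i _ => ?_
    rw [hxy i, ← hgk i]
    rfl
  have hgks : Function.Surjective (ev (sumMap gk)) := fun z => by
    obtain ⟨x, rfl⟩ := hg z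
    obtain ⟨y, hy⟩ := exists_pow_eq fun i => ev (modProj ϖ P) (ev (powProj P i) x)
    exact ⟨y, hcomp x y hy⟩
  have hK' : ∀ f : kerObj (sumMap gk) ⟶ R, f = 0 := extVanish_zero_iff.1
    (ExtVanish.left (ker_shortExact _ hgks)
      (ExtVanish.pow (extVanish_zero_iff.2 (modObj_hom_eq_zero hR))) hK)
  refine ExtVanish.right (ker_shortExact _ hg) (extVanish_zero_iff.2 fun f => ?_)
    (ExtVanish.pow (ExtVanish.of_projective _ _ 0))
  let q : pow ι P ⟶ (incl C ϖ).obj (pow ι (modObj ϖ P)) := powMap ι (modProj ϖ P)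
  have hq : ∀ x : (pow ι P).obj.carrier, ev (sumMap gk) (ev q x :) = ev (sumMap g) x := fun x => hcomp x (ev q x :) fun i => rfl
  obtain ⟨q', hq'⟩ := exists_lift ((incl C ϖ).map (kerInc (sumMap gk)))
    (kerInc_injective (sumMap gk)) (kerInc (sumMap g) ≫ q) fun x => by
      refine exists_kerInc_eq (sumMap gk) ?_
      refine (hq (ev (kerInc (sumMap g)) x)).trans ?_
      exact (ev_congr (kerInc_comp (sumMap g)) x :)
  have hq'v : ∀ x : (kerObj (sumMap g)).obj.carrier, ev (kerInc (sumMap gk)) (ev q' x :) = ev q (ev (kerInc (sumMap g)) x) :=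
    fun x => (ev_congr hq' x :)
  have hq's : Function.Surjective (ev q') := fun z => by
    let v : (pow ι (modObj ϖ P)).obj.carrier := ev (kerInc (sumMap gk)) z
    choose x hx using fun i => modProj_surjective (ϖ := ϖ) P (ev (powProj (modObj ϖ P) i) v :)
    obtain ⟨y, hy⟩ := exists_pow_eq x
    have hqy : ev q y = ev (kerInc (sumMap gk)) z := by
      refine pow_ext (X := modObj ϖ P) fun i => ?_
      rw [← hx i, ← hy i]
      rfl
    obtain ⟨w, hw⟩ := exists_kerInc_eq (sumMap g) (x := y) (by
      rw [← hq y, hqy]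
      exact (ev_congr (kerInc_comp (sumMap gk)) z :))
    refine ⟨w, kerInc_injective (sumMap gk) ?_⟩
    rw [hq'v, hw, hqy]
  -- Multiplication by `ϖ` on `P^ι` lands in the kernel of the map to `K`, and `f` vanishes on its
  -- image since `Hom(P, R) = 0`. This image contains `ker q'`, so `f` descends along `q'`.
  obtain ⟨k, hk⟩ := exists_lift (kerInc (sumMap g)) (kerInc_injective _) (ϖ • 𝟙 (pow ι P))
    fun x => exists_kerInc_eq (sumMap g) (by
      rw [smul_ev, ev_smul, ev_id]
      exact (kerObj θk).property.2 _)
  have hk0 : k ≫ f = 0 := pow_hom_eq_zero hR _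
  obtain ⟨f', hf'⟩ := exists_desc q' hq's f fun x hx => by
    have h1 : ev q (ev (kerInc (sumMap g)) x) = 0 := by
      rw [← hq'v, hx, ev_zero]
    have h2 : ∀ i, ∃ y, ϖ • y = ev (powProj P i) (ev (kerInc (sumMap g)) x) := fun i =>
      (modProj_eq_zero P _).1 (congrArg (ev (powProj (modObj ϖ P) i)) h1)
    choose y hy using h2
    obtain ⟨z, hz⟩ := exists_pow_eq y
    have h3 : ev k z = x := by
      refine kerInc_injective (sumMap g) ?_
      rw [← ev_comp, hk, smul_ev, ev_id]
      refine pow_ext fun i => ?_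
      rw [ev_smul, hz, hy]
    rw [← h3]
    exact (ev_congr hk0 z :)
  rw [← hf']
  have h4 := hK' (inclPreimage f')
  exact full_ext fun x => (ev_congr h4 (ev q' x :) :)

/-- By (H0), `0 → P[ϖ] → P → ϖP → 0` yields `Ext¹(ϖP, R) = 0`. With `extVanish_kernel`, the sequence
`0 → ϖP → ker θ → ker θk → 0` yields `Ext¹(ker θ, R) = 0`, and this shifts to `Ext²(Q, R) = 0`. The
same sequence reduces generation of `ker θ` to that of `ker θk`. -/
theorem exists_generators_and_extVanish (h : IsCosocle ϖ κ ((incl C ϖ).obj Q))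
    [Finite (O ⧸ Ideal.span {ϖ})] {φ₀ : Q ⟶ S} (hθ : θ ≫ (incl C ϖ).map φ₀ = κ)
    {R : (killedBy C ϖ).FullSubcategory} (hR : ∀ f : P ⟶ (incl C ϖ).obj R, f = 0)
    (H0 : ∀ f : kernel (ϖ • 𝟙 P) ⟶ (incl C ϖ).obj R, f = 0)
    (H3 : ∀ S' : (killedBy C ϖ).FullSubcategory, Simple S' → IsEmpty (S ≅ S') →
      ∀ e : Ext.{u + 1} Q S' 1, e = 0)
    (H4 : Module.Finite O (Ext.{u + 1} Q S 1))
    (H5 : ExtVanish.{u + 1} Q R 2) :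
    ExtVanish.{u + 1} ((incl C ϖ).obj Q) ((incl C ϖ).obj R) 2 ∧
    ∃ (ι : Type u) (_ : Fintype ι) (f : ι → (P ⟶ P)), (∀ i, f i ≫ θ = 0) ∧
      ∀ x, ev θ x = 0 → ∃ y : ι → P.obj.carrier, x = ∑ i, ev (f i) (y i) := by
  have := h.envelope.projective
  obtain ⟨θk, hθk⟩ := exists_modDesc θ
  obtain ⟨ι, _, g, hg⟩ := exists_generators_kernel h hθ H3 H4 hθk
  have hKk := extVanish_kernel h hθ hR H5 hθk g hg
  have hθkv : ∀ x : P.obj.carrier, ev θk (ev (modProj ϖ P) x :) = ev θ x := fun x =>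
    (ev_congr hθk x :)
  -- the projection from `ker θ` to its image in `P / ϖ P`
  obtain ⟨r, hr⟩ := exists_lift ((incl C ϖ).map (kerInc θk)) (kerInc_injective θk)
    (kerInc θ ≫ modProj ϖ P) fun x => by
      refine exists_kerInc_eq θk ?_
      rw [ev_comp, hθkv]
      exact (ev_congr (kerInc_comp θ) x :)
  have hrv : ∀ x : (kerObj θ).obj.carrier, ev (kerInc θk) (ev r x :) = ev (modProj ϖ P) (ev (kerInc θ) x) := fun x =>
    (ev_congr hr x :)
  have hrs : Function.Surjective (ev r) := fun z => by
    obtain ⟨x, hx⟩ := modProj_surjective P (ev (kerInc θk) z :)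
    obtain ⟨y, rfl⟩ := exists_kerInc_eq θ (x := x) (by
      rw [← hθkv, hx]
      exact (ev_congr (kerInc_comp θk) z :))
    exact ⟨y, kerInc_injective θk (by rw [hrv, hx])⟩
  have hr0 : ∀ x, ev r x = 0 → ∃ y, ϖ • y = ev (kerInc θ) x := fun x hx => by
    rw [← modProj_eq_zero, ← hrv, hx, ev_zero]
  constructor
  · -- the image of `ϖ` on `P`
    obtain ⟨β, hβ⟩ := exists_subLift (smulSub ϖ P) (ϖ • 𝟙 P) fun x => ⟨x, rfl⟩
    have hβv : ∀ x, ev (subInc (smulSub ϖ P)) (ev β x) = ϖ • x := fun x =>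
      (ev_congr hβ x :)
    have hβs : Function.Surjective (ev β) := by
      rintro ⟨_, x, rfl⟩
      exact ⟨x, subInc_injective _ (hβv x)⟩
    have hSES1 := shortExact_of (kernel.ι (ϖ • 𝟙 P)) β (ev_injective _) hβs (by
        have := mono_of_ev_injective _ (subInc_injective (smulSub ϖ P))
        rw [← cancel_mono (subInc (smulSub ϖ P)), Category.assoc, hβ, kernel.condition,
          zero_comp]) fun y hy => by
      obtain ⟨z, hz⟩ := exists_kerInc_eq (ϖ • 𝟙 P) (x := y) (by
        change ϖ • y = 0
        rw [← hβv, hy, ev_zero])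
      refine ⟨ev (kernel.lift _ (kerInc (ϖ • 𝟙 P)) (kerInc_comp _)) z, ?_⟩
      rw [← ev_comp, kernel.lift_ι, hz]
    have hB : ExtVanish.{u + 1} (subObj (smulSub ϖ P)) ((incl C ϖ).obj R) 1 :=
      ExtVanish.right hSES1 (extVanish_zero_iff.2 H0) (ExtVanish.of_projective _ _ 0)
    obtain ⟨j, hj⟩ := exists_lift (kerInc θ) (kerInc_injective θ) (subInc (smulSub ϖ P))
      fun x => exists_kerInc_eq θ (by
        obtain ⟨x, rfl⟩ := hβs x
        rw [hβv, ev_smul]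
        exact Q.property.2 _)
    have hjv : ∀ x, ev (kerInc θ) (ev j x) = ev (subInc (smulSub ϖ P)) x := fun x =>
      (ev_congr hj x :)
    have hSES2 := shortExact_of j r (fun x y hxy => subInc_injective _ (by
        rw [← hjv, ← hjv, hxy])) hrs (full_ext fun x => kerInc_injective θk (by
          rw [ev_comp, hrv, hjv, zero_ev]
          refine Eq.trans ?_ (ev_zero (kerInc θk)).symm
          exact (modProj_eq_zero P _).2 (subInc_mem (smulSub ϖ P) x))) fun y hy => by
      obtain ⟨z, hz⟩ := hr0 y hy
      exact ⟨ev β z, kerInc_injective θ (by rw [hjv, hβv, hz])⟩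
    exact ExtVanish.right (ker_shortExact θ (h.theta_surjective hθ))
      (ExtVanish.mid hSES2 hB hKk) (ExtVanish.of_projective _ _ 1)
  · choose g' hg' using fun i => h.envelope.exists_lift r hrs (g i)
    -- The extra index `none` carries multiplication by `ϖ`, which accounts for the part `ϖP` of
    -- `ker θ`.
    refine ⟨Option ι, inferInstance,
      fun i => i.elim (ϖ • 𝟙 P) fun i => g' i ≫ kerInc θ, fun i => ?_, fun x hx => ?_⟩
    · cases i with
      | none =>
        refine full_ext fun x => ?_
        change ev θ (ϖ • x) = 0
        rw [ev_smul]
        exact Q.property.2 _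
      | some i =>
        change (g' i ≫ kerInc θ) ≫ θ = 0
        rw [Category.assoc, kerInc_comp, comp_zero]
    · obtain ⟨y, rfl⟩ := exists_kerInc_eq θ hx
      obtain ⟨z, hz⟩ := hg (ev r y)
      obtain ⟨w, hw⟩ := hr0 (y - ∑ i, ev (g' i) (ev (powProj P i) z)) (by
        rw [ev_sub, ev_sum, ← hz, ev_sumMap, sub_eq_zero]
        exact Finset.sum_congr rfl fun i _ => by rw [← hg' i]; rfl)
      refine ⟨fun i => i.elim w fun i => ev (powProj P i) z, ?_⟩
      rw [Fintype.sum_option]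
      change _ = ϖ • w + ∑ i, ev (kerInc θ) (ev (g' i) (ev (powProj P i) z))
      rw [hw, ev_sub, ev_sum, sub_add_cancel]

end KilledBy

/-! ### The endomorphism ring of `P` and the filtration `Pₙ`. -/

section EndomorphismRing

variable {O G : Type u} [CommRing O] [Group G] [TopologicalSpace G]
  {C : ObjectProperty (ProAug O G)} [IsDualCat C]
  {S P Q : C.FullSubcategory} {κ : P ⟶ S} {ϖ : O} {ι : Type u} [Fintype ι]

/-- By hypothesis `r` lands in the image of `X^ι → Y`, so it lifts to `X^ι` by projectivity. This
turns pointwise generation into identities between morphisms. -/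
theorem exists_comb [Projective P] {X Y : C.FullSubcategory} (F : ι → (X ⟶ Y)) (r : P ⟶ Y)
    (h : ∀ x, ∃ y : ι → X.obj.carrier, ev r x = ∑ i, ev (F i) (y i)) :
    ∃ g : ι → (P ⟶ X), r = ∑ i, g i ≫ F i := by
  have h' : ∀ x, ∃ y, ev (sumMap F) y = ev r x := fun x => by
    obtain ⟨y, hy⟩ := h x
    obtain ⟨z, hz⟩ := exists_pow_eq y
    exact ⟨z, by rw [ev_sumMap, hy]; simp only [hz]⟩
  obtain ⟨s, hs⟩ := exists_subLift (range (sumMap F).hom) (sumMap F) fun x => ⟨x, rfl⟩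
  obtain ⟨t, ht⟩ := exists_subLift (range (sumMap F).hom) r h'
  have : Epi s := epi_of_ev_surjective s (by
    rintro ⟨_, x, rfl⟩
    exact ⟨x, subInc_injective _ (ev_congr hs x)⟩)
  refine ⟨fun i => Projective.factorThru t s ≫ powProj X i, ?_⟩
  rw [← comp_sumMap, ← ht]
  nth_rw 1 [← Projective.factorThru_comp t s]
  rw [Category.assoc, hs]

/-- The filtration of `P` by the subobjects `P_n = ∑ f_i P_{n-1}`. -/
def filt (f : ι → End P) : ℕ → Sub P.obj
  | 0 => ⊤
  | n + 1 => range (sumMap fun i => subInc (filt f n) ≫ f i).hom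

theorem mem_filt_succ (f : ι → End P) (n : ℕ) (x : P.obj.carrier) :
    x ∈ (filt f (n + 1)).toSubmodule ↔
      ∃ y : ι → P.obj.carrier, (∀ i, y i ∈ (filt f n).toSubmodule) ∧ x = ∑ i, ev (f i) (y i) := by
  constructor
  · rintro ⟨z, rfl⟩
    exact ⟨fun i => ev (subInc (filt f n)) (ev (powProj _ i) z), fun i => subInc_mem _ _,
      ev_sumMap _ _⟩
  · rintro ⟨y, hy, rfl⟩
    choose z hz using fun i => exists_subInc_eq (filt f n) (hy i)
    obtain ⟨w, hw⟩ := exists_pow_eq z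
    refine ⟨w, (ev_sumMap _ _).trans ?_⟩
    simp only [hw, ev_comp, hz]

theorem filt_succ_le (f : ι → End P) (n : ℕ) {x : P.obj.carrier}
    (hx : x ∈ (filt f (n + 1)).toSubmodule) : x ∈ (filt f n).toSubmodule := by
  induction n generalizing x with
  | zero => trivial
  | succ n ih =>
    rw [mem_filt_succ] at hx ⊢
    obtain ⟨y, hy, rfl⟩ := hx
    exact ⟨y, fun i => ih (hy i), rfl⟩

/-- The formal properties of `θ : P → Q` on which the construction of the universal deformation
rests; the kernel of `θ` is generated by the images of the `f i`. -/
structure IsHead (ϖ : O) (θ : P ⟶ Q) (f : ι → End P) : Prop where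
  projective : Projective P
  maximal : (Ideal.span {ϖ}).IsMaximal
  finite : Finite (O ⧸ Ideal.span {ϖ})
  exists_ne : ∃ x : Q.obj.carrier, x ≠ 0
  surjective : Function.Surjective (ev θ)
  hom_eq : ∀ g : P ⟶ Q, ∃ c : O, g = c • θ
  smul_θ : ∀ c : O, c • θ = 0 ↔ c ∈ Ideal.span {ϖ}
  isUnit : ∀ r : End P, r ≫ θ ≠ 0 → IsUnit r
  comp_θ : ∀ i, f i ≫ θ = 0
  gen : ∀ x, ev θ x = 0 → ∃ y : ι → P.obj.carrier, x = ∑ i, ev (f i) (y i)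
  separated : ∀ x, (∀ n, x ∈ (filt f n).toSubmodule) → x = 0

/-- If `r ≫ θ ≠ 0`, then `r ≫ κ ≠ 0`, so `r` is epi because `κ` is essential. Projectivity gives a
section, which is epi for the same reason, so `r` is invertible. Separatedness holds because `Pₙ`
dies in every quotient with a composition series of `n` steps. -/
theorem IsCosocle.isHead (h : IsCosocle ϖ κ Q) [Finite (O ⧸ Ideal.span {ϖ})] {φ₀ : Q ⟶ S}
    {θ : P ⟶ Q} (hθ : θ ≫ φ₀ = κ) (f : ι → End P) (hf : ∀ i, f i ≫ θ = 0)
    (hgen : ∀ x, ev θ x = 0 → ∃ y : ι → P.obj.carrier, x = ∑ i, ev (f i) (y i)) :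
    IsHead ϖ θ f where
  projective := h.envelope.projective
  maximal := h.maximal
  finite := inferInstance
  exists_ne := h.exists_ne
  surjective := h.theta_surjective hθ
  hom_eq := h.hom_eq hθ
  smul_θ := h.smul_θ hθ
  isUnit r hr := by
    have := h.envelope.projective
    rw [Ne, ← h.comp_kappa_iff hθ] at hr
    have he : ∀ s : P ⟶ P, s ≫ κ ≠ 0 → Epi s := fun s hs =>
      h.envelope.essential s (epi_of_ev_surjective _ (h.irred.surjective hs))
    have h1 : Epi r := he r hr
    obtain ⟨s, hs⟩ : ∃ s : P ⟶ P, s ≫ r = 𝟙 P :=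
      ⟨Projective.factorThru (𝟙 P) r, Projective.factorThru_comp _ _⟩
    obtain ⟨c, hc⟩ := h.envelope.exists_smul_eq h.irred h.endo (r ≫ κ)
    have h2 : Epi s := he s fun h0 => h.envelope.ne_zero h.irred (by
      rw [← Category.id_comp κ, ← hs, Category.assoc, hc, Linear.comp_smul, h0, smul_zero])
    have h3 : r ≫ s = 𝟙 P := by
      rw [← cancel_epi s, ← Category.assoc, hs, Category.id_comp, Category.comp_id]
    exact ⟨⟨r, s, hs, h3⟩, rfl⟩
  comp_θ := hf
  gen := hgen
  separated x hx := by
    by_contra hx0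
    obtain ⟨N, g, hg, ⟨n, c, hc0, hc1, hc⟩, hgx⟩ := IsDualCat.separated P.obj P.property x hx0
    have := epi_of_surjective g hg
    let N' : C.FullSubcategory := ⟨N, C.prop_of_epi g P.property⟩
    -- As `f i` lands in `ker κ`, composing with it pushes the image of `g` one step down the
    -- series. Hence `j` compositions kill a map with image in `c j`.
    have key : ∀ (j : Fin (n + 1)) (g : P ⟶ N'), (∀ y, ev g y ∈ (c j).toSubmodule) →
        ∀ y ∈ (filt f j).toSubmodule, ev g y = 0 := by
      intro j
      induction j using Fin.induction with
      | zero =>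
        intro g hg y _
        rw [hc0] at hg
        exact hg y
      | succ j ih =>
        intro g hg y hy
        rw [Fin.val_succ, mem_filt_succ] at hy
        obtain ⟨z, hz, rfl⟩ := hy
        rw [ev_sum]
        refine Finset.sum_eq_zero fun i _ => ?_
        refine ih (f i ≫ g) (fun w => ?_) (z i) (hz i)
        refine h.envelope.mem_of_covBy (hc j) g hg ?_
        exact ev_congr ((h.comp_kappa_iff hθ (f i)).2 (hf i)) w
    refine hgx (key (Fin.last n) (ObjectProperty.homMk g : P ⟶ N') (fun y => ?_) x (hx _))
    rw [hc1]
    trivial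

namespace IsHead

variable {θ : P ⟶ Q} {f : ι → End P} (h : IsHead ϖ θ f)
include h

theorem smul_Q (x : Q.obj.carrier) : ϖ • x = 0 := by
  obtain ⟨x, rfl⟩ := h.surjective x
  exact ev_congr ((h.smul_θ ϖ).2 (Ideal.mem_span_singleton_self ϖ)) x

theorem θ_ne_zero : θ ≠ 0 := by
  rintro rfl
  obtain ⟨x, hx⟩ := h.exists_ne
  obtain ⟨y, rfl⟩ := h.surjective x
  exact hx rfl

theorem isLocalRing : IsLocalRing (End P) := by
  have : Nontrivial (End P) := by
    refine ⟨⟨1, 0, fun h0 => h.θ_ne_zero ?_⟩⟩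
    rw [← Category.id_comp θ]
    exact (congrArg (· ≫ θ) h0).trans zero_comp
  refine ⟨fun {a b} hab => ?_⟩
  by_cases ha : a ≫ θ = 0
  · refine Or.inr (h.isUnit b fun hb => h.θ_ne_zero ?_)
    have : (a + b : P ⟶ P) ≫ θ = 0 := by rw [Preadditive.add_comp, ha, hb, add_zero]
    rw [← Category.id_comp θ]
    exact (congrArg (· ≫ θ) hab).symm.trans this
  · exact Or.inl (h.isUnit a ha)

theorem mem_jacobson_iff (r : End P) : r ∈ Ring.jacobson (End P) ↔ r ≫ θ = 0 := by
  have := h.isLocalRing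
  rw [ProAug.mem_jacobson_iff]
  constructor
  · intro hr
    by_contra h0
    exact hr (h.isUnit r h0)
  · rintro h0 ⟨⟨r, s, hrs, hsr⟩, rfl⟩
    refine h.θ_ne_zero ?_
    rw [← Category.id_comp θ]
    have h1 : s ≫ r = 𝟙 P := hrs
    rw [← h1, Category.assoc]
    exact (congrArg (s ≫ ·) h0).trans comp_zero

theorem f_mem (i : ι) : f i ∈ Ring.jacobson (End P) :=
  (h.mem_jacobson_iff _).2 (h.comp_θ i)

theorem isLocalOver : IsLocalOver ϖ (End P) where
  isLocalRing := h.isLocalRing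
  exists_scalar r := by
    obtain ⟨c, hc⟩ := h.hom_eq (r ≫ θ)
    refine ⟨c, (h.mem_jacobson_iff _).2 (full_ext fun x => ?_)⟩
    have h1 := ev_congr hc x
    rw [ev_comp, smul_ev] at h1
    rw [ev_comp, sub_ev, algebraMap_ev, ev_sub, h1, ev_smul, sub_self, zero_ev]
  scalar_mem_iff c := by
    rw [h.mem_jacobson_iff, ← h.smul_θ, Algebra.algebraMap_eq_smul_one]
    change (c • 𝟙 P) ≫ θ = 0 ↔ _
    rw [Linear.smul_comp, Category.id_comp]

/-- By projectivity, generation of `ker θ` by the images of the `f i` becomes generation of `𝔪` by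
the `f i` as a right ideal. -/
theorem exists_eq_sum {r : End P} (hr : r ∈ Ring.jacobson (End P)) :
    ∃ g : ι → End P, r = ∑ i, f i * g i := by
  have := h.projective
  rw [h.mem_jacobson_iff] at hr
  exact exists_comb f r fun x => h.gen _ (ev_congr hr x)

/-- As `r * f i` lies in `𝔪`, it can be rewritten as `∑ f j * g j`, and the induction hypothesis
applies to the `g j`. -/
theorem filt_stable (n : ℕ) (r : End P) {x : P.obj.carrier} (hx : x ∈ (filt f n).toSubmodule) :
    ev r x ∈ (filt f n).toSubmodule := by
  induction n generalizing x r with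
  | zero => trivial
  | succ n ih =>
    rw [mem_filt_succ] at hx
    obtain ⟨y, hy, rfl⟩ := hx
    rw [ev_sum]
    refine sum_mem fun i _ => ?_
    obtain ⟨g, hg⟩ := h.exists_eq_sum (Ideal.mul_mem_left _ r (h.f_mem i))
    have h1 : ev r (ev (f i) (y i)) = ∑ j, ev (f j) (ev (g j) (y i)) := by
      rw [← mul_ev, hg, sum_ev]
      rfl
    rw [h1, mem_filt_succ]
    exact ⟨_, fun j => ih (g j) (hy i), rfl⟩

/-- The passage from the filtration back to ideals is where projectivity enters: a map `P → Pₙ₊₁ = ∑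
f i Pₙ` is `∑ f i * g i` with each `g i` landing in `Pₙ`. -/
theorem mem_jacobson_pow_iff (n : ℕ) (r : End P) :
    r ∈ Ring.jacobson (End P) ^ n ↔ ∀ x, ev r x ∈ (filt f n).toSubmodule := by
  have := h.projective
  induction n generalizing r with
  | zero =>
    rw [Submodule.pow_zero, Ideal.one_eq_top]
    exact ⟨fun _ _ => trivial, fun _ => trivial⟩
  | succ n ih =>
    rw [Ideal.IsTwoSided.pow_succ]
    constructor
    · intro hr
      refine Submodule.smul_induction_on hr ?_ ?_
      · intro a ha b hb x
        obtain ⟨g, rfl⟩ := h.exists_eq_sum ha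
        rw [smul_eq_mul, mul_ev, sum_ev, mem_filt_succ]
        exact ⟨_, fun i => h.filt_stable n (g i) ((ih b).1 hb x), rfl⟩
      · intro a b ha hb x
        exact add_mem (ha x) (hb x)
    · intro hr
      obtain ⟨g, hg⟩ := exists_comb (fun i => subInc (filt f n) ≫ f i) r fun x => by
        obtain ⟨z, hz⟩ := hr x
        exact ⟨fun i => ev (powProj _ i) z, hz.symm.trans (ev_sumMap _ _)⟩
      have : r = ∑ i, f i * (show End P from g i ≫ subInc (filt f n)) := by
        rw [hg]
        exact Finset.sum_congr rfl fun i _ => (Category.assoc _ _ _).symm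
      rw [this]
      exact sum_mem fun i _ => Ideal.mul_mem_mul (h.f_mem i)
        ((ih _).2 fun x => subInc_mem (filt f n) (ev (g i) x))

theorem mem_filt_of_mem_jacobson_pow {n : ℕ} {r : End P} (hr : r ∈ Ring.jacobson (End P) ^ n)
    {x : P.obj.carrier} (hx : ev θ x = 0) : ev r x ∈ (filt f (n + 1)).toSubmodule := by
  obtain ⟨y, rfl⟩ := h.gen x hx
  rw [ev_sum]
  refine sum_mem fun i _ => ?_
  have : r * f i ∈ Ring.jacobson (End P) ^ (n + 1) := by
    rw [Submodule.pow_succ]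
    exact Ideal.mul_mem_mul hr (h.f_mem i)
  exact (h.mem_jacobson_pow_iff _ _).1 this (y i)

/-- The value at `x` is the unique point of a decreasing sequence of closed cosets of the `Pₙ`; it
exists by compactness and is unique by separatedness. -/
theorem exists_limit (r : ℕ → End P)
    (hr : ∀ n, r (n + 1) - r n ∈ Ring.jacobson (End P) ^ n) :
    ∃ s : End P, ∀ n, s - r n ∈ Ring.jacobson (End P) ^ n := by
  have hr' : ∀ n x, ev (r (n + 1)) x - ev (r n) x ∈ (filt f n).toSubmodule := fun n x => by
    rw [← sub_ev]
    exact (h.mem_jacobson_pow_iff _ _).1 (hr n) x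
  have hex : ∀ x, ∃ y, ∀ n, y - ev (r n) x ∈ (filt f n).toSubmodule := by
    intro x
    have hcl : ∀ n, IsClosed {y | y - ev (r n) x ∈ (filt f n).toSubmodule} := fun n =>
      (filt f n).isClosed.preimage (continuous_id.sub continuous_const)
    have hne := IsCompact.nonempty_iInter_of_sequence_nonempty_isCompact_isClosed
      (fun n => {y | y - ev (r n) x ∈ (filt f n).toSubmodule}) (fun n y hy => by
        have := add_mem (filt_succ_le f n hy) (hr' n x)
        rwa [sub_add_sub_cancel] at this)
      (fun n => ⟨ev (r n) x, by
        change ev (r n) x - ev (r n) x ∈ (filt f n).toSubmodule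
        rw [sub_self]; exact zero_mem _⟩)
      (hcl 0).isCompact hcl
    obtain ⟨y, hy⟩ := hne
    exact ⟨y, fun n => Set.mem_iInter.1 hy n⟩
  have huniq : ∀ x y z, (∀ n, y - ev (r n) x ∈ (filt f n).toSubmodule) →
      (∀ n, z - ev (r n) x ∈ (filt f n).toSubmodule) → y = z := fun x y z hy hz => by
    refine sub_eq_zero.1 (h.separated _ fun n => ?_)
    have := sub_mem (hy n) (hz n)
    rwa [sub_sub_sub_cancel_right] at this
  choose s hs using hex
  have hcont : Continuous s := by
    refine continuous_iff_isClosed.2 fun Z hZ => ?_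
    have hgraph : IsClosed {q : P.obj.carrier × P.obj.carrier |
        ∀ n, q.2 - ev (r n) q.1 ∈ (filt f n).toSubmodule} := by
      rw [Set.ofPred_forall]
      exact isClosed_iInter fun n => (filt f n).isClosed.preimage
        (continuous_snd.sub ((app_continuous (r n).hom).comp continuous_fst))
    -- Closed graph theorem: preimages of closed sets under `s` are projections of compact subsets
    -- of the graph.
    have : s ⁻¹' Z = Prod.fst '' ({q : P.obj.carrier × P.obj.carrier |
        ∀ n, q.2 - ev (r n) q.1 ∈ (filt f n).toSubmodule} ∩ Prod.snd ⁻¹' Z) := by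
      ext x
      constructor
      · exact fun hx => ⟨(x, s x), ⟨hs x, hx⟩, rfl⟩
      · rintro ⟨⟨x, y⟩, ⟨hy, hyZ⟩, rfl⟩
        change s x ∈ Z
        rwa [huniq x _ y (hs x) hy]
    rw [this]
    exact ((hgraph.inter (hZ.preimage continuous_snd)).isCompact.image continuous_fst).isClosed
  let s' : P ⟶ P := ObjectProperty.homMk (mkHom
    { toFun := s
      map_add' := fun x y => huniq (x + y) _ _ (hs _) fun n => by
        rw [ev_add, add_sub_add_comm]
        exact add_mem (hs x n) (hs y n)
      map_smul' := fun c x => huniq (c • x) _ _ (hs _) fun n => by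
        rw [ev_smul, RingHom.id_apply, ← smul_sub]
        exact Submodule.smul_mem _ c (hs x n)
      cont := hcont } fun g x => huniq (g • x) _ _ (hs _) fun n => by
        have : ev (r n) (g • x) = g • ev (r n) x := app_action _ _ _
        rw [this, ← smul_sub]
        exact (filt f n).smul_mem g _ (hs x n))
  refine ⟨s', fun n => (h.mem_jacobson_pow_iff _ _).2 fun x => ?_⟩
  rw [sub_ev]
  exact hs x n

theorem isProArtAlgebra : IsProArtAlgebra ϖ (End P) := by
  have hfin : Finite (End P ⧸ Ring.jacobson (End P)) := by
    have := h.finite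
    refine Finite.of_surjective (α := O ⧸ Ideal.span {ϖ}) (Ideal.Quotient.lift _
      ((Ideal.Quotient.mk (Ring.jacobson (End P))).comp (algebraMap O (End P))) fun c hc => ?_)
      fun r => ?_
    · exact Ideal.Quotient.eq_zero_iff_mem.2 ((h.isLocalOver.scalar_mem_iff c).2 hc)
    · obtain ⟨r, rfl⟩ := Ideal.Quotient.mk_surjective r
      obtain ⟨c, hc⟩ := h.isLocalOver.exists_scalar r
      exact ⟨Ideal.Quotient.mk _ c, (Ideal.Quotient.eq.2 hc).symm⟩
  refine h.isLocalOver.isProArtAlgebra (fun n => finite_quotient_jacobson_pow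
    (fun i => f i) h.f_mem (fun r hr => h.exists_eq_sum hr) n) (fun r hr => ?_)
    h.exists_limit
  exact full_ext fun x => h.separated _ fun n => (h.mem_jacobson_pow_iff n r).1 (hr n) x

end IsHead
end EndomorphismRing

/-! ### The graded pieces of the filtration. -/

section Graded

variable {O G : Type u} [CommRing O] [Group G] [TopologicalSpace G]
  {C : ObjectProperty (ProAug O G)} [IsDualCat C]
  {P Q : C.FullSubcategory} {ϖ : O} {ι : Type u} [Fintype ι]
  {θ : P ⟶ Q} {f : ι → End P}

/-- The `e l ∈ 𝔪 ^ n` generate `P_n` modulo `P_{n+1}`. -/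
structure GeneratesGraded (f : ι → End P) (n : ℕ) {J : Type u} [Fintype J] (e : J → End P) :
    Prop where
  mem : ∀ l, e l ∈ Ring.jacobson (End P) ^ n
  gen : ∀ x ∈ (filt f n).toSubmodule, ∃ y : J → P.obj.carrier,
    x - ∑ l, ev (e l) (y l) ∈ (filt f (n + 1)).toSubmodule

namespace IsHead

variable (h : IsHead ϖ θ f)
include h

/-- The `n`-fold products of the `f i` serve; they generate `Pₙ` itself, not only modulo `Pₙ₊₁`. -/
theorem exists_generators (n : ℕ) :
    ∃ (J : Type u) (_ : Fintype J) (e : J → End P),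
      (∀ l, e l ∈ Ring.jacobson (End P) ^ n) ∧
      ∀ x ∈ (filt f n).toSubmodule, ∃ y : J → P.obj.carrier, x = ∑ l, ev (e l) (y l) := by
  induction n with
  | zero =>
    refine ⟨PUnit, inferInstance, fun _ => 1, fun _ => ?_, fun x _ => ⟨fun _ => x, ?_⟩⟩
    · rw [Submodule.pow_zero, Ideal.one_eq_top]; trivial
    · simp
  | succ n ih =>
    obtain ⟨J, _, e, he, hg⟩ := ih
    refine ⟨ι × J, inferInstance, fun p => f p.1 * e p.2, fun p => ?_, fun x hx => ?_⟩
    · rw [Ideal.IsTwoSided.pow_succ]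
      exact Ideal.mul_mem_mul (h.f_mem p.1) (he p.2)
    · rw [mem_filt_succ] at hx
      obtain ⟨z, hz, rfl⟩ := hx
      choose y hy using fun i => hg (z i) (hz i)
      refine ⟨fun p => y p.1 p.2, ?_⟩
      rw [Fintype.sum_prod_type]
      refine Finset.sum_congr rfl fun i _ => ?_
      simp only [mul_ev]
      rw [← ev_sum, ← hy]

theorem exists_generatesGraded (n : ℕ) :
    ∃ (J : Type u) (_ : Fintype J) (e : J → End P), GeneratesGraded f n e := by
  obtain ⟨J, _, e, he, hg⟩ := h.exists_generators n
  refine ⟨J, _, e, he, fun x hx => ?_⟩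
  obtain ⟨y, hy⟩ := hg x hx
  refine ⟨y, ?_⟩
  rw [← hy, sub_self]
  exact zero_mem _

/-- Scalars in `(ϖ)` map `P` into `ker θ`, and `𝔪ⁿ` maps `ker θ` into `Pₙ₊₁`. -/
theorem smul_mem_filt {n : ℕ} {r : End P} (hr : r ∈ Ring.jacobson (End P) ^ n) {c : O}
    (hc : c ∈ Ideal.span {ϖ}) (x : P.obj.carrier) :
    c • ev r x ∈ (filt f (n + 1)).toSubmodule := by
  rw [← ev_smul]
  refine h.mem_filt_of_mem_jacobson_pow hr ?_
  rw [ev_smul]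
  exact ev_congr ((h.smul_θ c).2 hc) x

/-- In a generating family of least cardinality, a relation with a coefficient that is invertible
modulo `ϖ` would make one generator superfluous. -/
theorem exists_minimal_generators (n : ℕ) :
    ∃ (J : Type u) (_ : Fintype J) (e : J → End P), GeneratesGraded f n e ∧
      ∀ c : J → O, ∑ l, c l • e l ∈ Ring.jacobson (End P) ^ (n + 1) →
        ∀ l, c l ∈ Ideal.span {ϖ} := by
  classical
  have hex : ∃ d, ∃ (J : Type u) (_ : Fintype J) (e : J → End P),
      Fintype.card J = d ∧ GeneratesGraded f n e := by
    obtain ⟨J, _, e, he⟩ := h.exists_generatesGraded n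
    exact ⟨_, J, _, e, rfl, he⟩
  obtain ⟨J, _, e, hd, he⟩ := Nat.find_spec hex
  refine ⟨J, _, e, he, fun c hc l₀ => ?_⟩
  by_contra hl
  obtain ⟨a, z, hz, haz⟩ := h.maximal.exists_inv hl
  refine Nat.find_min hex (m := Fintype.card {l // l ≠ l₀}) ?_
    ⟨{l // l ≠ l₀}, inferInstance, fun l => e l, rfl, fun l => he.mem l, fun x hx => ?_⟩
  · rw [← hd]
    exact Fintype.card_subtype_lt (x := l₀) (by simp)
  · obtain ⟨y, hy⟩ := he.gen x hx
    -- Here `a` inverts `c l₀` modulo `ϖ`. Subtracting `a` times the relation at `y l₀` leaves only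
    -- `z • e l₀ (y l₀)` at `l₀`, with `z ∈ (ϖ)`, and this lies in `Pₙ₊₁`.
    refine ⟨fun l => y l - (a * c l) • y l₀, ?_⟩
    have h1 : ∑ l, ev (e l) (y l - (a * c l) • y l₀) =
        ∑ l, ev (e l) (y l) - a • ev (∑ l, c l • e l) (y l₀) := by
      rw [sum_ev, Finset.smul_sum, ← Finset.sum_sub_distrib]
      refine Finset.sum_congr rfl fun l _ => ?_
      rw [ev_sub, ev_smul, mul_smul]
      rfl
    have h2 : ∑ l, ev (e l) (y l - (a * c l) • y l₀) =
        ev (e l₀) (y l₀ - (a * c l₀) • y l₀) +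
          ∑ l : {l // l ≠ l₀}, ev (e l) (y l - (a * c l) • y l₀) :=
      Fintype.sum_eq_add_sum_subtype_ne _ l₀
    have h3 : ev (e l₀) (y l₀ - (a * c l₀) • y l₀) = z • ev (e l₀) (y l₀) := by
      rw [← ev_smul]
      congr 1
      rw [sub_eq_iff_eq_add, ← add_smul, add_comm z, haz, one_smul]
    have h4 : x - ∑ l : {l // l ≠ l₀}, ev (e l) (y l - (a * c l) • y l₀) =
        (x - ∑ l, ev (e l) (y l)) + a • ev (∑ l, c l • e l) (y l₀) + z • ev (e l₀) (y l₀) := by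
      rw [← sub_eq_iff_eq_add'] at h2
      rw [← h2, h3, h1]
      abel
    rw [h4]
    exact add_mem (add_mem hy (Submodule.smul_mem _ _ ((h.mem_jacobson_pow_iff _ _).1 hc _)))
      (h.smul_mem_filt (he.mem l₀) hz _)

theorem hom_pow_eq {J : Type u} [Fintype J] (g : P ⟶ pow J Q) :
    ∃ c : J → O, ∀ l, g ≫ powProj Q l = c l • θ := by
  choose c hc using fun l => h.hom_eq (g ≫ powProj Q l)
  exact ⟨c, hc⟩

/-- The graded pieces of the filtration of `P` are direct sums of copies of `Q`. -/
theorem exists_graded_basis {R : C.FullSubcategory} (hR : ∀ g : P ⟶ R, g = 0)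
    (hQ : ExtVanish.{u + 1} Q R 2)
    (hYQ : ∀ Y : C.FullSubcategory, (∀ g : P ⟶ Y, g = 0) → (∀ g : Y ⟶ R, g = 0) →
      ∀ g : Y ⟶ Q, g = 0) (n : ℕ) :
    ExtVanish.{u + 1} (subObj (filt f n)) R 1 ∧
    ∃ (J : Type u) (_ : Fintype J) (e : J → End P), GeneratesGraded f n e ∧
      ∀ y : J → P.obj.carrier, ∑ l, ev (e l) (y l) ∈ (filt f (n + 1)).toSubmodule →
        ∀ l, ev θ (y l) = 0 := by
  have := h.projective
  have hQR : ∀ g : Q ⟶ R, g = 0 := fun g => by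
    have := epi_of_ev_surjective θ h.surjective
    exact (cancel_epi θ).1 ((hR _).trans comp_zero.symm)
  -- The induction carries `Ext¹(Pₙ, R) = 0`. It starts with `P₀ = P`, which is projective, and each
  -- step also produces the basis of the graded piece.
  suffices key : ∀ n, ExtVanish.{u + 1} (subObj (filt f n)) R 1 →
      ExtVanish.{u + 1} (subObj (filt f (n + 1))) R 1 ∧
      ∃ (J : Type u) (_ : Fintype J) (e : J → End P), GeneratesGraded f n e ∧
        ∀ y : J → P.obj.carrier, ∑ l, ev (e l) (y l) ∈ (filt f (n + 1)).toSubmodule →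
          ∀ l, ev θ (y l) = 0 by
    have h1 : ∀ n, ExtVanish.{u + 1} (subObj (filt f n)) R 1 := by
      intro n
      induction n with
      | zero =>
        obtain ⟨i, hi⟩ := exists_subLift (filt f 0) (𝟙 P) fun _ => trivial
        have := mono_of_ev_injective _ (subInc_injective (filt f 0))
        refine ExtVanish.of_retract (subInc (filt f 0)) i ?_ (ExtVanish.of_projective P R 0)
        rw [← cancel_mono (subInc (filt f 0)), Category.assoc, hi, Category.comp_id,
          Category.id_comp]
      | succ n ih => exact (key n ih).1
    exact ⟨h1 n, (key n (h1 n)).2⟩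
  intro n hn
  obtain ⟨J, _, e, he, hmin⟩ := h.exists_minimal_generators n
  -- `X = P_n / P_{n+1}`
  obtain ⟨j, hj⟩ := exists_subLift (filt f n) (subInc (filt f (n + 1))) fun x =>
    filt_succ_le f n (subInc_mem _ x)
  have hjv : ∀ x, ev (subInc (filt f n)) (ev j x) = ev (subInc (filt f (n + 1))) x :=
    ev_congr hj
  let N : Sub (subObj (filt f n)).obj := comapSub (subInc (filt f n)).hom (filt f (n + 1))
  let π : subObj (filt f n) ⟶ quotObj N := quotProj N
  have hπ0 : ∀ x, ev π x = 0 ↔ ev (subInc (filt f n)) x ∈ (filt f (n + 1)).toSubmodule :=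
    fun x => quotProj_eq_zero N x
  have hSES := shortExact_of j π (fun x y hxy => subInc_injective _ (by rw [← hjv, ← hjv, hxy]))
    (quotProj_surjective N) (full_ext fun x => (hπ0 (ev j x)).2 (by
      rw [hjv]; exact subInc_mem _ x)) fun y hy => by
    obtain ⟨z, hz⟩ := exists_subInc_eq (filt f (n + 1)) ((hπ0 y).1 hy)
    exact ⟨z, subInc_injective _ (by rw [hjv, hz])⟩
  -- `Pₙ₊₁` is generated by images of `P`, which has no nonzero map to `R`.
  have hR' : ∀ g : subObj (filt f (n + 1)) ⟶ R, g = 0 := fun g => by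
    obtain ⟨J', _, e', hm, hg⟩ := h.exists_generators (n + 1)
    refine full_ext fun x => ?_
    obtain ⟨y, hy⟩ := hg _ (subInc_mem _ x)
    choose s hs using fun l => exists_subLift (filt f (n + 1)) (e' l)
      ((h.mem_jacobson_pow_iff _ _).1 (hm l))
    have hx : x = ∑ l, ev (s l) (y l) := subInc_injective _ (by
      rw [hy, ev_sum]
      exact Finset.sum_congr rfl fun l _ => (ev_congr (hs l) (y l)).symm)
    rw [hx, ev_sum]
    exact Finset.sum_eq_zero fun l _ => ev_congr (hR (s l ≫ g)) (y l)
  have hX : ExtVanish.{u + 1} (quotObj N) R 1 :=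
    ExtVanish.right hSES (extVanish_zero_iff.2 hR') hn
  choose e' he' using fun l => exists_subLift (filt f n) (e l)
    ((h.mem_jacobson_pow_iff n _).1 (he.mem l))
  have he'v : ∀ l x, ev (subInc (filt f n)) (ev (e' l) x) = ev (e l) x := fun l => ev_congr (he' l)
  choose ε hε using fun l => exists_desc θ h.surjective (e' l ≫ π) fun x hx => (hπ0 (ev (e' l) x)).2 (by
    rw [he'v]
    exact h.mem_filt_of_mem_jacobson_pow (he.mem l) hx)
  have hεv : ∀ l x, ev (ε l) (ev θ x) = ev π (ev (e' l) x) := fun l => ev_congr (hε l)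
  have hεs : Function.Surjective (ev (sumMap ε)) := fun z => by
    obtain ⟨x, rfl⟩ := quotProj_surjective N z
    obtain ⟨y, hy⟩ := he.gen _ (subInc_mem _ x)
    obtain ⟨w, hw⟩ := exists_pow_eq fun l => ev θ (y l)
    refine ⟨w, ?_⟩
    rw [ev_sumMap]
    simp only [hw, hεv]
    rw [← ev_sum, ← sub_eq_zero, ← neg_sub, neg_eq_zero]
    refine (ev_sub π _ _).symm.trans ((hπ0 _).2 ?_)
    rw [ev_sub, ev_sum]
    simpa only [he'v] using hy
  have hSES2 := ker_shortExact _ hεs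
  -- Let `Y` be the kernel of `Q^J → X`. A map `P → Y ⊆ Q^J` has components `c l • θ`. Vanishing in
  -- `X` says `∑ c l • e l ∈ 𝔪ⁿ⁺¹`, so by minimality every `c l` lies in `(ϖ)` and kills `θ`.
  have hPY : ∀ g : P ⟶ kerObj (sumMap ε), g = 0 := fun g => by
    have := mono_of_ev_injective _ (kerInc_injective (sumMap ε))
    rw [← cancel_mono (kerInc (sumMap ε)), zero_comp]
    obtain ⟨c, hc⟩ := h.hom_pow_eq (g ≫ kerInc (sumMap ε))
    have hc' : ∀ l, c l ∈ Ideal.span {ϖ} := by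
      refine hmin c ((h.mem_jacobson_pow_iff _ _).2 fun x => ?_)
      have h1 : ev (sumMap ε) (ev (g ≫ kerInc (sumMap ε)) x) = 0 :=
        ev_congr (kerInc_comp (sumMap ε)) (ev g x)
      rw [ev_sumMap] at h1
      have h2 : ∀ l, ev (powProj Q l) (ev (g ≫ kerInc (sumMap ε)) x) = ev θ (c l • x) := fun l =>
        (ev_congr (hc l) x).trans (ev_smul _ _ _).symm
      simp only [h2, hεv] at h1
      rw [← ev_sum, hπ0, ev_sum] at h1
      simp only [he'v, ev_smul] at h1
      rw [sum_ev]
      exact h1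
    refine pow_hom_ext fun l => ?_
    rw [hc l, (h.smul_θ _).2 (hc' l), zero_comp]
  -- `Hom(Q, R) = 0` and `Ext¹(X, R) = 0` give `Hom(Y, R) = 0`. So every map `Y → Q` vanishes, and
  -- in particular the inclusion of `Y` in `Q^J` does.
  have hYR : ∀ g : kerObj (sumMap ε) ⟶ R, g = 0 := extVanish_zero_iff.1
    (ExtVanish.left hSES2 (ExtVanish.pow (extVanish_zero_iff.2 hQR)) hX)
  have hY : kerInc (sumMap ε) = 0 := pow_hom_ext fun l => by
    rw [hYQ _ hPY hYR (kerInc (sumMap ε) ≫ powProj Q l), zero_comp]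
  have hεi : ∀ x, ev (sumMap ε) x = 0 → x = 0 := fun x hx => by
    obtain ⟨y, rfl⟩ := exists_kerInc_eq (sumMap ε) hx
    exact ev_congr hY y
  have hiso : IsIso (sumMap ε) := isIso_of_bijective _
    ⟨(injective_iff_map_eq_zero (sumMap ε).hom.1).2 hεi, hεs⟩
  -- Now `X ≅ Q^J`, so `Ext²(X, R) = 0`, and the sequence `Pₙ₊₁ → Pₙ → X` gives `Ext¹(Pₙ₊₁, R) = 0`.
  have hX2 : ExtVanish.{u + 1} (quotObj N) R 2 :=
    ExtVanish.of_retract (inv (sumMap ε)) (sumMap ε) (IsIso.inv_hom_id _) (ExtVanish.pow hQ)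
  refine ⟨ExtVanish.left hSES hn hX2, J, _, e, he, fun y hy => ?_⟩
  obtain ⟨w, hw⟩ := exists_pow_eq fun l => ev θ (y l)
  have h1 : w = 0 := hεi w (by
    rw [ev_sumMap]
    simp only [hw, hεv]
    rw [← ev_sum, hπ0, ev_sum]
    simpa only [he'v] using hy)
  intro l
  rw [← hw l, h1, ev_zero]

end IsHead
end Graded

/-! ### Bases over the residue field. -/

section ResidueBasis

variable {O : Type u} [CommRing O] {ϖ : O} {V I : Type u} [AddCommGroup V] [Module O V]

/-- `v` is a basis over `O / ϖ` of the `O`-module `V` that is killed by `ϖ`, with dual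
functionals `χ`. -/
structure IsResidueBasis (ϖ : O) (v : I → V) (χ : I → (V →ₗ[O] O ⧸ Ideal.span {ϖ})) :
    Prop where
  span : Submodule.span O (Set.range v) = ⊤
  dual_self : ∀ i, χ i (v i) = 1
  dual_ne : ∀ i j, j ≠ i → χ i (v j) = 0

theorem exists_isResidueBasis (hm : (Ideal.span {ϖ}).IsMaximal) (hV : ∀ x : V, ϖ • x = 0) :
    ∃ (I : Type u) (v : I → V) (χ : I → (V →ₗ[O] O ⧸ Ideal.span {ϖ})),
      IsResidueBasis ϖ v χ := by
  have hT : Module.IsTorsionBySet O V (Ideal.span {ϖ}) := by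
    rintro x ⟨c, hc⟩
    obtain ⟨d, rfl⟩ := Ideal.mem_span_singleton'.1 hc
    change (d * ϖ) • x = 0
    rw [mul_smul, hV, smul_zero]
  let _ := Ideal.Quotient.field (Ideal.span {ϖ})
  let _ : Module (O ⧸ Ideal.span {ϖ}) V := hT.module
  have : IsScalarTower O (O ⧸ Ideal.span {ϖ}) V := hT.isScalarTower
  let b := Module.Basis.ofVectorSpace (O ⧸ Ideal.span {ϖ}) V
  refine ⟨_, b, fun i => (b.coord i).restrictScalars O, ?_, fun i => ?_, fun i j hij => ?_⟩
  · have h1 := b.span_eq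
    have := Submodule.restrictScalars_span O (O ⧸ Ideal.span {ϖ}) Ideal.Quotient.mk_surjective
      (Set.range b)
    rw [← this, h1, Submodule.restrictScalars_top]
  · simp
  · simp [hij]

theorem IsResidueBasis.mem_of_sum_eq_zero {v : I → V} {χ : I → (V →ₗ[O] O ⧸ Ideal.span {ϖ})}
    (hv : IsResidueBasis ϖ v χ) (s : Finset I) (c : I → O) (h : ∑ i ∈ s, c i • v i = 0) :
    ∀ i ∈ s, c i ∈ Ideal.span {ϖ} := by
  intro i hi
  have h1 := congrArg (χ i) h
  rw [map_sum, Finset.sum_eq_single i, map_smul, hv.dual_self, map_zero] at h1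
  · rw [Algebra.smul_def, mul_one] at h1
    exact Ideal.Quotient.eq_zero_iff_mem.1 h1
  · intro j _ hj
    rw [map_smul, hv.dual_ne _ _ hj, smul_zero]
  · exact fun h => absurd hi h

theorem IsResidueBasis.nonempty {v : I → V} {χ : I → (V →ₗ[O] O ⧸ Ideal.span {ϖ})}
    (hv : IsResidueBasis ϖ v χ) (h : ∃ x : V, x ≠ 0) : Nonempty I := by
  by_contra hI
  rw [not_nonempty_iff] at hI
  obtain ⟨x, hx⟩ := h
  have : x ∈ Submodule.span O (Set.range v) := by rw [hv.span]; trivial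
  rw [Set.range_eq_empty, Submodule.span_empty] at this
  exact hx this

end ResidueBasis

/-! ### Lifts of a basis of `Q` form a basis of `P / Pₙ` over `E / 𝔪ⁿ`. -/

section Coordinates

variable {O G : Type u} [CommRing O] [Group G] [TopologicalSpace G]
  {C : ObjectProperty (ProAug O G)} [IsDualCat C]
  {P Q : C.FullSubcategory} {ϖ : O} {ι I : Type u} [Fintype ι]
  {θ : P ⟶ Q} {f : ι → End P}

/-- The graded pieces of the filtration of `P` are direct sums of copies of `Q`. -/
def IsGradedFree (θ : P ⟶ Q) (f : ι → End P) : Prop :=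
  ∀ n, ∃ (J : Type u) (_ : Fintype J) (e : J → End P), GeneratesGraded f n e ∧
    ∀ y : J → P.obj.carrier, ∑ l, ev (e l) (y l) ∈ (filt f (n + 1)).toSubmodule →
      ∀ l, ev θ (y l) = 0

namespace IsHead

variable (h : IsHead ϖ θ f)
include h

theorem exists_residueBasis : ∃ (I : Type u) (x : I → P.obj.carrier)
    (χ : I → (Q.obj.carrier →ₗ[O] O ⧸ Ideal.span {ϖ})),
      IsResidueBasis ϖ (fun i => ev θ (x i)) χ := by
  obtain ⟨I, v, χ, hv⟩ := exists_isResidueBasis h.maximal h.smul_Q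
  choose x hx using fun i => h.surjective (v i)
  exact ⟨I, x, χ, by simpa only [hx] using hv⟩

/-- By projectivity `r` is `∑ e l * g l` modulo `𝔪ⁿ⁺¹`, and each `g l` may be replaced by a scalar
because `E / 𝔪 = k`. -/
theorem exists_approx {n : ℕ} {J : Type u} [Fintype J] {e : J → End P}
    (he : GeneratesGraded f n e) {r : End P} (hr : r ∈ Ring.jacobson (End P) ^ n) :
    ∃ c : J → O, r - ∑ l, c l • e l ∈ Ring.jacobson (End P) ^ (n + 1) := by
  have := h.projective
  obtain ⟨g, hg⟩ : ∃ g : J → End P, (r : P ⟶ P) ≫ quotProj (filt f (n + 1)) =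
      ∑ l, (g l : P ⟶ P) ≫ (e l : P ⟶ P) ≫ quotProj (filt f (n + 1)) :=
    exists_comb _ _ fun x => by
      obtain ⟨y, hy⟩ := he.gen _ ((h.mem_jacobson_pow_iff _ _).1 hr x)
      refine ⟨y, ?_⟩
      rw [ev_comp, ← sub_eq_zero]
      simp only [ev_comp]
      rw [← ev_sum, ← ev_sub]
      exact (quotProj_eq_zero _ _).2 hy
  have h1 : r - ∑ l, e l * g l ∈ Ring.jacobson (End P) ^ (n + 1) := by
    refine (h.mem_jacobson_pow_iff _ _).2 fun x => (quotProj_eq_zero _ _).1 ?_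
    have := ev_congr hg x
    rw [sum_ev] at this
    rw [sub_ev, ev_sub, sub_eq_zero, sum_ev, ev_sum]
    exact this
  choose c hc using fun l => h.isLocalOver.exists_scalar (g l)
  refine ⟨c, ?_⟩
  have h2 : r - ∑ l, c l • e l = (r - ∑ l, e l * g l) +
      ∑ l, e l * (g l - algebraMap O (End P) (c l)) := by
    simp only [mul_sub, Finset.sum_sub_distrib, ← Algebra.commutes, ← Algebra.smul_def]
    abel
  rw [h2]
  refine add_mem h1 (sum_mem fun l _ => ?_)
  rw [Submodule.pow_succ]
  exact Ideal.mul_mem_mul (he.mem l) (hc l)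

/-- This is independence. Inductively `r i ≡ ∑ c i l • e l` modulo `𝔪ⁿ⁺¹`, so `∑ e l (∑ c i l • x
i)` lies in `Pₙ₊₁`. Freeness of the graded piece gives `∑ c i l • θ(x i) = 0` for each `l`, so all
`c i l` lie in `(ϖ)`, and then `c i l • e l` maps `P` into `Pₙ₊₁`. -/
theorem mem_pow_of_sum_mem (hf : IsGradedFree θ f) {x : I → P.obj.carrier}
    {χ : I → (Q.obj.carrier →ₗ[O] O ⧸ Ideal.span {ϖ})}
    (hx : IsResidueBasis ϖ (fun i => ev θ (x i)) χ) (s : Finset I) (r : I → End P) (n : ℕ)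
    (hr : ∑ i ∈ s, ev (r i) (x i) ∈ (filt f n).toSubmodule) :
    ∀ i ∈ s, r i ∈ Ring.jacobson (End P) ^ n := by
  induction n with
  | zero =>
    intro i _
    rw [Submodule.pow_zero, Ideal.one_eq_top]
    trivial
  | succ n ih =>
    have ih := ih (filt_succ_le f n hr)
    obtain ⟨J, _, e, he, hinj⟩ := hf n
    have hc : ∀ i, ∃ c : J → O, i ∈ s →
        r i - ∑ l, c l • e l ∈ Ring.jacobson (End P) ^ (n + 1) := fun i => by
      by_cases hi : i ∈ s
      · obtain ⟨c, hc⟩ := h.exists_approx he (ih i hi)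
        exact ⟨c, fun _ => hc⟩
      · exact ⟨0, fun h => absurd h hi⟩
    choose c hc using hc
    have h1 : ∑ l, ev (e l) (∑ i ∈ s, c i l • x i) ∈ (filt f (n + 1)).toSubmodule := by
      have h2 : ∑ l, ev (e l) (∑ i ∈ s, c i l • x i) = ∑ i ∈ s, ev (r i) (x i) -
          ∑ i ∈ s, ev (r i - ∑ l, c i l • e l) (x i) := by
        have h3 : ∀ i, ev (r i - ∑ l, c i l • e l) (x i) =
            ev (r i) (x i) - ∑ l, c i l • ev (e l) (x i) := fun i => by
          refine (sub_ev _ _ _).trans ?_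
          rw [sum_ev]
          rfl
        simp only [h3, Finset.sum_sub_distrib, sub_sub_cancel, ev_sum]
        rw [Finset.sum_comm]
        simp only [ev_smul]
      rw [h2]
      exact sub_mem hr (sum_mem fun i hi => (h.mem_jacobson_pow_iff _ _).1 (hc i hi) _)
    have h2 := hinj _ h1
    intro i hi
    rw [← sub_add_cancel (r i) (∑ l, c i l • e l)]
    refine add_mem (hc i hi) (sum_mem fun l _ => (h.mem_jacobson_pow_iff _ _).2 fun y => ?_)
    have h3 := h2 l
    rw [ev_sum] at h3
    simp only [ev_smul] at h3
    exact h.smul_mem_filt (he.mem l) (hx.mem_of_sum_eq_zero s (fun i => c i l) h3 i hi) y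

/-- This is generation. An error in `Pₙ` is `∑ e l (y l)` modulo `Pₙ₊₁`, and modulo `ker θ` each `y
l` is an `O`-combination of the `x i`; this suffices because `e l` maps `ker θ` into `Pₙ₊₁`. -/
theorem exists_sub_mem_filt {x : I → P.obj.carrier}
    {χ : I → (Q.obj.carrier →ₗ[O] O ⧸ Ideal.span {ϖ})}
    (hx : IsResidueBasis ϖ (fun i => ev θ (x i)) χ) (n : ℕ) (z : P.obj.carrier) :
    ∃ c : I →₀ End P, z - c.sum (fun i r => ev r (x i)) ∈ (filt f n).toSubmodule := by
  let σ : (I →₀ End P) →+ P.obj.carrier := Finsupp.liftAddHom fun i =>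
    { toFun := fun r => ev r (x i), map_zero' := rfl, map_add' := fun _ _ => rfl }
  change ∃ c, z - σ c ∈ _
  induction n with
  | zero => exact ⟨0, trivial⟩
  | succ n ih =>
    obtain ⟨w, hzw⟩ := ih
    obtain ⟨J, _, e, he⟩ := h.exists_generatesGraded n
    obtain ⟨y, hy⟩ := he.gen _ hzw
    have hy' : ∀ l, ∃ c : I →₀ O, ev θ (y l - c.sum fun i a => a • x i) = 0 := fun l => by
      have : ev θ (y l) ∈ Submodule.span O (Set.range fun i => ev θ (x i)) := by
        rw [hx.span]; trivial
      obtain ⟨c, hc⟩ := Finsupp.mem_span_range_iff_exists_finsupp.1 this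
      refine ⟨c, ?_⟩
      rw [ev_sub, ← hc, Finsupp.sum, Finsupp.sum, ev_sum]
      simp only [ev_smul, sub_self]
    choose c hc using hy'
    have hσ : ∀ l, σ ((c l).mapRange (· • e l) (zero_smul O _)) =
        ev (e l) ((c l).sum fun i a => a • x i) := fun l => by
      refine (Finsupp.sum_mapRange_index (h := fun i (r : End P) => ev r (x i))
        fun _ => rfl).trans ?_
      rw [Finsupp.sum, Finsupp.sum, ev_sum]
      refine Finset.sum_congr rfl fun i _ => ?_
      rw [ev_smul]
      rfl
    refine ⟨w + ∑ l, (c l).mapRange (· • e l) (zero_smul O _), ?_⟩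
    have h1 : z - σ (w + ∑ l, (c l).mapRange (· • e l) (zero_smul O _)) =
        (z - σ w - ∑ l, ev (e l) (y l)) +
          ∑ l, ev (e l) (y l - (c l).sum fun i a => a • x i) := by
      rw [map_add, map_sum]
      simp only [ev_sub, Finset.sum_sub_distrib, hσ]
      abel
    rw [h1]
    exact add_mem hy (sum_mem fun l _ => h.mem_filt_of_mem_jacobson_pow (he.mem l) (hc l))

end IsHead
end Coordinates

/-! ### Nakayama's lemma for a nilpotent ideal. -/

section Nakayama

variable {A H : Type u} [Ring A] [AddCommGroup H] [Module A H]

/-- Iterating `H = N + I H` gives `H = N + I ^ j H` for all `j`. Nilpotence makes finite generation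
of `H` unnecessary. -/
theorem eq_top_of_forall_sub_mem_smul {I : Ideal A} {n : ℕ} (hI : I ^ n = ⊥)
    (N : Submodule A H) (h : ∀ x, ∃ y ∈ N, x - y ∈ I • (⊤ : Submodule A H)) : N = ⊤ := by
  have h1 : ⊤ ≤ N ⊔ I • (⊤ : Submodule A H) := fun x _ => by
    obtain ⟨y, hy, hxy⟩ := h x
    rw [← add_sub_cancel y x]
    exact Submodule.add_mem_sup hy hxy
  have h2 : ∀ j, ⊤ ≤ N ⊔ I ^ j • (⊤ : Submodule A H) := by
    intro j
    induction j with
    | zero => rw [Submodule.pow_zero, Submodule.one_smul]; exact le_sup_right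
    | succ j ih =>
      refine ih.trans (sup_le le_sup_left ?_)
      calc I ^ j • (⊤ : Submodule A H) ≤ I ^ j • (N ⊔ I • (⊤ : Submodule A H)) :=
            Submodule.smul_mono le_rfl h1
        _ = I ^ j • N ⊔ I ^ (j + 1) • (⊤ : Submodule A H) := by
            rw [Submodule.smul_sup, ← Submodule.mul_smul, Submodule.pow_succ]
        _ ≤ _ := sup_le_sup_right Submodule.smul_le_right _
  have h3 := h2 n
  rw [hI, Submodule.bot_smul, sup_bot_eq] at h3
  exact top_le_iff.1 h3

end Nakayama

/-! ### Balanced tensor products; free modules are flat. -/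

section FlatModules

variable {A I : Type u} [Ring A] {N N' M : Type u} [AddCommGroup N] [Module Aᵐᵒᵖ N]
  [AddCommGroup N'] [Module Aᵐᵒᵖ N'] [AddCommGroup M] [Module A M]

/-- The class of `n ⊗ m`. -/
def bmk (A : Type u) [Ring A] {N M : Type u} [AddCommGroup N] [Module Aᵐᵒᵖ N] [AddCommGroup M]
    [Module A M] (n : N) (m : M) : BalancedTensor A N M :=
  QuotientAddGroup.mk (n ⊗ₜ[ℤ] m)

theorem bmk_add_left (n n' : N) (m : M) : bmk A (n + n') m = bmk A n m + bmk A n' m := by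
  rw [bmk, TensorProduct.add_tmul]; rfl

theorem bmk_add_right (n : N) (m m' : M) : bmk A n (m + m') = bmk A n m + bmk A n m' := by
  rw [bmk, TensorProduct.tmul_add]; rfl

theorem bmk_zero_left (m : M) : bmk A (0 : N) m = 0 := by
  rw [bmk, TensorProduct.zero_tmul]; rfl

theorem bmk_zero_right (n : N) : bmk A n (0 : M) = 0 := by
  rw [bmk, TensorProduct.tmul_zero]; rfl

theorem bmk_sum_right {J : Type*} (s : Finset J) (n : N) (m : J → M) :
    bmk A n (∑ j ∈ s, m j) = ∑ j ∈ s, bmk A n (m j) :=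
  map_sum (⟨⟨fun m => bmk A n m, bmk_zero_right n⟩, bmk_add_right n⟩ :
    M →+ BalancedTensor A N M) m s

theorem bmk_smul (n : N) (a : A) (m : M) : bmk A (MulOpposite.op a • n) m = bmk A n (a • m) := by
  refine (QuotientAddGroup.eq_iff_sub_mem).2 (AddSubgroup.subset_closure ⟨n, a, m, rfl⟩)

theorem bmap_bmk (g : N →ₗ[Aᵐᵒᵖ] N') (n : N) (m : M) :
    BalancedTensor.map A M g (bmk A n m) = bmk A (g n) m := rfl

theorem btensor_induction {p : BalancedTensor A N M → Prop} (h0 : p 0)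
    (h1 : ∀ n m, p (bmk A n m)) (h2 : ∀ x y, p x → p y → p (x + y)) (x) : p x := by
  obtain ⟨x, rfl⟩ := QuotientAddGroup.mk_surjective x
  induction x using TensorProduct.induction_on with
  | zero => exact h0
  | tmul n m => exact h1 n m
  | add x y hx hy => exact h2 _ _ hx hy

/-- The map out of a balanced tensor product given by a balanced biadditive map. -/
def blift {T : Type u} [AddCommGroup T] (g : N →+ M →+ T)
    (hg : ∀ n (a : A) m, g (MulOpposite.op a • n) m = g n (a • m)) :
    BalancedTensor A N M →+ T :=
  QuotientAddGroup.lift (balancedRel A N M)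
    (TensorProduct.liftAddHom (R := ℤ) g fun r n m => by
      rw [map_zsmul, map_zsmul]; rfl)
    ((AddSubgroup.closure_le _).2 (by
      rintro _ ⟨n, a, m, rfl⟩
      change _ = _
      rw [map_sub, TensorProduct.liftAddHom_tmul, TensorProduct.liftAddHom_tmul, hg, sub_self]))

/-- Free modules are flat. -/
theorem isFlatModule_of_basis (b : Module.Basis I A M) : IsFlatModule A M := by
  intro N N' _ _ _ _ g hg
  -- Coordinates with respect to `b` embed `N ⊗ M` into a sum of copies of `N`, compatibly with maps
  -- of `N`; `F'` is a left inverse.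
  have key : ∀ (N : Type u) [AddCommGroup N] [Module Aᵐᵒᵖ N],
      ∃ (F : BalancedTensor A N M →+ (I →₀ N)) (F' : (I →₀ N) →+ BalancedTensor A N M),
        (∀ n m, F (bmk A n m) = (b.repr m).mapRange (fun a => MulOpposite.op a • n)
          (by rw [MulOpposite.op_zero, zero_smul])) ∧ ∀ t, F' (F t) = t := by
    intro N _ _
    let F : BalancedTensor A N M →+ (I →₀ N) := blift
      { toFun := fun n =>
          { toFun := fun m => (b.repr m).mapRange (fun a => MulOpposite.op a • n)
              (by rw [MulOpposite.op_zero, zero_smul])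
            map_zero' := by ext; simp
            map_add' := fun m m' => by ext; simp [add_smul] }
        map_zero' := by ext; simp
        map_add' := fun n n' => by ext; simp } (fun n a m => by
          ext; simp [mul_smul])
    let F' : (I →₀ N) →+ BalancedTensor A N M := Finsupp.liftAddHom fun i =>
      { toFun := fun n => bmk A n (b i)
        map_zero' := bmk_zero_left _
        map_add' := fun n n' => bmk_add_left _ _ _ }
    refine ⟨F, F', fun n m => rfl, fun t => ?_⟩
    induction t using btensor_induction with
    | h0 => rw [map_zero, map_zero]
    | h2 x y hx hy => rw [map_add, map_add, hx, hy]
    | h1 n m =>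
      change ((b.repr m).mapRange (fun a => MulOpposite.op a • n)
        (by rw [MulOpposite.op_zero, zero_smul])).sum
        (fun i n => bmk A n (b i)) = _
      rw [Finsupp.sum_mapRange_index (h := fun i n => bmk A n (b i)) fun i => bmk_zero_left _]
      simp only [bmk_smul]
      rw [Finsupp.sum, ← bmk_sum_right]
      congr 1
      exact b.linearCombination_repr m
  obtain ⟨F, F', hF, hF'⟩ := key N
  obtain ⟨K, K', hK, hK'⟩ := key N'
  have hnat : ∀ t, K (BalancedTensor.map A M g t) = (F t).mapRange g (map_zero g) := fun t => by
    induction t using btensor_induction with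
    | h0 => simp
    | h2 x y hx hy =>
      rw [map_add, map_add, map_add, hx, hy, Finsupp.mapRange_add (map_add g)]
    | h1 n m =>
      rw [bmap_bmk, hK, hF]
      ext i
      simp
  intro t t' htt
  have h1 : F t = F t' := by
    have := hnat t
    rw [htt, hnat t'] at this
    exact (Finsupp.mapRange_injective g (map_zero g) hg this).symm
  rw [← hF' t, h1, hF']

end FlatModules

/-! ### Flat modules over an artinian local algebra are free. -/

section FlatOverLocal

variable {O : Type u} [CommRing O] {ϖ : O} {A : Type u} [Ring A] [Algebra O A]
  {M V I : Type u} [AddCommGroup M] [Module A M] [Module O M] [IsScalarTower O A M]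
  [AddCommGroup V] [Module O V]

/-- `π : M → V` identifies `V` with `M / 𝔪_A M`. -/
structure IsReductionMap (A : Type u) [Ring A] [Module A M] (π : M →ₗ[O] V) : Prop where
  surjective : Function.Surjective π
  ker : ∀ x, π x = 0 ↔ x ∈ Ring.jacobson A • (⊤ : Submodule A M)

namespace IsReductionMap

variable {π : M →ₗ[O] V} (hπ : IsReductionMap A π)
  {y : I → M} {χ : I → (V →ₗ[O] O ⧸ Ideal.span {ϖ})}
  (hy : IsResidueBasis ϖ (fun i => π (y i)) χ) (hA : IsArtAlgebra ϖ A)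
include hπ hy hA

theorem span_eq_top : Submodule.span A (Set.range y) = ⊤ := by
  obtain ⟨n, hn⟩ := hA.exists_jacobson_pow_eq_bot
  refine eq_top_of_forall_sub_mem_smul hn _ fun x => ?_
  have : π x ∈ Submodule.span O (Set.range fun i => π (y i)) := by rw [hy.span]; trivial
  obtain ⟨c, hc⟩ := Finsupp.mem_span_range_iff_exists_finsupp.1 this
  refine ⟨c.sum fun i a => a • y i, sum_mem fun i _ => ?_, (hπ.ker _).1 ?_⟩
  · change c i • y i ∈ _
    rw [← IsScalarTower.algebraMap_smul A]
    exact Submodule.smul_mem _ _ (Submodule.subset_span ⟨i, rfl⟩)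
  · rw [map_sub, ← hc, Finsupp.sum, Finsupp.sum, map_sum]
    simp only [map_smul, sub_self]

/-- Given `∑ a i • y i = 0`, the coefficients are pushed into `𝔪 ^ j` for every `j`. If they lie in
`𝔪 ^ j`, flatness for `𝔪 ^ j ⊆ A` gives `∑ a i ⊗ y i = 0` in `𝔪 ^ j ⊗ M`. Applying `b ⊗ m ↦ b χ i (π
m)`, with values modulo `𝔪 ^ (j + 1)`, isolates `a i`. -/
theorem linearIndependent (hflat : IsFlatModule A M) : LinearIndependent A y := by
  have hL := (isArtAlgebra_iff.1 hA).2
  obtain ⟨n, hn⟩ := hA.exists_jacobson_pow_eq_bot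
  rw [linearIndependent_iff']
  intro s a ha
  suffices ∀ j, ∀ i ∈ s, a i ∈ Ring.jacobson A ^ j by
    intro i hi
    have := this n i hi
    rwa [hn] at this
  intro j
  induction j with
  | zero => intro i _; rw [Submodule.pow_zero, Ideal.one_eq_top]; trivial
  | succ j ih =>
    let K := Ring.jacobson A ^ j
    let K' := Ring.jacobson A ^ (j + 1)
    let N : Submodule Aᵐᵒᵖ A :=
      { carrier := K
        add_mem' := fun h h' => add_mem h h'
        zero_mem' := zero_mem K
        smul_mem' := fun c x hx => Ideal.mul_mem_right c.unop _ hx }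
    have hKK' : ∀ (b : A) (x : A), b ∈ K → x ∈ Ring.jacobson A → b * x ∈ K' := fun b x hb hx => by
      change b * x ∈ Ring.jacobson A ^ (j + 1)
      rw [Submodule.pow_succ]
      exact Ideal.mul_mem_mul hb hx
    -- the scalar action of `O / ϖ` on `𝔪 ^ j / 𝔪 ^ (j + 1)`
    let scal : N →+ (O ⧸ Ideal.span {ϖ}) →ₗ[O] (A ⧸ K') :=
      { toFun := fun b => (Ideal.span {ϖ}).liftQ
          (LinearMap.toSpanSingleton O (A ⧸ K') (Submodule.Quotient.mk b.1)) fun c hc => by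
            rw [LinearMap.mem_ker, LinearMap.toSpanSingleton_apply,
              ← Submodule.Quotient.mk_smul, Submodule.Quotient.mk_eq_zero, Algebra.smul_def,
              Algebra.commutes]
            exact hKK' _ _ b.2 ((hL.scalar_mem_iff c).2 hc)
        map_zero' := by
          refine Submodule.linearMap_qext _ (LinearMap.ext fun c => ?_)
          exact smul_zero c
        map_add' := fun b b' => by
          refine Submodule.linearMap_qext _ (LinearMap.ext fun c => ?_)
          exact smul_add c (Submodule.Quotient.mk (p := K') b.1) (Submodule.Quotient.mk b'.1) }
    have hscal : ∀ (b : N) (c : O), scal b (Ideal.Quotient.mk _ c) =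
        Submodule.Quotient.mk (c • b.1) := fun b c => rfl
    -- Modulo `𝔪` the element `r` is a central scalar, and the error `𝔪 ^ j * 𝔪` vanishes in the
    -- target.
    have hbal : ∀ i (b : N) (r : A) (m : M), scal (MulOpposite.op r • b) (χ i (π m)) =
        scal b (χ i (π (r • m))) := fun i b r m => by
      obtain ⟨c, hc⟩ := hL.exists_scalar r
      have h1 : π (r • m) = c • π m := by
        rw [← sub_eq_zero, ← map_smul, ← map_sub, hπ.ker, ← IsScalarTower.algebraMap_smul A c m,
          ← sub_smul]
        exact Submodule.smul_mem_smul hc trivial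
      rw [h1, (χ i).map_smul]
      obtain ⟨d, hd⟩ := Ideal.Quotient.mk_surjective (χ i (π m))
      rw [← hd, (scal b).map_smul, hscal, hscal, ← Submodule.Quotient.mk_smul,
        Submodule.Quotient.eq]
      have h2 : d • (b.1 * r) - c • d • b.1 = d • (b.1 * (r - algebraMap O A c)) := by
        rw [mul_sub, smul_sub, ← Algebra.commutes, ← Algebra.smul_def, smul_comm c d]
      have h3 : (MulOpposite.op r • b).1 = b.1 * r := rfl
      rw [h3, h2, Algebra.smul_def]
      exact Ideal.mul_mem_left _ _ (hKK' _ _ b.2 hc)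
    let Ψ : I → BalancedTensor A N M →+ (A ⧸ K') := fun i => blift
      { toFun := fun b => ((scal b).toAddMonoidHom.comp (χ i).toAddMonoidHom).comp
          π.toAddMonoidHom
        map_zero' := by rw [map_zero]; rfl
        map_add' := fun b b' => by rw [map_add]; rfl } (hbal i)
    have hΨ : ∀ i (b : N) m, Ψ i (bmk A b m) = scal b (χ i (π m)) := fun i b m => rfl
    have hz : ∑ i ∈ s.attach, bmk A (⟨a i, ih i i.2⟩ : N) (y i) = 0 := by
      refine hflat N A N.subtype N.injective_subtype ?_
      rw [map_sum, map_zero]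
      have : ∀ i : s, BalancedTensor.map A M N.subtype (bmk A (⟨a i, ih i i.2⟩ : N) (y i)) =
          bmk A (1 : A) (a i • y i) := fun i => by
        rw [bmap_bmk, ← bmk_smul]
        congr 1
        exact (one_mul _).symm
      simp only [this]
      rw [← bmk_sum_right, Finset.sum_attach s fun i => a i • y i, ha, bmk_zero_right]
    intro i hi
    have h1 := congrArg (Ψ i) hz
    rw [map_sum, map_zero, Finset.sum_eq_single ⟨i, hi⟩ (fun l _ hl => by
      rw [hΨ, hy.dual_ne i l fun h => hl (Subtype.ext h), map_zero])
      fun h => absurd (Finset.mem_attach _ _) h, hΨ, hy.dual_self,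
      ← map_one (Ideal.Quotient.mk (Ideal.span {ϖ})), hscal, one_smul,
      Submodule.Quotient.mk_eq_zero] at h1
    exact h1

end IsReductionMap
end FlatOverLocal

theorem bijective_of_span_of_linearIndependent {A X Y I : Type u} [Ring A] [AddCommGroup X]
    [Module A X] [AddCommGroup Y] [Module A Y] (g : X →ₗ[A] Y) (v : I → X)
    (hv : Submodule.span A (Set.range v) = ⊤) (h1 : LinearIndependent A fun i => g (v i))
    (h2 : Submodule.span A (Set.range fun i => g (v i)) = ⊤) : Function.Bijective g := by
  constructor
  · refine (injective_iff_map_eq_zero g).2 fun x hx => ?_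
    have : x ∈ Submodule.span A (Set.range v) := by rw [hv]; trivial
    obtain ⟨c, rfl⟩ := Finsupp.mem_span_range_iff_exists_finsupp.1 this
    rw [Finsupp.sum, map_sum] at hx
    simp only [map_smul] at hx
    have h3 := linearIndependent_iff'.1 h1 _ _ hx
    exact Finset.sum_eq_zero fun i hi => by
      change c i • v i = 0
      rw [h3 i hi, zero_smul]
  · intro z
    have : z ∈ Submodule.span A (Set.range fun i => g (v i)) := by rw [h2]; trivial
    obtain ⟨c, rfl⟩ := Finsupp.mem_span_range_iff_exists_finsupp.1 this
    refine ⟨c.sum fun i a => a • v i, ?_⟩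
    rw [Finsupp.sum, map_sum]
    simp only [map_smul]
    rfl

/-! ### Elements of the completed tensor product. -/

section Tensor

variable {O G : Type u} [CommRing O] [Group G] [TopologicalSpace G]
  {C : ObjectProperty (ProAug O G)} {R : Type u} [Ring R] [Algebra O R]

namespace CMod

instance (M : CMod C R) : Module O M.Carrier := inferInstanceAs (Module O M.obj.obj.carrier)

theorem smul_eq (M : CMod C R) (r : R) (x : M.Carrier) : r • x = ev (M.ρ r) x := rfl

instance (M : CMod C R) : IsScalarTower O R M.Carrier where
  smul_assoc c r x := by
    rw [smul_eq, smul_eq, map_smul]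
    rfl

variable [IsDualCat C] {A : Type u} [Ring A] [Algebra O A] [Finite A]
  (M : CMod C R) (φ : R →ₐ[O] A)

theorem exists_eq_sum_tmul [Fintype A] (z : (M.tensorObj φ).obj.carrier) :
    ∃ w : A → M.obj.obj.carrier, z = ∑ a, ev (M.tmul φ a) (w a) := by
  obtain ⟨w, rfl⟩ := quotπ_surjective (closedSpan (M.relations φ) (M.relations_smul φ)) z
  refine ⟨w, ?_⟩
  have h1 := map_sum (quotπ (closedSpan (M.relations φ) (M.relations_smul φ))).1
    (fun a : A => app (M.single a) (w a)) Finset.univ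
  have h2 := M.sum_single w
  rw [Subsingleton.elim (Fintype.ofFinite A) ‹Fintype A›] at h2
  nth_rw 1 [h2]
  exact h1

theorem act_tmul (a b : A) (x : M.obj.obj.carrier) :
    ev ((M.baseChange φ).ρ a) (ev (M.tmul φ b) x) = ev (M.tmul φ (a * b)) x :=
  ev_congr (M.tmul_tensorAct φ a b) x

theorem act_tmul_one (a : A) (x : M.obj.obj.carrier) :
    ev ((M.baseChange φ).ρ a) (ev (M.tmul φ 1) x) = ev (M.tmul φ a) x := by
  rw [act_tmul, mul_one]

theorem tmul_zero' : M.tmul φ 0 = 0 := by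
  have h := M.tmul_add (φ := φ) 0 0
  rw [add_zero] at h
  exact left_eq_add.1 h

theorem tmul_ρ (a : A) (r : R) (x : M.obj.obj.carrier) :
    ev (M.tmul φ a) (ev (M.ρ r) x) = ev (M.tmul φ (a * φ r)) x :=
  (ev_congr (M.tmul_mul a r) x).symm

/-- The element `1 ⊗ x`. -/
def oneTmul (x : M.obj.obj.carrier) : (M.baseChange φ).Carrier := ev (M.tmul φ 1) x

theorem span_oneTmul_of_forall {I : Type u} (y : I → M.obj.obj.carrier)
    (h : ∀ x, ∃ c : I →₀ R, ∀ a, ev (M.tmul φ a) x =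
      ev (M.tmul φ a) (c.sum fun i r => ev (M.ρ r) (y i))) :
    Submodule.span A (Set.range fun i => M.oneTmul φ (y i)) = ⊤ := by
  have := Fintype.ofFinite A
  refine top_le_iff.1 fun z _ => ?_
  obtain ⟨w, hw⟩ := M.exists_eq_sum_tmul φ z
  rw [hw]
  refine Submodule.sum_mem (M := (M.baseChange φ).Carrier) _ fun a _ => ?_
  obtain ⟨c, hc⟩ := h (w a)
  rw [hc a, Finsupp.sum, ev_sum]
  refine Submodule.sum_mem (M := (M.baseChange φ).Carrier) _ fun i _ => ?_
  rw [tmul_ρ, ← act_tmul_one]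
  exact Submodule.smul_mem _ (a * φ (c i)) (Submodule.subset_span ⟨i, rfl⟩)

theorem span_oneTmul {I : Type u} (y : I → M.Carrier)
    (h : Submodule.span R (Set.range y) = ⊤) :
    Submodule.span A (Set.range fun i => M.oneTmul φ (y i)) = ⊤ := by
  refine M.span_oneTmul_of_forall φ y fun x => ?_
  have hx : (show M.Carrier from x) ∈ Submodule.span R (Set.range y) := by rw [h]; trivial
  obtain ⟨c, hc⟩ := Finsupp.mem_span_range_iff_exists_finsupp.1 hx
  refine ⟨c, fun a => ?_⟩
  congr 1
  exact hc.symm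

/-- A family with `φ`-semilinear coordinates stays independent after base change, provided that
the closed subobject of relations consists of finite sums of relations. -/
theorem linearIndependent_oneTmul {I : Type u} {x : I → M.obj.obj.carrier}
    (c : M.obj.obj.carrier →+ (I →₀ A)) (hcr : ∀ r z, c (ev (M.ρ r) z) = φ r • c z)
    (hcx : ∀ i, c (x i) = Finsupp.single i 1) {T : Type u} [Fintype T]
    (F : T → (M.obj.obj ⟶ pi fun _ : A => M.obj.obj))
    (hF : ∀ l y, app (F l) y ∈ M.relations φ)
    (hFz : ∀ z ∈ (closedSpan (M.relations φ) (M.relations_smul φ)).toSubmodule,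
      ∃ y : T → M.obj.obj.carrier, z = ∑ l, app (F l) (y l)) :
    LinearIndependent A fun i => M.oneTmul φ (x i) := by
  classical
  have := Fintype.ofFinite A
  -- `Φ` sends `∑ a ⊗ z a` to `∑ a • c (z a)`. Continuity of `Φ` is not available, so it is `hFz`
  -- that lets `Φ` kill the closure of the relations.
  let Φ : (pi fun _ : A => M.obj.obj).carrier →+ (I →₀ A) :=
    AddMonoidHom.mk' (fun z => ∑ a : A, a • c (z a)) fun z z' => by
      rw [← Finset.sum_add_distrib]
      refine Finset.sum_congr rfl fun a _ => ?_
      rw [← smul_add, ← map_add]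
      rfl
  have hΦ : ∀ a y, Φ (app (M.single a) y) = a • c y := fun a y => by
    refine (Finset.sum_eq_single a ?_ ?_).trans ?_
    · intro b _ hb
      change b • c (Pi.single (M := fun _ : A => M.obj.obj.carrier) a y b) = _
      rw [Pi.single_eq_of_ne hb, map_zero, smul_zero]
    · exact fun h => absurd (Finset.mem_univ a) h
    · change a • c (Pi.single (M := fun _ : A => M.obj.obj.carrier) a y a) = _
      rw [Pi.single_eq_same]
  have hrel : ∀ z ∈ M.relations φ, Φ z = 0 := by
    rintro _ (⟨a, b, y, rfl⟩ | ⟨a, r, y, rfl⟩)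
    · rw [map_sub, map_sub, hΦ, hΦ, hΦ, add_smul]
      abel
    · rw [map_sub, hΦ, hΦ, hcr, mul_smul, sub_self]
  rw [linearIndependent_iff']
  intro s a ha
  have h1 : ∑ i ∈ s, app (M.single (a i)) (x i) ∈
      (closedSpan (M.relations φ) (M.relations_smul φ)).toSubmodule := by
    rw [← quotπ_eq_zero]
    refine (map_sum (quotπ (closedSpan (M.relations φ) (M.relations_smul φ))).1 _ _).trans ?_
    refine Eq.trans ?_ ha
    refine Finset.sum_congr rfl fun i _ => ?_
    exact (M.act_tmul_one φ (a i) (x i)).symm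
  obtain ⟨y, hy⟩ := hFz _ h1
  have h2 : Φ (∑ i ∈ s, app (M.single (a i)) (x i)) = 0 := by
    rw [hy, map_sum]
    exact Finset.sum_eq_zero fun l _ => hrel _ (hF l _)
  have h3 : ∑ i ∈ s, Finsupp.single i (a i) = 0 := by
    rw [← h2, map_sum]
    refine Finset.sum_congr rfl fun i _ => ?_
    rw [hΦ, hcx, Finsupp.smul_single, smul_eq_mul, mul_one]
  intro i hi
  have h4 := DFunLike.congr_fun h3 i
  rw [Finsupp.finsetSum_apply, Finset.sum_eq_single i] at h4
  · simpa using h4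
  · intro j _ hj
    exact Finsupp.single_eq_of_ne hj.symm
  · exact fun h => absurd hi h

end CMod
end Tensor

/-! ### The base change `A ⊗ P` is free over `A`. -/

section Free

variable {O G : Type u} [CommRing O] [Group G] [TopologicalSpace G]
  {C : ObjectProperty (ProAug O G)} [IsDualCat C]
  {P Q : C.FullSubcategory} {ϖ : O} {ι I : Type u} [Fintype ι]
  {θ : P ⟶ Q} {f : ι → End P} {A : Type u} [Ring A] [Algebra O A]

namespace IsHead

variable (h : IsHead ϖ θ f)
include h

/-- The coordinates with respect to a family that lifts a basis of `Q`. -/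
theorem exists_coord (hf : IsGradedFree θ f) {x : I → P.obj.carrier}
    {χ : I → (Q.obj.carrier →ₗ[O] O ⧸ Ideal.span {ϖ})}
    (hx : IsResidueBasis ϖ (fun i => ev θ (x i)) χ) {n : ℕ} (φ : End P →ₐ[O] A)
    (hφ : ∀ r ∈ Ring.jacobson (End P) ^ n, φ r = 0) :
    ∃ c : P.obj.carrier →+ (I →₀ A), (∀ (r : End P) z, c (ev r z) = φ r • c z) ∧
      ∀ i, c (x i) = Finsupp.single i 1 := by
  classical
  let σ : (I →₀ End P) →+ P.obj.carrier := Finsupp.liftAddHom fun i =>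
    { toFun := fun r => ev r (x i), map_zero' := rfl, map_add' := fun _ _ => rfl }
  let Φ : (I →₀ End P) →+ (I →₀ A) := Finsupp.mapRange.addMonoidHom φ.toAddMonoidHom
  -- Modulo `Pₙ`, the element `∑ d i x i` determines the `d i` modulo `𝔪ⁿ`, and `φ` kills `𝔪ⁿ`. So
  -- applying `φ` to the coefficients is well defined.
  have hΦ : ∀ d, σ d ∈ (filt f n).toSubmodule → Φ d = 0 := fun d hd => by
    ext i
    by_cases hi : i ∈ d.support
    · exact hφ _ (h.mem_pow_of_sum_mem hf hx d.support d n hd i hi)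
    · change φ (d i) = 0
      rw [Finsupp.notMem_support_iff.1 hi, map_zero]
  have huniq : ∀ z d d', z - σ d ∈ (filt f n).toSubmodule → z - σ d' ∈ (filt f n).toSubmodule →
      Φ d = Φ d' := fun z d d' hd hd' => by
    rw [← sub_eq_zero, ← map_sub]
    refine hΦ _ ?_
    rw [map_sub]
    have := sub_mem hd' hd
    rwa [sub_sub_sub_cancel_left] at this
  have hex : ∀ z, ∃ d, z - σ d ∈ (filt f n).toSubmodule := h.exists_sub_mem_filt hx n
  choose d hd using hex
  refine ⟨⟨⟨fun z => Φ (d z), ?_⟩, fun z z' => ?_⟩, fun r z => ?_, fun i => ?_⟩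
  · exact (huniq 0 _ 0 (hd 0) (by simp)).trans (map_zero Φ)
  · refine (huniq _ _ (d z + d z') (hd _) ?_).trans (map_add Φ _ _)
    rw [map_add, add_sub_add_comm]
    exact add_mem (hd z) (hd z')
  · refine (huniq _ _ ((d z).mapRange (r * ·) (mul_zero r)) (hd _) ?_).trans ?_
    · have : σ ((d z).mapRange (r * ·) (mul_zero r)) = ev r (σ (d z)) := by
        refine (Finsupp.sum_mapRange_index (h := fun i (r : End P) => ev r (x i))
          fun _ => rfl).trans ?_
        exact (ev_sum _ _ _).symm
      rw [this, ← ev_sub]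
      exact h.filt_stable n r (hd z)
    · ext i
      change φ (r * d z i) = φ r * φ (d z i)
      rw [map_mul]
  · refine (huniq _ _ (Finsupp.single i 1) (hd _) ?_).trans ?_
    · have : σ (Finsupp.single i 1) = x i := Finsupp.liftAddHom_apply_single _ _ _
      rw [this, sub_self]
      exact zero_mem _
    · ext j
      change φ (Finsupp.single i (1 : End P) j) = _
      rw [Finsupp.single_apply, Finsupp.single_apply]
      split_ifs
      · exact map_one φ
      · exact map_zero φ

/-- As `A` is finite, the closed subobject of relations is the image of a finite sum of
copies of `P`. -/
theorem exists_le_range [Finite A] {n : ℕ} (φ : End P →ₐ[O] A)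
    (hφ : ∀ r ∈ Ring.jacobson (End P) ^ n, φ r = 0) :
    ∃ (T : Type u) (_ : Fintype T) (F : T → (P.obj ⟶ pi fun _ : A => P.obj)),
      (∀ l y, app (F l) y ∈ (CMod.taut P).relations φ) ∧
      ∀ z ∈ (closedSpan ((CMod.taut P).relations φ) ((CMod.taut P).relations_smul φ)).toSubmodule,
        ∃ y : T → P.obj.carrier, z = ∑ l, app (F l) (y l) := by
  have := Fintype.ofFinite A
  have := h.projective
  obtain ⟨J, _, e, he, hgen⟩ := h.exists_generators n
  have hquot : Finite (End P ⧸ Ring.jacobson (End P) ^ n) := by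
    rcases n with _ | n
    · rw [Submodule.pow_zero, Ideal.one_eq_top]
      infer_instance
    · exact (h.isProArtAlgebra.quotients (n + 1) n.succ_pos).finite
  obtain ⟨T, hT, hrep⟩ := exists_finite_representatives (Ring.jacobson (End P) ^ n)
  have := hT.fintype
  let sg : A → (P ⟶ pow A P) := fun a => ObjectProperty.homMk ((CMod.taut P).single a)
  let t : T ⊕ J → End P := Sum.elim (fun r => r.1) e
  -- Finitely many relations suffice: additivity for pairs in `A`, and `φ`-linearity for
  -- representatives of `E / 𝔪ⁿ` and for generators `e j` of `Pₙ`.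
  let F : (A × A) ⊕ (A × (T ⊕ J)) → (P ⟶ pow A P) := Sum.elim
    (fun p => sg (p.1 + p.2) - sg p.1 - sg p.2)
    (fun p => sg (p.1 * φ (t p.2)) - (t p.2 : P ⟶ P) ≫ sg p.1)
  let N := range (sumMap F).hom
  let N' : Sub (pi fun _ : A => (CMod.taut P).obj.obj) := N
  have hN : ∀ k x, ev (F k) x ∈ N.toSubmodule := fun k x => by
    refine ⟨ev (powInc P k) x, ?_⟩
    exact ev_congr (powInc_sumMap F k) x
  have h1 : ∀ a b x, ev (sg (a + b)) x - ev (sg a) x - ev (sg b) x ∈ N.toSubmodule :=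
    fun a b x => by
      have := hN (Sum.inl (a, b)) x
      change ev (sg (a + b) - sg a - sg b) x ∈ _ at this
      rwa [sub_ev, sub_ev] at this
  have h0 : ∀ x, ev (sg 0) x ∈ N.toSubmodule := fun x => by
    have := neg_mem (h1 0 0 x)
    rwa [add_zero, sub_self, zero_sub, neg_neg] at this
  have h2 : ∀ a l x, ev (sg (a * φ (t l))) x - ev (sg a) (ev (t l) x) ∈ N.toSubmodule :=
    fun a l x => by
      have := hN (Sum.inr (a, l)) x
      change ev (sg (a * φ (t l)) - (t l : P ⟶ P) ≫ sg a) x ∈ _ at this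
      rwa [sub_ev] at this
  refine ⟨_, inferInstance, fun k => (F k).hom, fun k y => ?_, fun z hz => ?_⟩
  · rcases k with ⟨a, b⟩ | ⟨a, l⟩
    · refine Or.inl ⟨a, b, y, ?_⟩
      change ev (sg (a + b) - sg a - sg b) y = _
      rw [sub_ev, sub_ev]
      rfl
    · refine Or.inr ⟨a, t l, y, ?_⟩
      change ev (sg (a * φ (t l)) - (t l : P ⟶ P) ≫ sg a) y = _
      rw [sub_ev]
      rfl
  · have hle : Submodule.span O ((CMod.taut P).relations φ) ≤ N'.toSubmodule := by
      refine Submodule.span_le.2 ?_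
      rintro _ (⟨a, b, x, rfl⟩ | ⟨a, r, x, rfl⟩)
      · exact h1 a b x
      · change ev (sg (a * φ r)) x - ev (sg a) (ev r x) ∈ N.toSubmodule
        obtain ⟨s, hs, hrs⟩ := hrep r
        obtain ⟨g, hg⟩ : ∃ g : J → End P, r - s = ∑ j, (g j : P ⟶ P) ≫ (e j : P ⟶ P) :=
          exists_comb (fun j => (e j : P ⟶ P)) (r - s : P ⟶ P)
            fun x => hgen _ ((h.mem_jacobson_pow_iff _ _).1 hrs x)
        have hφr : φ r = φ s := by
          rw [← sub_eq_zero, ← map_sub]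
          exact hφ _ hrs
        have hrx : ev r x = ev s x + ∑ j, ev (e j) (ev (g j) x) := by
          rw [← sub_eq_iff_eq_add']
          exact (ev_congr hg x).trans (sum_ev Finset.univ
            (fun j => (g j : P ⟶ P) ≫ (e j : P ⟶ P)) x)
        -- With `r = s + ∑ e j * g j`, the relation for `r` at `x` is the one for `s` at `x`
        -- together with those for `e j` at `g j x`, since `φ (e j) = 0`.
        have key : ev (sg (a * φ r)) x - ev (sg a) (ev r x) =
            (ev (sg (a * φ s)) x - ev (sg a) (ev s x)) +
            ∑ j, ((ev (sg (a * φ (e j))) (ev (g j) x) - ev (sg a) (ev (e j) (ev (g j) x))) -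
              ev (sg 0) (ev (g j) x)) := by
          have : ∀ j, a * φ (e j) = 0 := fun j => by rw [hφ _ (he j), mul_zero]
          simp only [this, hφr, hrx, ev_add, ev_sum, sub_sub_cancel_left, Finset.sum_neg_distrib]
          abel
        rw [key]
        exact add_mem (h2 a (Sum.inl ⟨s, hs⟩) x)
          (sum_mem fun j _ => sub_mem (h2 a (Sum.inr j) _) (h0 _))
    -- The image of a finite power of `P` is compact, hence closed, so it also contains the closure
    -- of the relations.
    obtain ⟨w, rfl⟩ := Submodule.topologicalClosure_minimal
      (M := (pi fun _ : A => (CMod.taut P).obj.obj).carrier) _ hle N'.isClosed hz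
    exact ⟨fun k => ev (powProj P k) w, ev_sumMap F w⟩

theorem linearIndependent_oneTmul [Finite A] (hf : IsGradedFree θ f) {x : I → P.obj.carrier}
    {χ : I → (Q.obj.carrier →ₗ[O] O ⧸ Ideal.span {ϖ})}
    (hx : IsResidueBasis ϖ (fun i => ev θ (x i)) χ) {n : ℕ} (φ : End P →ₐ[O] A)
    (hφ : ∀ r ∈ Ring.jacobson (End P) ^ n, φ r = 0) :
    LinearIndependent A fun i => (CMod.taut P).oneTmul φ (x i) := by
  obtain ⟨c, hcr, hcx⟩ := h.exists_coord hf hx φ hφ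
  obtain ⟨T, _, F, hF, hFz⟩ := h.exists_le_range φ hφ
  exact (CMod.taut P).linearIndependent_oneTmul φ c hcr hcx F hF hFz

theorem span_oneTmul_eq_top [Finite A] {x : I → P.obj.carrier}
    {χ : I → (Q.obj.carrier →ₗ[O] O ⧸ Ideal.span {ϖ})}
    (hx : IsResidueBasis ϖ (fun i => ev θ (x i)) χ) {n : ℕ} (φ : End P →ₐ[O] A)
    (hφ : ∀ r ∈ Ring.jacobson (End P) ^ n, φ r = 0) :
    Submodule.span A (Set.range fun i => (CMod.taut P).oneTmul φ (x i)) = ⊤ := by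
  refine (CMod.taut P).span_oneTmul_of_forall φ x fun (z : P.obj.carrier) => ?_
  obtain ⟨c, hc⟩ := h.exists_sub_mem_filt hx n z
  refine ⟨c, fun a => ?_⟩
  obtain ⟨J, _, e, he, hgen⟩ := h.exists_generators n
  obtain ⟨y, hy⟩ := hgen _ hc
  have h1 : ev ((CMod.taut P).tmul φ a) ((z : P.obj.carrier) - c.sum fun i r => ev r (x i) : P.obj.carrier) = 0 := by
    rw [hy]
    refine (ev_sum ((CMod.taut P).tmul φ a) _ _).trans ?_
    refine Finset.sum_eq_zero fun j _ => ?_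
    refine ((CMod.taut P).tmul_ρ φ a (e j) (y j)).trans ?_
    rw [hφ _ (he j), mul_zero, CMod.tmul_zero']
    rfl
  exact sub_eq_zero.1 ((ev_sub ((CMod.taut P).tmul φ a) _ _).symm.trans h1)

/-- The module is free: if the `θ(x i)` are a basis of `Q`, then the `1 ⊗ x i` are a basis over `A`.
-/
theorem isFlatModule_baseChange [Finite A] (hf : IsGradedFree θ f) {n : ℕ} (φ : End P →ₐ[O] A)
    (hφ : ∀ r ∈ Ring.jacobson (End P) ^ n, φ r = 0) :
    IsFlatModule A ((CMod.taut P).baseChange φ).Carrier := by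
  obtain ⟨I, x, χ, hx⟩ := h.exists_residueBasis
  exact isFlatModule_of_basis (Module.Basis.mk (h.linearIndependent_oneTmul hf hx φ hφ)
    (h.span_oneTmul_eq_top hx φ hφ).ge)

end IsHead
end Free

/-! ### The reduction `k ⊗ M` as `M / 𝔪_A M`. -/

section Reduction

variable {O G : Type u} [CommRing O] [Group G] [TopologicalSpace G]
  {C : ObjectProperty (ProAug O G)} [IsDualCat C] {ϖ : O} {Q : C.FullSubcategory}

omit [IsDualCat C] in
theorem smul_hom_eq_smul_hom (hQ : ∀ x : Q.obj.carrier, ϖ • x = 0) {X : C.FullSubcategory}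
    (π : X ⟶ Q) {c d : O} (h : c - d ∈ Ideal.span {ϖ}) : c • π = d • π := by
  obtain ⟨b, hb⟩ := Ideal.mem_span_singleton'.1 h
  refine full_ext fun x => ?_
  rw [smul_ev, smul_ev, ← sub_eq_zero, ← sub_smul, ← hb, mul_smul, hQ, smul_zero]

theorem IsLocalOver.sub_mem_span {A : Type u} [Ring A] [Algebra O A] (hA : IsLocalOver ϖ A)
    {a : A} {c d : O} (hc : a - algebraMap O A c ∈ Ring.jacobson A)
    (hd : a - algebraMap O A d ∈ Ring.jacobson A) : c - d ∈ Ideal.span {ϖ} := by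
  rw [← hA.scalar_mem_iff, map_sub]
  have := sub_mem hd hc
  rwa [sub_sub_sub_cancel_left] at this

namespace CMod

omit [IsDualCat C] in
theorem ρ_comp_of_sub_mem {R : Type u} [Ring R] [Algebra O R] (M : CMod C R) (π : M.obj ⟶ Q)
    (hπ : ∀ r ∈ Ring.jacobson R, M.ρ r ≫ π = 0) {r : R} {c : O}
    (hr : r - algebraMap O R c ∈ Ring.jacobson R) : M.ρ r ≫ π = c • π := by
  have h1 := hπ _ hr
  rw [map_sub, AlgHom.commutes] at h1
  refine full_ext fun x => ?_
  have h2 : ev π (ev (M.ρ r) x - ev (algebraMap O (End M.obj) c) x) = 0 :=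
    (congrArg (ev π) (sub_ev _ _ _).symm).trans (ev_congr h1 x)
  rw [algebraMap_ev, ev_sub, ev_smul] at h2
  exact sub_eq_zero.1 h2

/-- A morphism to an object killed by `ϖ` that kills the radical action extends to the completed
tensor product. -/
theorem exists_residue_desc {R A : Type u} [Ring R] [Algebra O R] [Ring A] [Algebra O A]
    [Finite A] (hR : IsLocalOver ϖ R) (hA : IsLocalOver ϖ A) (φ : R →ₐ[O] A)
    (hφ : ∀ x ∈ Ring.jacobson R, φ x ∈ Ring.jacobson A)
    (hQ : ∀ x : Q.obj.carrier, ϖ • x = 0) (M : CMod C R) (π : M.obj ⟶ Q)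
    (hπ : ∀ r ∈ Ring.jacobson R, M.ρ r ≫ π = 0) :
    ∃ σ : M.tensorObj φ ⟶ Q, ∀ a c, a - algebraMap O A c ∈ Ring.jacobson A →
      M.tmul φ a ≫ σ = c • π := by
  choose s hs using hA.exists_scalar
  have hs' : ∀ a c, a - algebraMap O A c ∈ Ring.jacobson A → s a • π = c • π := fun a c hc =>
    smul_hom_eq_smul_hom hQ π (hA.sub_mem_span (hs a) hc)
  refine ⟨M.desc (fun a => s a • π) (fun a b => ?_) (fun a r => ?_), fun a c hc => ?_⟩
  · rw [← add_smul]
    refine hs' _ _ ?_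
    rw [map_add, add_sub_add_comm]
    exact add_mem (hs a) (hs b)
  · obtain ⟨d, hd⟩ := hR.exists_scalar r
    rw [Linear.comp_smul, M.ρ_comp_of_sub_mem π hπ hd, ← mul_smul]
    refine hs' _ _ ?_
    have h1 := hφ _ hd
    rw [map_sub, AlgHom.commutes] at h1
    have h2 : a * φ r - algebraMap O A (s a * d) =
        a * (φ r - algebraMap O A d) + algebraMap O A d * (a - algebraMap O A (s a)) := by
      rw [mul_sub, mul_sub, map_mul, ← Algebra.commutes d a, Algebra.commutes d (algebraMap O A _)]
      abel
    rw [h2]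
    exact add_mem (Ideal.mul_mem_left _ _ h1) (Ideal.mul_mem_left _ _ (hs a))
  · rw [tmul_desc]
    exact hs' a c hc

variable {A : ArtAlg ϖ} (M : CMod C A.carrier)

open Classical in
/-- The subobject `𝔪_A M`. -/
def radSub : Sub M.obj.obj :=
  letI := Fintype.ofFinite {a : A.carrier // a ∈ Ring.jacobson A.carrier}
  range (sumMap fun a : {a : A.carrier // a ∈ Ring.jacobson A.carrier} =>
    (M.ρ a.1 : M.obj ⟶ M.obj)).hom

theorem mem_radSub_iff [hfin : Fintype {a : A.carrier // a ∈ Ring.jacobson A.carrier}]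
    (x : M.obj.obj.carrier) : x ∈ M.radSub.toSubmodule ↔
      ∃ y : {a : A.carrier // a ∈ Ring.jacobson A.carrier} → M.obj.obj.carrier,
        x = ∑ a, ev (M.ρ a.1) (y a) := by
  rw [Subsingleton.elim hfin (Fintype.ofFinite _)]
  let _ := Fintype.ofFinite {a : A.carrier // a ∈ Ring.jacobson A.carrier}
  constructor
  · rintro ⟨w, rfl⟩
    exact ⟨fun a => ev (powProj M.obj a) w, ev_sumMap _ w⟩
  · rintro ⟨y, rfl⟩
    obtain ⟨w, hw⟩ := exists_pow_eq y
    refine ⟨w, (ev_sumMap _ w).trans ?_⟩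
    simp only [hw]

theorem ρ_mem_radSub {a : A.carrier} (ha : a ∈ Ring.jacobson A.carrier)
    (x : M.obj.obj.carrier) : ev (M.ρ a) x ∈ M.radSub.toSubmodule := by
  let _ := Fintype.ofFinite {a : A.carrier // a ∈ Ring.jacobson A.carrier}
  exact ⟨ev (powInc M.obj ⟨a, ha⟩) x, ev_congr (powInc_sumMap _ _) x⟩

theorem mem_jacobson_smul_iff (x : M.Carrier) :
    x ∈ Ring.jacobson A.carrier • (⊤ : Submodule A.carrier M.Carrier) ↔
      (x : M.obj.obj.carrier) ∈ M.radSub.toSubmodule := by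
  have := Fintype.ofFinite {a : A.carrier // a ∈ Ring.jacobson A.carrier}
  constructor
  · intro hx
    refine Submodule.smul_induction_on hx (fun a ha z _ => M.ρ_mem_radSub ha z)
      fun u v hu hv => add_mem hu hv
  · intro hx
    obtain ⟨y, hy⟩ := (M.mem_radSub_iff x).1 hx
    rw [hy]
    exact Submodule.sum_mem (M := M.Carrier) _ fun a _ =>
      Submodule.smul_mem_smul (M := M.Carrier) (n := y a) a.2 trivial

theorem tmul_mk (a : A.carrier) (x : M.obj.obj.carrier) :
    ev (M.tmul (Ideal.Quotient.mkₐ O (Ring.jacobson A.carrier)) (Ideal.Quotient.mk _ a)) x =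
      ev M.toReduction (ev (M.ρ a) x) := by
  refine Eq.symm ((M.tmul_ρ _ 1 a x).trans ?_)
  rw [one_mul]
  rfl

theorem toReduction_ρ {a : A.carrier} (ha : a ∈ Ring.jacobson A.carrier) :
    M.ρ a ≫ M.toReduction = 0 := full_ext fun x => by
  rw [ev_comp, ← tmul_mk, Ideal.Quotient.eq_zero_iff_mem.2 ha]
  exact ev_congr (M.tmul_zero' _) x

theorem toReduction_surjective : Function.Surjective (ev M.toReduction) := by
  have := Fintype.ofFinite (A.carrier ⧸ Ring.jacobson A.carrier)
  intro z
  obtain ⟨w, rfl⟩ := M.exists_eq_sum_tmul _ z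
  choose s hs using Ideal.Quotient.mk_surjective (I := Ring.jacobson A.carrier)
  refine ⟨∑ a, ev (M.ρ (s a)) (w a), ?_⟩
  rw [ev_sum]
  refine Finset.sum_congr rfl fun a _ => ?_
  rw [← tmul_mk, hs]

theorem map_eq_zero_of_mem {X : C.FullSubcategory} (π : M.obj ⟶ X)
    (hπ : ∀ a ∈ Ring.jacobson A.carrier, M.ρ a ≫ π = 0) {x : M.obj.obj.carrier}
    (hx : x ∈ M.radSub.toSubmodule) : ev π x = 0 := by
  have := Fintype.ofFinite {a : A.carrier // a ∈ Ring.jacobson A.carrier}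
  obtain ⟨y, rfl⟩ := (M.mem_radSub_iff x).1 hx
  rw [ev_sum]
  exact Finset.sum_eq_zero fun a _ => ev_congr (hπ a.1 a.2) (y a)

/-- Conversely to `toReduction_ρ`, the projection of `M` to `M / 𝔪_A M` factors through `k ⊗ M`, so
the kernel is no larger than `𝔪_A M`. -/
theorem toReduction_eq_zero_iff (x : M.obj.obj.carrier) : ev M.toReduction x = 0 ↔
    x ∈ M.radSub.toSubmodule := by
  refine ⟨fun hx => ?_, M.map_eq_zero_of_mem _ fun a => M.toReduction_ρ⟩
  let N := M.radSub
  have hN : ∀ a b, a - b ∈ Ring.jacobson A.carrier →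
      M.ρ a ≫ quotProj N = M.ρ b ≫ quotProj N := fun a b hab => full_ext fun x => by
    rw [ev_comp, ev_comp, ← sub_eq_zero, ← ev_sub, quotProj_eq_zero]
    have := M.ρ_mem_radSub hab x
    rw [map_sub] at this
    exact (sub_ev (M.ρ a : M.obj ⟶ M.obj) (M.ρ b) x).symm ▸ this
  choose s hs using Ideal.Quotient.mk_surjective (I := Ring.jacobson A.carrier)
  have hs' : ∀ a b, Ideal.Quotient.mk _ b = a → s a - b ∈ Ring.jacobson A.carrier :=
    fun a b hb => Ideal.Quotient.eq.1 ((hs a).trans hb.symm)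
  -- The map is `a ⊗ x ↦ s(a) x`; the choice of the lift `s(a)` of `a` is irrelevant modulo `𝔪_A M`.
  obtain ⟨δ, hδ'⟩ : ∃ δ : M.reduction.obj ⟶ quotObj N,
      M.toReduction ≫ δ = M.ρ (s 1) ≫ quotProj N := by
    refine ⟨M.desc (fun a => M.ρ (s a) ≫ quotProj N) (fun a b => ?_) (fun a r => ?_),
      M.tmul_desc _ _ _ 1⟩
    · rw [← Preadditive.add_comp]
      refine (hN _ (s a + s b) (hs' _ _ ?_)).trans ?_
      · rw [map_add, hs, hs]
      · rw [map_add]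
    · refine (hN _ (s a * r) (hs' _ _ ?_)).trans ?_
      · rw [map_mul, hs]
        rfl
      · rw [map_mul, End.mul_def, Category.assoc]
  have hδ : ev δ (ev M.toReduction x) = ev (quotProj N) x := by
    refine (ev_congr hδ' x).trans ?_
    refine (ev_congr (hN _ 1 (hs' _ _ (map_one _))) x).trans ?_
    rw [map_one]
    rfl
  rw [hx, ev_zero] at hδ
  exact (quotProj_eq_zero N x).1 hδ.symm

theorem exists_reduction_iso (hQ : ∀ x : Q.obj.carrier, ϖ • x = 0) (π : M.obj ⟶ Q)
    (hπ : Function.Surjective (ev π)) (hker : ∀ x, ev π x = 0 ↔ x ∈ M.radSub.toSubmodule) :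
    ∃ α : M.reduction.obj ≅ Q, M.toReduction ≫ α.hom = π := by
  have hA := (isArtAlgebra_iff.1 A.isArtAlgebra).2
  have := hA.isLocalRing
  obtain ⟨σ, hσ⟩ : ∃ σ : M.reduction.obj ⟶ Q, M.toReduction ≫ σ = π := by
    obtain ⟨σ, hσ⟩ := exists_residue_desc hA (hA.quotient le_rfl)
      (Ideal.Quotient.mkₐ O (Ring.jacobson A.carrier))
      (fun x hx => by
        have : Ideal.Quotient.mkₐ O (Ring.jacobson A.carrier) x = 0 :=
          Ideal.Quotient.eq_zero_iff_mem.2 hx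
        rw [this]
        exact zero_mem _) hQ M π
      fun a ha => full_ext fun x => (hker _).2 (M.ρ_mem_radSub ha x)
    refine ⟨σ, (hσ 1 1 ?_).trans (one_smul _ _)⟩
    rw [map_one, sub_self]
    exact zero_mem _
  have hiso : IsIso σ := by
    refine isIso_of_bijective σ ⟨(injective_iff_map_eq_zero σ.hom.1).2 fun z hz => ?_,
      fun y => ?_⟩
    · obtain ⟨x, rfl⟩ := M.toReduction_surjective z
      exact (M.toReduction_eq_zero_iff x).2 ((hker x).1 ((ev_congr hσ x).symm.trans hz))
    · obtain ⟨x, rfl⟩ := hπ y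
      exact ⟨ev M.toReduction x, ev_congr hσ x⟩
  exact ⟨asIso σ, hσ⟩

/-- The kernel of the residue map of a module generated by the `τ a = a • τ 1`. -/
theorem eq_zero_iff_mem_radSub [Fintype A.carrier] {X : C.FullSubcategory}
    (τ : A.carrier → (X ⟶ M.obj)) (hact : ∀ a x, ev (M.ρ a) (ev (τ 1) x) = ev (τ a) x)
    (hsum : ∀ z, ∃ w : A.carrier → X.obj.carrier, z = ∑ a, ev (τ a) (w a)) {σ : M.obj ⟶ Q}
    {π : X ⟶ Q} (hσ : ∀ a c, a - algebraMap O A.carrier c ∈ Ring.jacobson A.carrier →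
      τ a ≫ σ = c • π)
    (hker : ∀ x, ev π x = 0 → ev (τ 1) x ∈ M.radSub.toSubmodule) (z : M.obj.obj.carrier) :
    ev σ z = 0 ↔ z ∈ M.radSub.toSubmodule := by
  have hA := (isArtAlgebra_iff.1 A.isArtAlgebra).2
  choose s hs using hA.exists_scalar
  obtain ⟨w, rfl⟩ := hsum z
  -- Each `a` is a scalar `s a` plus an element of `𝔪_A`, so modulo `𝔪_A M` every element is `τ 1`
  -- of a single element.
  have h1 : ∑ a, ev (τ a) (w a) = ev (τ 1) (∑ a, s a • w a) +
      ∑ a, ev (M.ρ (a - algebraMap O A.carrier (s a))) (ev (τ 1) (w a)) := by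
    rw [ev_sum, ← Finset.sum_add_distrib]
    refine Finset.sum_congr rfl fun a _ => ?_
    rw [map_sub, AlgHom.commutes, ev_smul]
    refine Eq.trans ?_ (congrArg _ (sub_ev _ _ _).symm)
    rw [algebraMap_ev, hact, add_sub_cancel]
  have h2 : ∑ a, ev (M.ρ (a - algebraMap O A.carrier (s a))) (ev (τ 1) (w a)) ∈
      M.radSub.toSubmodule := sum_mem fun a _ => M.ρ_mem_radSub (hs a) _
  have h3 : ev σ (∑ a, ev (τ a) (w a)) = ev π (∑ a, s a • w a) := by
    rw [ev_sum, ev_sum]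
    refine Finset.sum_congr rfl fun a _ => ?_
    rw [ev_smul]
    exact ev_congr (hσ a _ (hs a)) (w a)
  constructor
  · intro hz
    rw [h1]
    exact add_mem (hker _ (h3.symm.trans hz)) h2
  · refine M.map_eq_zero_of_mem σ fun a ha => full_ext fun z => ?_
    obtain ⟨w, rfl⟩ := hsum z
    rw [ev_comp, ev_sum, ev_sum]
    refine Finset.sum_eq_zero fun b _ => ?_
    have h4 : ev (M.ρ a) (ev (τ b) (w b)) = ev (τ (a * b)) (w b) := by
      rw [← hact, ← hact (a * b), map_mul]
      rfl
    rw [h4]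
    refine (ev_congr (hσ _ 0 ?_) (w b)).trans ?_
    · rw [map_zero, sub_zero]
      exact Ideal.mul_mem_right b _ ha
    · rw [zero_smul]
      rfl

end CMod

namespace Deformation

variable {A : ArtAlg ϖ} (D : Deformation Q A)

/-- The projection of a deformation as a linear map. -/
def projLin : D.M.Carrier →ₗ[O] Q.obj.carrier := D.proj.hom.1.toLinearMap

theorem isReductionMap : IsReductionMap A.carrier D.projLin where
  surjective := (bijective_of_isIso D.α.hom).2.comp D.M.toReduction_surjective
  ker x := by
    refine Iff.trans ?_ ((D.M.toReduction_eq_zero_iff x).trans (D.M.mem_jacobson_smul_iff x).symm)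
    change ev D.α.hom (ev D.M.toReduction x) = 0 ↔ _
    constructor
    · intro hx
      exact (bijective_of_isIso D.α.hom).1 (hx.trans (ev_zero _).symm)
    · intro hx
      rw [hx, ev_zero]

theorem ρ_proj {a : A.carrier} {c : O} (h : a - algebraMap O A.carrier c ∈
    Ring.jacobson A.carrier) : D.M.ρ a ≫ D.proj = c • D.proj :=
  D.M.ρ_comp_of_sub_mem D.proj (fun r hr => by
    rw [proj, ← Category.assoc, D.M.toReduction_ρ hr, zero_comp]) h

end Deformation

/-! ### Base changes of `P` are deformations of `Q`. -/

section Universal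

variable {P : C.FullSubcategory} {ι : Type u} [Fintype ι] {θ : P ⟶ Q} {f : ι → End P}
  {A : ArtAlg ϖ}

namespace IsHead

variable (h : IsHead ϖ θ f)
include h

/-- The map is `a ⊗ x ↦ c • θ(x)`, where `c` is a scalar congruent to `a`. Its kernel is `𝔪_A (A ⊗
P)` because `ker θ = ∑ f i P` and `1 ⊗ f i y = φ (f i) ⊗ y` with `φ (f i) ∈ 𝔪_A`. -/
theorem exists_reductionMap (φ : End P →ₐ[O] A.carrier)
    (hφ : ∀ x ∈ Ring.jacobson (End P), φ x ∈ Ring.jacobson A.carrier) :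
    ∃ π : ((CMod.taut P).baseChange φ).obj ⟶ Q, (CMod.taut P).tmul φ 1 ≫ π = θ ∧
      Function.Surjective (ev π) ∧
      ∀ x, ev π x = 0 ↔ x ∈ ((CMod.taut P).baseChange φ).radSub.toSubmodule := by
  have hA := (isArtAlgebra_iff.1 A.isArtAlgebra).2
  have := Fintype.ofFinite A.carrier
  obtain ⟨σ, hσ⟩ := CMod.exists_residue_desc h.isLocalOver hA φ hφ h.smul_Q (CMod.taut P) θ
    fun r hr => (h.mem_jacobson_iff r).1 hr
  have hσ1 : (CMod.taut P).tmul φ 1 ≫ σ = θ := by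
    refine (hσ 1 1 ?_).trans (one_smul _ _)
    rw [map_one, sub_self]
    exact zero_mem _
  refine ⟨σ, hσ1, fun y => ?_, fun z => ?_⟩
  · obtain ⟨x, rfl⟩ := h.surjective y
    exact ⟨ev ((CMod.taut P).tmul φ 1) x, ev_congr hσ1 x⟩
  · refine CMod.eq_zero_iff_mem_radSub ((CMod.taut P).baseChange φ) (X := P)
      (fun a => (CMod.taut P).tmul φ a) ((CMod.taut P).act_tmul_one φ)
      ((CMod.taut P).exists_eq_sum_tmul φ) hσ (fun x hx => ?_) z
    obtain ⟨y, rfl⟩ := h.gen x hx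
    have h1 : ∀ i, ev ((CMod.taut P).tmul φ 1) (ev (f i) (y i)) =
        ev (((CMod.taut P).baseChange φ).ρ (φ (f i)))
          (ev ((CMod.taut P).tmul φ 1) (y i)) := fun i => by
      refine ((CMod.taut P).tmul_ρ φ 1 (f i) (y i)).trans ?_
      exact (congrArg (fun a => ev ((CMod.taut P).tmul φ a) (y i)) (one_mul (φ (f i)))).trans
        ((CMod.taut P).act_tmul_one φ (φ (f i)) (y i)).symm
    have h2 : ev ((CMod.taut P).tmul φ 1) (∑ i, ev (f i) (y i)) =
        ∑ i, ev (((CMod.taut P).baseChange φ).ρ (φ (f i)))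
          (ev ((CMod.taut P).tmul φ 1) (y i)) :=
      (ev_sum ((CMod.taut P).tmul φ 1) _ _).trans (Finset.sum_congr rfl fun i _ => h1 i)
    exact h2.symm ▸ sum_mem fun i _ => CMod.ρ_mem_radSub _ (hφ _ (h.f_mem i)) _

/-- As `𝔪_A` is nilpotent, the local homomorphism `φ` kills some `𝔪ⁿ`, and the freeness results
apply. -/
theorem exists_deformation (hf : IsGradedFree θ f) (φ : LocHom O (End P) A.carrier) :
    ∃ (_ : IsFlatModule A.carrier ((CMod.taut P).baseChange φ.1).Carrier)
      (α : ((CMod.taut P).baseChange φ.1).reduction.obj ≅ Q),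
      (CMod.taut P).tmul φ.1 1 ≫ ((CMod.taut P).baseChange φ.1).toReduction ≫ α.hom = θ := by
  obtain ⟨n, hn⟩ := A.isArtAlgebra.exists_jacobson_pow_eq_bot
  obtain ⟨π, hπ, hsurj, hker⟩ := h.exists_reductionMap φ.1 φ.2
  obtain ⟨α, hα⟩ := CMod.exists_reduction_iso _ h.smul_Q π hsurj hker
  refine ⟨h.isFlatModule_baseChange hf (n := n) φ.1 fun r hr => ?_, α, ?_⟩
  · have := φ.map_jacobson_pow n hr
    rwa [hn] at this
  · exact (congrArg ((CMod.taut P).tmul φ.1 1 ≫ ·) hα).trans hπ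

end IsHead
end Universal
end Reduction

/-! ### `Hom(P, M)` is free of rank one over `A`, and universality follows. -/

section Representability

variable {O G : Type u} [CommRing O] [Group G] [TopologicalSpace G]
  {C : ObjectProperty (ProAug O G)} [IsDualCat C] {ϖ : O} {P Q : C.FullSubcategory}

/-- The action of `A` on the morphisms from `X` to an object with an `A`-action. -/
@[reducible] def homModule {A : Type u} [Ring A] [Algebra O A] (X : C.FullSubcategory)
    (M : CMod C A) : Module A (X ⟶ M.obj) where
  smul a g := g ≫ M.ρ a
  one_smul g := by
    change g ≫ M.ρ 1 = g
    rw [map_one]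
    exact Category.comp_id _
  mul_smul a b g := by
    change g ≫ M.ρ (a * b) = (g ≫ M.ρ b) ≫ M.ρ a
    rw [map_mul, End.mul_def, Category.assoc]
  smul_zero a := zero_comp
  smul_add a g g' := Preadditive.add_comp _ _ _ _ _ _
  add_smul a b g := by
    change g ≫ M.ρ (a + b) = g ≫ M.ρ a + g ≫ M.ρ b
    rw [map_add]
    exact Preadditive.comp_add _ _ _ _ _ _
  zero_smul g := by
    change g ≫ M.ρ 0 = 0
    rw [map_zero]
    exact comp_zero

/-- An element of an object with an `A`-action, as an element of the underlying `A`-module. -/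
def CMod.elem {A : Type u} [Ring A] [Algebra O A] (M : CMod C A) (x : M.obj.obj.carrier) :
    M.Carrier := x

omit [IsDualCat C] in
theorem isIso_of_linearIndependent {A I : Type u} [Ring A] [Algebra O A] {M N : CMod C A}
    (g : M.obj ⟶ N.obj) (hg : ∀ a, M.ρ a ≫ g = g ≫ N.ρ a) (v : I → M.Carrier)
    (hv : Submodule.span A (Set.range v) = ⊤)
    (h1 : LinearIndependent A fun i => N.elem (ev g (v i)))
    (h2 : Submodule.span A (Set.range fun i => N.elem (ev g (v i))) = ⊤) : IsIso g := by
  let g' : M.Carrier →ₗ[A] N.Carrier :=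
    { toFun := ev g
      map_add' := fun x y => ev_add g x y
      map_smul' := fun a x => ev_congr (hg a) x }
  exact isIso_of_bijective g (bijective_of_span_of_linearIndependent g' v hv h1 h2)

variable {ι : Type u} [Fintype ι] {θ : P ⟶ Q} {f : ι → End P} {A B : ArtAlg ϖ}

/-- The deformation `D` is represented by `φ`: there is a `φ`-semilinear lift of `θ` to `D`. -/
def IsRep (θ : P ⟶ Q) (φ : LocHom O (End P) A.carrier) (D : Deformation Q A) : Prop :=
  ∃ t : P ⟶ D.M.obj, t ≫ D.proj = θ ∧ ∀ r : End P, (r : P ⟶ P) ≫ t = t ≫ D.M.ρ (φ.1 r)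

namespace IsHead

variable (h : IsHead ϖ θ f) {D : Deformation Q A} {t : P ⟶ D.M.obj} (ht : t ≫ D.proj = θ)
include h

theorem exists_lift (D : Deformation Q A) : ∃ t : P ⟶ D.M.obj, t ≫ D.proj = θ := by
  have := h.projective
  have : Epi D.proj := epi_of_ev_surjective _ D.isReductionMap.surjective
  exact ⟨Projective.factorThru θ D.proj, Projective.factorThru_comp _ _⟩

include ht

theorem exists_basis : ∃ (I : Type u) (x : I → P.obj.carrier), Nonempty I ∧
    LinearIndependent A.carrier (fun i => D.M.elem (ev t (x i))) ∧
    Submodule.span A.carrier (Set.range fun i => D.M.elem (ev t (x i))) = ⊤ := by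
  obtain ⟨I, x, χ, hx⟩ := h.exists_residueBasis
  have hy : IsResidueBasis ϖ (fun i => D.projLin (D.M.elem (ev t (x i)))) χ := by
    have : (fun i => D.projLin (D.M.elem (ev t (x i)))) = fun i => ev θ (x i) :=
      funext fun i => ev_congr ht (x i)
    rw [this]
    exact hx
  exact ⟨I, x, hx.nonempty h.exists_ne,
    D.isReductionMap.linearIndependent hy A.isArtAlgebra D.flat,
    D.isReductionMap.span_eq_top hy A.isArtAlgebra⟩

/-- The `t (x i)` are part of a basis of the deformation, and there is at least one of them since `Q
≠ 0`. -/
theorem comp_ρ_injective {a b : A.carrier} (hab : t ≫ D.M.ρ a = t ≫ D.M.ρ b) : a = b := by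
  obtain ⟨I, x, ⟨i⟩, hli, -⟩ := h.exists_basis ht
  rw [← sub_eq_zero]
  refine linearIndependent_iff'.1 hli {i} (fun _ => a - b) ?_ i (Finset.mem_singleton_self i)
  rw [Finset.sum_singleton, sub_smul, sub_eq_zero]
  exact ev_congr hab (x i)

/-- Nakayama's lemma for the `A`-module `Hom(P, M)`. Modulo maps with values in `𝔪_A M`, every `g`
is a scalar multiple of `t`, and by projectivity such maps lie in `𝔪_A Hom(P, M)`. -/
theorem exists_eq_comp_ρ (g : P ⟶ D.M.obj) : ∃ a : A.carrier, g = t ≫ D.M.ρ a := by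
  have := h.projective
  have hfin := Fintype.ofFinite {a : A.carrier // a ∈ Ring.jacobson A.carrier}
  let _ := homModule P D.M
  obtain ⟨n, hn⟩ := A.isArtAlgebra.exists_jacobson_pow_eq_bot
  have key : Submodule.span A.carrier {t} = ⊤ := by
    refine eq_top_of_forall_sub_mem_smul hn _ fun g => ?_
    obtain ⟨c, hc⟩ := h.hom_eq (g ≫ D.proj)
    refine ⟨algebraMap O A.carrier c • t,
      Submodule.smul_mem _ _ (Submodule.mem_span_singleton_self t), ?_⟩
    have h1 : ∀ x, ev (g - t ≫ D.M.ρ (algebraMap O A.carrier c)) x ∈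
        D.M.radSub.toSubmodule := fun x => by
      have h2 : (g - t ≫ D.M.ρ (algebraMap O A.carrier c)) ≫ D.proj = 0 := by
        rw [Preadditive.sub_comp, Category.assoc, D.ρ_proj (c := c) (by
          rw [sub_self]; exact zero_mem _), Linear.comp_smul, ht, hc, sub_self]
      exact (D.M.mem_jacobson_smul_iff _).1 ((D.isReductionMap.ker _).1 (ev_congr h2 x))
    obtain ⟨e, he⟩ := exists_comb
      (fun a : {a : A.carrier // a ∈ Ring.jacobson A.carrier} => (D.M.ρ a.1 : D.M.obj ⟶ D.M.obj))
      _ fun x => (D.M.mem_radSub_iff _).1 (h1 x)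
    have h3 : g - algebraMap O A.carrier c • t =
        ∑ a : {a : A.carrier // a ∈ Ring.jacobson A.carrier}, a.1 • e a := he
    rw [h3]
    exact sum_mem fun a _ => Submodule.smul_mem_smul a.2 trivial
  have hg : g ∈ Submodule.span A.carrier {t} := by rw [key]; trivial
  obtain ⟨a, ha⟩ := Submodule.mem_span_singleton.1 hg
  exact ⟨a, ha.symm⟩

theorem mem_jacobson_of_comp_eq_zero {a : A.carrier} (ha : t ≫ D.M.ρ a ≫ D.proj = 0) :
    a ∈ Ring.jacobson A.carrier := by
  have hA := (isArtAlgebra_iff.1 A.isArtAlgebra).2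
  obtain ⟨c, hc⟩ := hA.exists_scalar a
  rw [D.ρ_proj hc, Linear.comp_smul, ht, h.smul_θ, ← hA.scalar_mem_iff] at ha
  rw [← sub_add_cancel a (algebraMap O A.carrier c)]
  exact add_mem hc ha

omit ht

/-- Precomposition with `r` moves `t` to a unique multiple `φ(r) • t` in the free module `Hom(P, M)`
of rank one. Uniqueness makes `φ` an algebra homomorphism. -/
theorem exists_isRep (D : Deformation Q A) : ∃ φ : LocHom O (End P) A.carrier, IsRep θ φ D := by
  obtain ⟨t, ht⟩ := h.exists_lift D
  choose φ hφ using fun r : End P => h.exists_eq_comp_ρ ht ((r : P ⟶ P) ≫ t)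
  have hu : ∀ r a, (r : P ⟶ P) ≫ t = t ≫ D.M.ρ a → φ r = a := fun r a ha =>
    h.comp_ρ_injective ht ((hφ r).symm.trans ha)
  let φ' : End P →ₐ[O] A.carrier :=
    { toFun := φ
      map_one' := hu _ _ (by
        rw [map_one]
        exact (Category.id_comp _).trans (Category.comp_id _).symm)
      map_mul' := fun r s => hu _ _ (by
        rw [map_mul, End.mul_def, End.mul_def, Category.assoc, hφ r, ← Category.assoc, hφ s,
          Category.assoc])
      map_zero' := hu _ _ (by
        rw [map_zero]
        exact zero_comp.trans comp_zero.symm)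
      map_add' := fun r s => hu _ _ (by
        rw [map_add]
        refine (Preadditive.add_comp _ _ _ _ _ _).trans ?_
        rw [hφ r, hφ s]
        exact (Preadditive.comp_add _ _ _ _ _ _).symm)
      commutes' := fun c => hu _ _ (by
        rw [AlgHom.commutes]
        refine full_ext fun x => ?_
        rw [ev_comp, ev_comp, algebraMap_ev, algebraMap_ev, ev_smul]) }
  refine ⟨⟨φ', fun r hr => h.mem_jacobson_of_comp_eq_zero ht ?_⟩, t, ht, hφ⟩
  change t ≫ D.M.ρ (φ r) ≫ D.proj = 0
  rw [← Category.assoc, ← hφ, Category.assoc, ht]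
  exact (h.mem_jacobson_iff r).1 hr

/-- Two lifts of `θ` differ by some `a ∈ 1 + 𝔪_A`, which is a unit and conjugates `φ` into `ψ`. -/
theorem conj_of_isRep {φ ψ : LocHom O (End P) A.carrier} (hφ : IsRep θ φ D)
    (hψ : IsRep θ ψ D) : (conjSetoid O (End P) A.carrier).r φ ψ := by
  obtain ⟨t, ht, htφ⟩ := hφ
  obtain ⟨t', ht', htψ⟩ := hψ
  have := A.isArtAlgebra.isLocalRing
  obtain ⟨a, rfl⟩ := h.exists_eq_comp_ρ ht t'
  have ha : a - 1 ∈ Ring.jacobson A.carrier := by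
    refine h.mem_jacobson_of_comp_eq_zero ht ?_
    let ρ : A.carrier → (D.M.obj ⟶ D.M.obj) := fun a => D.M.ρ a
    have h1 : ρ (a - 1) = ρ a - 𝟙 D.M.obj := by
      refine (map_sub D.M.ρ a 1).trans ?_
      rw [map_one]
      rfl
    change t ≫ ρ (a - 1) ≫ D.proj = 0
    rw [h1, Preadditive.sub_comp, Preadditive.comp_sub, ← Category.assoc, ht', Category.id_comp,
      ht, sub_self]
  have hunit : IsUnit a := by
    have := isUnit_one_add_of_mem_jacobson ha
    rwa [add_sub_cancel] at this
  obtain ⟨u, rfl⟩ := hunit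
  refine ⟨u, fun r => ?_⟩
  have h1 : ψ.1 r * u = u * φ.1 r := by
    refine h.comp_ρ_injective ht ?_
    rw [map_mul, map_mul, End.mul_def, End.mul_def, ← Category.assoc, ← Category.assoc, ← htψ,
      ← htφ, Category.assoc]
  rw [← h1, mul_assoc, Units.mul_inv, mul_one]

/-- Acting by `u` on `t` gives the right semilinearity, but a lift of `c • θ` with `c` the residue
of `u`. Rescaling by an inverse `d` of `c` modulo `ϖ` repairs this without changing the conjugation.
-/
theorem isRep_of_conj {φ ψ : LocHom O (End P) A.carrier}
    (hc : (conjSetoid O (End P) A.carrier).r φ ψ) (hφ : IsRep θ φ D) : IsRep θ ψ D := by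
  obtain ⟨u, hu⟩ := hc
  obtain ⟨t, ht, htφ⟩ := hφ
  have hA := (isArtAlgebra_iff.1 A.isArtAlgebra).2
  have := hA.isLocalRing
  obtain ⟨c, hc⟩ := hA.exists_scalar u
  have hcϖ : c ∉ Ideal.span {ϖ} := fun h0 => by
    have := add_mem hc ((hA.scalar_mem_iff c).2 h0)
    rw [sub_add_cancel, ProAug.mem_jacobson_iff] at this
    exact this u.isUnit
  obtain ⟨d, z, hz, hdz⟩ := h.maximal.exists_inv hcϖ
  refine ⟨t ≫ D.M.ρ (d • (u : A.carrier)), ?_, fun r => ?_⟩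
  · rw [Category.assoc, D.ρ_proj (c := d * c), Linear.comp_smul, ht]
    · have : (1 : O) • θ = (d * c) • θ := smul_hom_eq_smul_hom h.smul_Q θ (by
        rw [← hdz, add_sub_cancel_left]; exact hz)
      rw [← this, one_smul]
    · rw [map_mul, Algebra.smul_def, ← mul_sub]
      exact Ideal.mul_mem_left _ _ hc
  · rw [← Category.assoc, htφ, Category.assoc, Category.assoc, ← End.mul_def, ← End.mul_def,
      ← map_mul, ← map_mul, hu, mul_smul_comm, smul_mul_assoc, mul_assoc, Units.inv_mul, mul_one]

/-- A deformation is represented by `φ` if and only if it is isomorphic to the base change of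
the tautological module along `φ`. -/
theorem isRep_iff {φ : LocHom O (End P) A.carrier}
    (hflat : IsFlatModule A.carrier ((CMod.taut P).baseChange φ.1).Carrier)
    (α : ((CMod.taut P).baseChange φ.1).reduction.obj ≅ Q)
    (hα : (CMod.taut P).tmul φ.1 1 ≫ ((CMod.taut P).baseChange φ.1).toReduction ≫ α.hom = θ)
    (D : Deformation Q A) :
    (defSetoid Q A).r ⟨(CMod.taut P).baseChange φ.1, hflat, α⟩ D ↔ IsRep θ φ D := by
  obtain ⟨φ, hφjac⟩ := φ
  change IsFlatModule A.carrier ((CMod.taut P).baseChange φ).Carrier at hflat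
  change ((CMod.taut P).baseChange φ).reduction.obj ≅ Q at α
  let τ : A.carrier → (P ⟶ ((CMod.taut P).baseChange φ).obj) := (CMod.taut P).tmul φ
  have hτρ : ∀ a b, τ b ≫ ((CMod.taut P).baseChange φ).ρ a = τ (a * b) := fun a b =>
    (CMod.taut P).tmul_tensorAct φ a b
  have hτr : ∀ a (r : End P), τ (a * φ r) = (r : P ⟶ P) ≫ τ a := fun a r =>
    (CMod.taut P).tmul_mul a r
  let D₀ : Deformation Q A := ⟨(CMod.taut P).baseChange φ, hflat, α⟩
  have hα' : τ 1 ≫ D₀.proj = θ := hα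
  constructor
  · rintro ⟨β, hβ, hβθ⟩
    refine ⟨τ 1 ≫ β.hom, ?_, fun r => ?_⟩
    · rw [Category.assoc]
      exact (congrArg (τ 1 ≫ ·) hβθ).trans hα'
    · have h1 := hτr 1 r
      rw [one_mul] at h1
      have h2 := hτρ (φ r) 1
      rw [mul_one, h1] at h2
      rw [← Category.assoc, ← h2, Category.assoc, Category.assoc]
      exact congrArg (τ 1 ≫ ·) (hβ (φ r))
  -- The isomorphism is `a ⊗ x ↦ a t(x)`. It carries the basis `1 ⊗ x i` to the `t (x i)`, which
  -- form a basis because `D` is flat.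
  · rintro ⟨t, ht, htφ⟩
    obtain ⟨β, hβ⟩ : ∃ β : ((CMod.taut P).baseChange φ).obj ⟶ D.M.obj,
        ∀ a, τ a ≫ β = t ≫ D.M.ρ a := by
      refine ⟨(CMod.taut P).desc (fun a => t ≫ D.M.ρ a) (fun a b => ?_) (fun a r => ?_),
        fun a => (CMod.taut P).tmul_desc _ _ _ a⟩
      · rw [map_add]
        exact Preadditive.comp_add _ _ _ _ _ _
      · rw [map_mul, End.mul_def]
        exact (Category.assoc _ _ _).symm.trans
          ((congrArg (· ≫ D.M.ρ a) (htφ r).symm).trans (Category.assoc _ _ _))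
    have hβρ : ∀ a, ((CMod.taut P).baseChange φ).ρ a ≫ β = β ≫ D.M.ρ a := fun a => by
      refine CMod.tensor_ext fun b => ?_
      change τ b ≫ ((CMod.taut P).baseChange φ).ρ a ≫ β = τ b ≫ β ≫ D.M.ρ a
      rw [← Category.assoc, hτρ, ← Category.assoc, hβ, hβ, map_mul, End.mul_def, Category.assoc]
    obtain ⟨n, hn⟩ := A.isArtAlgebra.exists_jacobson_pow_eq_bot
    obtain ⟨I, x, χ, hx⟩ := h.exists_residueBasis
    have hτ1 : τ 1 ≫ β = t := by
      rw [hβ, map_one]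
      exact Category.comp_id _
    have hy : IsResidueBasis ϖ (fun i => D.projLin (D.M.elem (ev t (x i)))) χ := by
      have : (fun i => D.projLin (D.M.elem (ev t (x i)))) = fun i => ev θ (x i) :=
        funext fun i => ev_congr ht (x i)
      rw [this]
      exact hx
    have hev : (fun i => D.M.elem (ev β (ev (τ 1) (x i)))) = fun i => ev t (x i) :=
      funext fun i => ev_congr hτ1 (x i)
    have hiso : IsIso β := isIso_of_linearIndependent (M := (CMod.taut P).baseChange φ) β hβρ
      (fun i => (CMod.taut P).oneTmul φ (x i))
      (h.span_oneTmul_eq_top hx φ (n := n) fun r hr => by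
        have := LocHom.map_jacobson_pow ⟨φ, hφjac⟩ n hr
        rwa [hn] at this)
      (by
        change LinearIndependent A.carrier (fun i => D.M.elem (ev β (ev (τ 1) (x i))))
        rw [hev]
        exact D.isReductionMap.linearIndependent hy A.isArtAlgebra D.flat)
      (by
        change Submodule.span A.carrier
          (Set.range fun i => D.M.elem (ev β (ev (τ 1) (x i)))) = ⊤
        rw [hev]
        exact D.isReductionMap.span_eq_top hy A.isArtAlgebra)
    refine ⟨asIso β, hβρ, CMod.tensor_ext fun a => ?_⟩
    change τ a ≫ β ≫ D.proj = τ a ≫ D₀.proj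
    obtain ⟨c, hc⟩ := (isArtAlgebra_iff.1 A.isArtAlgebra).2.exists_scalar a
    have h1 := hτρ a 1
    rw [mul_one] at h1
    rw [← Category.assoc, hβ, Category.assoc, D.ρ_proj hc, ← h1, Category.assoc]
    have h2 : ((CMod.taut P).baseChange φ).ρ a ≫ D₀.proj = c • D₀.proj := D₀.ρ_proj hc
    rw [h2, Linear.comp_smul, Linear.comp_smul, ht, hα']

/-- A lift to `D'` that is semilinear along `k ∘ φ` factors through a `k`-semilinear map `D → D'`.
Its linear extension `B ⊗ D → D'` carries a basis to a basis. Conversely, a lift to `D` is composed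
with `m ↦ 1 ⊗ m`. -/
theorem isRep_pushforward {φ : LocHom O (End P) A.carrier}
    (hflat : IsFlatModule A.carrier ((CMod.taut P).baseChange φ.1).Carrier)
    (α : ((CMod.taut P).baseChange φ.1).reduction.obj ≅ Q)
    (hα : (CMod.taut P).tmul φ.1 1 ≫ ((CMod.taut P).baseChange φ.1).toReduction ≫ α.hom = θ)
    (k : LocHom O A.carrier B.carrier) (hD : IsRep θ φ D) (D' : Deformation Q B) :
    IsRep θ (k.comp φ) D' ↔ IsPushforward k D D' := by
  constructor
  · rintro ⟨t', ht', htφ'⟩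
    have hD₀ := (h.isRep_iff hflat α hα D).2 hD
    obtain ⟨φ, hφjac⟩ := φ
    obtain ⟨k, hk⟩ := k
    obtain ⟨β₀, hβ₀, hβ₀θ⟩ := hD₀
    let τ : A.carrier → (P ⟶ ((CMod.taut P).baseChange φ).obj) := (CMod.taut P).tmul φ
    have hτρ : ∀ a b, τ b ≫ ((CMod.taut P).baseChange φ).ρ a = τ (a * b) := fun a b =>
      (CMod.taut P).tmul_tensorAct φ a b
    change ((CMod.taut P).baseChange φ).obj ≅ D.M.obj at β₀
    replace hβ₀ : ∀ a, ((CMod.taut P).baseChange φ).ρ a ≫ β₀.hom = β₀.hom ≫ D.M.ρ a := hβ₀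
    have hD1 : τ 1 ≫ β₀.hom ≫ D.proj = θ := (congrArg (τ 1 ≫ ·) hβ₀θ).trans hα
    obtain ⟨s₀, hs₀⟩ : ∃ s₀ : ((CMod.taut P).baseChange φ).obj ⟶ D'.M.obj,
        ∀ a, τ a ≫ s₀ = t' ≫ D'.M.ρ (k a) := by
      refine ⟨(CMod.taut P).desc (fun a => t' ≫ D'.M.ρ (k a)) (fun a b => ?_) (fun a r => ?_),
        fun a => (CMod.taut P).tmul_desc _ _ _ a⟩
      · rw [map_add, map_add]
        exact Preadditive.comp_add _ _ _ _ _ _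
      · rw [map_mul, map_mul, End.mul_def]
        exact (Category.assoc _ _ _).symm.trans
          ((congrArg (· ≫ D'.M.ρ (k a)) (htφ' r).symm).trans (Category.assoc _ _ _))
    have hs₀ρ : ∀ a, ((CMod.taut P).baseChange φ).ρ a ≫ s₀ = s₀ ≫ D'.M.ρ (k a) := fun a => by
      refine CMod.tensor_ext fun b => ?_
      change τ b ≫ ((CMod.taut P).baseChange φ).ρ a ≫ s₀ = τ b ≫ s₀ ≫ D'.M.ρ (k a)
      rw [← Category.assoc, hτρ, ← Category.assoc, hs₀, hs₀, map_mul, map_mul, End.mul_def,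
        Category.assoc]
    have hs₀1 : τ 1 ≫ s₀ = t' := by
      rw [hs₀, map_one, map_one]
      exact Category.comp_id _
    -- After identifying `D` with `A ⊗ P`, the map `s` is `a ⊗ x ↦ k(a) t'(x)`.
    let s : D.M.obj ⟶ D'.M.obj := β₀.inv ≫ s₀
    have hsρ : ∀ a, D.M.ρ a ≫ s = s ≫ D'.M.ρ (k a) := fun a => by
      have h1 : D.M.ρ a ≫ β₀.inv = β₀.inv ≫ ((CMod.taut P).baseChange φ).ρ a := by
        rw [Iso.comp_inv_eq, Category.assoc, hβ₀, Iso.inv_hom_id_assoc]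
      change D.M.ρ a ≫ β₀.inv ≫ s₀ = (β₀.inv ≫ s₀) ≫ D'.M.ρ (k a)
      rw [← Category.assoc, h1, Category.assoc, hs₀ρ, Category.assoc]
    let t : P ⟶ D.M.obj := τ 1 ≫ β₀.hom
    have ht : t ≫ D.proj = θ := (Category.assoc _ _ _).trans hD1
    have hts : t ≫ s = t' := by
      change (τ 1 ≫ β₀.hom) ≫ β₀.inv ≫ s₀ = t'
      rw [Category.assoc, Iso.hom_inv_id_assoc, hs₀1]
    have hsθ : s ≫ D'.proj = D.proj := by
      rw [← cancel_epi β₀.hom]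
      refine CMod.tensor_ext fun a => ?_
      change τ a ≫ β₀.hom ≫ (β₀.inv ≫ s₀) ≫ D'.proj = τ a ≫ β₀.hom ≫ D.proj
      obtain ⟨c, hc⟩ := (isArtAlgebra_iff.1 A.isArtAlgebra).2.exists_scalar a
      have hc' := hk _ hc
      rw [map_sub, AlgHom.commutes] at hc'
      rw [Category.assoc, Iso.hom_inv_id_assoc, ← Category.assoc, hs₀, Category.assoc,
        D'.ρ_proj hc', Linear.comp_smul, ht']
      have h1 := hτρ a 1
      rw [mul_one] at h1
      rw [← h1, Category.assoc, ← Category.assoc (CMod.ρ _ a), hβ₀, Category.assoc, D.ρ_proj hc,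
        Linear.comp_smul, Linear.comp_smul, hD1]
    let σ : B.carrier → (D.M.obj ⟶ (D.M.baseChange k).obj) := D.M.tmul k
    obtain ⟨β, hβ⟩ : ∃ β : (D.M.baseChange k).obj ⟶ D'.M.obj,
        ∀ b, σ b ≫ β = s ≫ D'.M.ρ b := by
      refine ⟨D.M.desc (fun b => s ≫ D'.M.ρ b) (fun a b => ?_) (fun b a => ?_),
        fun b => D.M.tmul_desc _ _ _ b⟩
      · rw [map_add]
        exact Preadditive.comp_add _ _ _ _ _ _
      · rw [map_mul, End.mul_def, ← Category.assoc, ← hsρ, Category.assoc]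
    have hβρ : ∀ b, (D.M.baseChange k).ρ b ≫ β = β ≫ D'.M.ρ b := fun b => by
      refine CMod.tensor_ext fun b' => ?_
      have h1 : σ b' ≫ (D.M.baseChange k).ρ b = σ (b * b') := D.M.tmul_tensorAct k b b'
      change σ b' ≫ (D.M.baseChange k).ρ b ≫ β = σ b' ≫ β ≫ D'.M.ρ b
      rw [← Category.assoc, h1, ← Category.assoc, hβ, hβ, map_mul, End.mul_def]
      exact (Category.assoc _ _ _).symm
    have hβ1 : σ 1 ≫ β = s := by
      rw [hβ, map_one]
      exact Category.comp_id _
    obtain ⟨I, x, χ, hx⟩ := h.exists_residueBasis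
    have hy : ∀ {A : ArtAlg ϖ} {D : Deformation Q A} {t : P ⟶ D.M.obj}, t ≫ D.proj = θ →
        IsResidueBasis ϖ (fun i => D.projLin (D.M.elem (ev t (x i)))) χ := fun {A D t} ht => by
      have : (fun i => D.projLin (D.M.elem (ev t (x i)))) = fun i => ev θ (x i) :=
        funext fun i => ev_congr ht (x i)
      rw [this]
      exact hx
    have hev : (fun i => D'.M.elem (ev β (ev (σ 1) (ev t (x i))))) =
        fun i => ev t' (x i) :=
      funext fun i => (ev_congr hβ1 _).trans (ev_congr hts (x i))
    have hiso : IsIso β := isIso_of_linearIndependent (M := D.M.baseChange k) β hβρ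
      (fun i => D.M.oneTmul k (ev t (x i)))
      (D.M.span_oneTmul k _
        (D.isReductionMap.span_eq_top (hy ht) A.isArtAlgebra))
      (by
        change LinearIndependent B.carrier
          (fun i => D'.M.elem (ev β (ev (σ 1) (ev t (x i)))))
        rw [hev]
        exact D'.isReductionMap.linearIndependent (hy ht') B.isArtAlgebra
          D'.flat)
      (by
        change Submodule.span B.carrier
          (Set.range fun i => D'.M.elem (ev β (ev (σ 1) (ev t (x i))))) = ⊤
        rw [hev]
        exact D'.isReductionMap.span_eq_top (hy ht') B.isArtAlgebra)
    refine ⟨asIso β, hβρ, ?_⟩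
    change σ 1 ≫ β ≫ D'.proj = D.proj
    rw [← Category.assoc, hβ1, hsθ]
  · rintro ⟨β, hβ, hβθ⟩
    obtain ⟨t, ht, htφ⟩ := hD
    obtain ⟨φ, hφjac⟩ := φ
    obtain ⟨k, hk⟩ := k
    let σ : B.carrier → (D.M.obj ⟶ (D.M.baseChange k).obj) := D.M.tmul k
    change (D.M.baseChange k).obj ≅ D'.M.obj at β
    replace hβ : ∀ b, (D.M.baseChange k).ρ b ≫ β.hom = β.hom ≫ D'.M.ρ b := hβ
    replace hβθ : σ 1 ≫ β.hom ≫ D'.proj = D.proj := hβθ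
    refine ⟨t ≫ σ 1 ≫ β.hom, ?_, fun r => ?_⟩
    · rw [Category.assoc, Category.assoc, hβθ, ht]
    · have h1 : σ (1 * k (φ r)) = D.M.ρ (φ r) ≫ σ 1 := D.M.tmul_mul (φ := k) 1 (φ r)
      have h2 : σ 1 ≫ (D.M.baseChange k).ρ (k (φ r)) = σ (k (φ r) * 1) :=
        D.M.tmul_tensorAct k _ 1
      rw [mul_one] at h2
      rw [one_mul] at h1
      change (r : P ⟶ P) ≫ t ≫ σ 1 ≫ β.hom = (t ≫ σ 1 ≫ β.hom) ≫ D'.M.ρ (k (φ r))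
      rw [← Category.assoc, htφ, Category.assoc, Category.assoc, Category.assoc, ← hβ,
        ← Category.assoc (σ 1), h2, h1, Category.assoc]

end IsHead
end Representability

/-! ### Homomorphisms to commutative algebras. -/

section CommutativeQuotient

variable {O : Type u} [CommRing O] {ϖ : O} {R A : Type u} [Ring R] [Algebra O R] [Ring A]
  [Algebra O A]

/-- `φ` kills all commutators and some `𝔪ⁿ`, and the closure lies in the sum of the commutator ideal
and `𝔪ⁿ`. -/
theorem LocHom.eq_zero_of_mem_commutatorClosure (φ : LocHom O R A) (hA : IsArtAlgebra ϖ A)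
    (hcomm : ∀ a b : A, a * b = b * a) {x : R} (hx : x ∈ commutatorClosure R) : φ.1 x = 0 := by
  obtain ⟨n, hn⟩ := hA.exists_jacobson_pow_eq_bot
  obtain ⟨y, hy, z, hz, rfl⟩ := Submodule.mem_sup.1 ((Submodule.mem_iInf _).1 hx n)
  have hz' := φ.map_jacobson_pow n hz
  rw [hn] at hz'
  have hy' : commutatorIdeal R ≤ RingHom.ker φ.1 := Ideal.span_le.2 (by
    rintro _ ⟨a, b, c, rfl⟩
    change φ.1 _ = 0
    rw [map_mul, map_sub, map_mul, map_mul, hcomm (φ.1 a), sub_self, zero_mul])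
  have h1 : φ.1 y = 0 := hy' hy
  rw [map_add, h1, (Submodule.mem_bot A).1 hz', add_zero]

theorem LocHom.ofAb_bijective (hR : IsLocalOver ϖ R) (hA : IsArtAlgebra ϖ A)
    (hcomm : ∀ a b : A, a * b = b * a) :
    Function.Bijective (LocHom.ofAb : LocHom O (Abelianized R) A → LocHom O R A) := by
  have := hR.isLocalRing
  refine ⟨fun ψ ψ' h => Subtype.ext (AlgHom.ext fun x => ?_), fun φ => ?_⟩
  · obtain ⟨x, rfl⟩ := Ideal.Quotient.mk_surjective x
    exact congrArg (fun φ : LocHom O R A => φ.1 x) h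
  · refine ⟨⟨Ideal.Quotient.liftₐ _ φ.1 fun x hx =>
      φ.eq_zero_of_mem_commutatorClosure hA hcomm hx, fun x hx => ?_⟩, ?_⟩
    · obtain ⟨x, rfl⟩ := Ideal.Quotient.mk_surjective x
      exact φ.2 x ((mk_mem_jacobson_iff hR.commutatorClosure_le x).1 hx)
    · exact Subtype.ext (AlgHom.ext fun x => rfl)

theorem ConjClass.mk_bijective (hcomm : ∀ a b : A, a * b = b * a) :
    Function.Bijective (Quotient.mk (conjSetoid O R A)) := by
  refine ⟨fun φ ψ h => ?_, Quotient.mk_surjective⟩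
  obtain ⟨u, hu⟩ := Quotient.exact h
  refine Subtype.ext (AlgHom.ext fun x => ?_)
  rw [hu, hcomm, ← mul_assoc, Units.inv_mul, one_mul]

end CommutativeQuotient

/-! ### The bijection between conjugacy classes and deformation classes. -/

section ClassMap

variable {O G : Type u} [CommRing O] [Group G] [TopologicalSpace G]
  {C : ObjectProperty (ProAug O G)} [IsDualCat C] {ϖ : O} {P Q : C.FullSubcategory}
  {ι : Type u} [Fintype ι] {θ : P ⟶ Q} {f : ι → End P}

theorem IsHead.exists_classMap (h : IsHead ϖ θ f) (hf : IsGradedFree θ f) :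
    ∃ F : ∀ A : ArtAlg ϖ, ConjClass O (End P) A.carrier → DefFunctor Q A,
      (∀ (A : ArtAlg ϖ) (φ : LocHom O (End P) A.carrier),
        ∃ (hflat : IsFlatModule A.carrier ((CMod.taut P).baseChange φ.1).Carrier)
          (α : ((CMod.taut P).baseChange φ.1).reduction.obj ≅ Q),
          (CMod.taut P).tmul φ.1 1 ≫
              ((CMod.taut P).baseChange φ.1).toReduction ≫ α.hom = θ ∧
            F A (Quotient.mk _ φ) = Quotient.mk _ ⟨(CMod.taut P).baseChange φ.1, hflat, α⟩) ∧
      (∀ A : ArtAlg ϖ, Function.Bijective (F A)) ∧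
      (∀ (A B : ArtAlg ϖ) (k : LocHom O A.carrier B.carrier)
        (φ : LocHom O (End P) A.carrier) (D : Deformation Q A) (D' : Deformation Q B),
        F A (Quotient.mk _ φ) = Quotient.mk _ D →
          (F B (Quotient.mk _ (k.comp φ)) = Quotient.mk _ D' ↔ IsPushforward k D D')) ∧
      (∀ A : ArtAlg ϖ, (∀ a b : A.carrier, a * b = b * a) →
        Function.Bijective fun ψ : LocHom O (Abelianized (End P)) A.carrier =>
          F A (Quotient.mk _ ψ.ofAb)) := by
  choose hflat α hα using fun (A : ArtAlg ϖ) (φ : LocHom O (End P) A.carrier) =>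
    h.exists_deformation hf φ
  let D₀ : ∀ A : ArtAlg ϖ, LocHom O (End P) A.carrier → Deformation Q A := fun A φ =>
    ⟨(CMod.taut P).baseChange φ.1, hflat A φ, α A φ⟩
  have hr : ∀ A φ D, (defSetoid Q A).r (D₀ A φ) D ↔ IsRep θ φ D := fun A φ D =>
    h.isRep_iff (hflat A φ) (α A φ) (hα A φ) D
  let F : ∀ A : ArtAlg ϖ, ConjClass O (End P) A.carrier → DefFunctor Q A := fun A =>
    Quotient.map (D₀ A) fun φ ψ hc => (hr A φ _).2
      (h.isRep_of_conj ((conjSetoid _ _ _).symm hc) ((hr A ψ _).1 ((defSetoid Q A).refl _)))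
  -- This equivalence reduces bijectivity and naturality of `F` to properties of `IsRep`.
  have hF : ∀ A φ D, F A (Quotient.mk _ φ) = Quotient.mk _ D ↔ IsRep θ φ D := fun A φ D =>
    Quotient.eq.trans (hr A φ D)
  have hbij : ∀ A, Function.Bijective (F A) := fun A => by
    constructor
    · intro x y
      induction x using Quotient.ind with | _ φ
      induction y using Quotient.ind with | _ ψ
      intro hxy
      exact Quotient.sound (h.conj_of_isRep ((hF A φ (D₀ A ψ)).1 hxy) ((hF A ψ _).1 rfl))
    · intro d
      induction d using Quotient.ind with | _ D
      obtain ⟨φ, hφ⟩ := h.exists_isRep D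
      exact ⟨Quotient.mk _ φ, (hF A φ D).2 hφ⟩
  refine ⟨F, fun A φ => ⟨hflat A φ, α A φ, hα A φ, rfl⟩, hbij, fun A B k φ D D' hD => ?_,
    fun A hcomm => ?_⟩
  · rw [hF] at hD ⊢
    exact h.isRep_pushforward (hflat A φ) (α A φ) (hα A φ) k hD D'
  · exact (hbij A).comp ((ConjClass.mk_bijective hcomm).comp
      (LocHom.ofAb_bijective h.isLocalOver A.isArtAlgebra hcomm))

end ClassMap

/-! ### Passage of the hypotheses from `C(k)` to `C(O)`. -/

section Hypotheses

variable {O G : Type u} [CommRing O] [Group G] [TopologicalSpace G]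
  {C : ObjectProperty (ProAug O G)} [IsDualCat C] {ϖ : O}
  {S Q : (killedBy C ϖ).FullSubcategory} {P : C.FullSubcategory} {κ : P ⟶ (incl C ϖ).obj S}

/-- An irreducible quotient of `Q` in `C(O)` is killed by `ϖ` because `Q` is, so (H1) in `C(k)`
controls all of them. -/
theorem IsCosocle.of_killedBy (hϖ : (Ideal.span {ϖ}).IsMaximal) (hS : Simple S)
    (hSend : Function.Surjective (algebraMap O (End S))) (hκ : IsProjectiveEnvelope κ)
    (H1 : ∀ S' : (killedBy C ϖ).FullSubcategory, Simple S' → IsEmpty (S ≅ S') →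
      ∀ f : Q ⟶ S', f = 0)
    (H2 : HasMultiplicityOne S.obj Q.obj) : IsCosocle ϖ κ ((incl C ϖ).obj Q) where
  envelope := hκ
  irred := (simple_iff.1 hS :)
  endo g := by
    obtain ⟨c, hc⟩ := hSend (inclPreimage g)
    exact ⟨c, full_ext fun x => (ev_congr hc x :)⟩
  maximal := hϖ
  smul_S := S.property.2
  smul_Q := Q.property.2
  simple_quotient X hX f hf := by
    have hs := hX.surjective hf
    let X' : (killedBy C ϖ).FullSubcategory := toKilled X fun x => by
      obtain ⟨y, rfl⟩ := hs x
      rw [← ev_smul, Q.property.2 y, ev_zero]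
    let f' : Q ⟶ X' := inclPreimage f
    by_contra h0
    have h1 : IsEmpty (S ≅ X') := ⟨fun e => h0 ⟨(incl C ϖ).mapIso e⟩⟩
    have h2 : f' = 0 := H1 X' (simple_iff.2 hX) h1 f'
    exact hf (full_ext fun x => (ev_congr h2 x :))
  multiplicity := H2

end Hypotheses
end ProAug

end

open ProAug
theorem mainTheorem11 {p : ℕ} [Fact p.Prime] {L : Type u} [Field L] [Algebra ℚ_[p] L]
    [FiniteDimensional ℚ_[p] L] [Algebra ℤ_[p] L] [IsScalarTower ℤ_[p] ℚ_[p] L]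
    {O : Type u} [CommRing O] [Algebra O L] [IsIntegralClosure O ℤ_[p] L]
    (ϖ : O) (hϖ : Irreducible ϖ)
    {G : Type u} [Group G] [TopologicalSpace G] [IsTopologicalGroup G]
    (hG : ∃ H : Subgroup G, IsOpen (H : Set G) ∧ IsProP p H)
    (C : ObjectProperty (ProAug O G)) [IsDualCat C]
    (S Q : (killedBy C ϖ).FullSubcategory)
    (hS : Simple S) (hSend : Function.Surjective (algebraMap O (End S)))
    (P : C.FullSubcategory) (κ : P ⟶ (incl C ϖ).obj S) (hκ : IsProjectiveEnvelope κ)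
    (hQ : IsFiniteLength Q.obj)
    (H0 : ∀ f : kernel (ϖ • 𝟙 P) ⟶ (incl C ϖ).obj (radical Q), f = 0)
    (H1 : ∀ S' : (killedBy C ϖ).FullSubcategory, Simple S' → IsEmpty (S ≅ S') →
      ∀ f : Q ⟶ S', f = 0)
    (H2 : HasMultiplicityOne S.obj Q.obj)
    (H3 : ∀ S' : (killedBy C ϖ).FullSubcategory, Simple S' → IsEmpty (S ≅ S') →
      ∀ e : Abelian.Ext.{u + 1} Q S' 1, e = 0)
    (H4 : Module.Finite O (Abelian.Ext.{u + 1} Q S 1))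
    (H5 : ∀ e : Abelian.Ext.{u + 1} Q (radical Q) 2, e = 0) :
    (∃ φ₀ : Q ⟶ S, φ₀ ≠ 0) ∧
    ∀ φ₀ : Q ⟶ S, φ₀ ≠ 0 →
      (∃ θ : P ⟶ (incl C ϖ).obj Q, θ ≫ (incl C ϖ).map φ₀ = κ) ∧
      ∀ θ : P ⟶ (incl C ϖ).obj Q, θ ≫ (incl C ϖ).map φ₀ = κ →
        IsProArtAlgebra ϖ (End P) ∧
        IsProArtAlgebra ϖ (Abelianized (End P)) ∧
        ∃ F : ∀ A : ArtAlg ϖ, ConjClass O (End P) A.carrier →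
            DefFunctor ((incl C ϖ).obj Q) A,
          (∀ (A : ArtAlg ϖ) (φ : LocHom O (End P) A.carrier),
            ∃ (hflat : IsFlatModule A.carrier ((CMod.taut P).baseChange φ.1).Carrier)
              (α : ((CMod.taut P).baseChange φ.1).reduction.obj ≅ (incl C ϖ).obj Q),
              (CMod.taut P).tmul φ.1 1 ≫
                  ((CMod.taut P).baseChange φ.1).toReduction ≫ α.hom = θ ∧
                F A (Quotient.mk _ φ) = Quotient.mk _ ⟨(CMod.taut P).baseChange φ.1, hflat, α⟩) ∧
          (∀ A : ArtAlg ϖ, Function.Bijective (F A)) ∧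
          (∀ (A B : ArtAlg ϖ) (f : LocHom O A.carrier B.carrier)
            (φ : LocHom O (End P) A.carrier) (D : Deformation ((incl C ϖ).obj Q) A)
            (D' : Deformation ((incl C ϖ).obj Q) B),
            F A (Quotient.mk _ φ) = Quotient.mk _ D →
              (F B (Quotient.mk _ (f.comp φ)) = Quotient.mk _ D' ↔ IsPushforward f D D')) ∧
          (∀ A : ArtAlg ϖ, (∀ a b : A.carrier, a * b = b * a) →
            Function.Bijective fun ψ : LocHom O (Abelianized (End P)) A.carrier =>
              F A (Quotient.mk _ ψ.ofAb)) := by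
  obtain ⟨-, hmax, hfin⟩ := isLocalRing_and_span_uniformizer (p := p) (L := L) ϖ hϖ
  have h := IsCosocle.of_killedBy hmax hS hSend hκ H1 H2
  refine ⟨?_, fun φ₀ hφ₀ => ⟨h.exists_theta fun h0 => hφ₀ ?_, fun θ hθ => ?_⟩⟩
  · obtain ⟨φ, hφ⟩ := h.exists_hom
    refine ⟨inclPreimage φ, fun h0 => hφ ?_⟩
    exact full_ext fun x => (ev_congr h0 x :)
  · exact full_ext fun x => (ev_congr h0 x :)
  have hR : ∀ f : P ⟶ (incl C ϖ).obj (radical Q), f = 0 := h.hom_radical_eq_zero hθ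
  -- From here on only the `C(O)`-version of (H5) and the generators of `ker θ` are needed.
  obtain ⟨hQR, ι, _, f, hf, hgen⟩ := exists_generators_and_extVanish h hθ hR H0 H3 H4 H5
  have hh := h.isHead hθ f hf hgen
  have hpro := hh.isProArtAlgebra
  exact ⟨hpro, hpro.abelianized, hh.exists_classMap fun n =>
    (hh.exists_graded_basis hR hQR (fun _ hP hY => h.hom_eq_zero hP hY) n).2⟩
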